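/- **Proposition 3.5.** Let $a,b\ge 0$ be integers, $m=-(a+2)(b+2)+3$, $n=(a+2)(b+3)-3$, and $$\mathcal A=A_{m,n}=\begin{pmatrix}0&1&0\\0&0&1\\1&-m&-n\end{pmatrix}\in SL(3,\mathbb Z).$$ *Terminology.* The planes spanned by pairs of linearly independent eigenvectors of $\mathcal A$ divide $\mathbb R^3$ into open orthants. The *sail* is the boundary of the convex hull $K$ of all nonzero integer points in the closure of the orthant containing $(0,0,1)$. Its faces are the nonempty proper faces of $K$ cut out by supporting planes (vertices, edges, and two-dimensional faces). Let $\Gamma$ be the group of integer operators of determinant one that commute with $\mathcal A$ and map the sail onto itself. Two faces are *equivalent* if an element of $\Gamma$ maps one to the other. The *torus triangulation* of $\mathcal A$ is the quotient of the sail by $\Gamma$ together with the images of the faces. A set of faces makes up a *fundamental region* if it contains exactly one face of each equivalence class; the closure of the region is the union of these (closed) faces. Put $$\begin{aligned} A&=(b^2+3b+3,\ b^2+2b-a+1,\ a^2b+3a^2+4ab+b^2+6a+5b+4),\\ B&=(b^2+5b+6,\ b^2+4b+4,\ b^2+3b+3),\\ C&=(-ab-2a-2b-1,\,1,\,0),\qquad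 D=(0,0,1),\\ E&=(b+4,\,b+3,\,b+2),\qquad F=(b+2,\,b+1,\,a+b+2),\qquad G=(1,1,1), \end{aligned}$$ $$X=\bigl((b+3)I-(b+2)\mathcal A^{-1}\bigr)\mathcal A^{-2},\qquad Y=\mathcal A^{-2}.$$ Then the following hold. 1. The characteristic polynomial of $\mathcal A$ is irreducible over $\mathbb Q$ and has three distinct real roots. 2. $X$ and $Y$ belong to $SL(3,\mathbb Z)$ and generate $\Gamma$, and $X^iY^j=I$ with $i,j\in\mathbb Z$ only if $i=j=0$. 3. The following faces of the sail make up a fundamental region: the vertices $D,F,G$; the edges $AB$, $AF$, $FD$, $BF$, $DG$, $EG$, $CG$ and, if $a\ge1$, also $BD$; the triangles $ABF$, $CDG$, $CEG$ and, if $a\ge 1$, the triangle $BDF$ and the quadrangle $BDGE$, while if $a=0$, the pentagon $BFDGE$. (For $a=0$ the triangle $BDF$ and the quadrangle $BDGE$ lie in one plane and together form this pentagon, of which $BD$ is a diagonal.) 4. The vertices of the sail that lie in the closure of this fundamental region are exactly $A,B,C,D,E,F,G$. 5. $X$ maps $A$ to $D$, $B$ to $C$, and the segment $AB$ to the segment $DC$.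 $Y$ maps $A$ to $B$, $F$ to $E$, $D$ to $C$, and the broken line $AFD$ to the broken line $BEC$. 6. The interior of the segment $BD$ contains exactly $b+1$ integer points. 7. The torus triangulation of $\mathcal A$ is homeomorphic to the following decomposition of $\mathbb R^2/\mathbb Z^2$. Place $A,B,C,D,E,F,G$ in the plane at $$(0,0),\ (0,1),\ (1,1),\ (1,0),\ (\tfrac12,1),\ (\tfrac12,0),\ (\tfrac34,\tfrac34)$$ respectively; the cells are the images in $\mathbb R^2/\mathbb Z^2$ of the points, segments and convex polygons with the same names as the faces listed in 3. That is, there is a homeomorphism from the quotient of the sail by $\Gamma$ onto $\mathbb R^2/\mathbb Z^2$ that maps, in each dimension $0,1,2$, the set of cells of the torus triangulation onto the set of cells of the model, and that maps the image of each face listed in 3 onto the model cell of the same name. -/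

import Mathlib

open scoped MatrixGroups

/-! ### Integer operators of three-dimensional space -/

/-- The linear action of `SL(3, ℤ)` on `ℝ³` (matrices act on column vectors). -/
noncomputable def act (M : SL(3, ℤ)) : (Fin 3 → ℝ) →ₗ[ℝ] (Fin 3 → ℝ) :=
  Matrix.toLin' ((M : Matrix (Fin 3) (Fin 3) ℤ).map (Int.cast : ℤ → ℝ))

theorem act_apply (M : SL(3, ℤ)) (v : Fin 3 → ℝ) :
    act M v = ((M : Matrix (Fin 3) (Fin 3) ℤ).map (Int.cast : ℤ → ℝ)).mulVec v := by
  simp [act]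

theorem act_one : act 1 = LinearMap.id := by
  have h : ((1 : Matrix (Fin 3) (Fin 3) ℤ).map (Int.cast : ℤ → ℝ)) = 1 :=
    Matrix.map_one _ Int.cast_zero Int.cast_one
  simp [act, h]

theorem act_mul (M N : SL(3, ℤ)) : act (M * N) = (act M).comp (act N) := by
  have h : (((M : Matrix (Fin 3) (Fin 3) ℤ) * (N : Matrix (Fin 3) (Fin 3) ℤ)).map
      (Int.cast : ℤ → ℝ)) = (M : Matrix (Fin 3) (Fin 3) ℤ).map (Int.cast : ℤ → ℝ) *
        (N : Matrix (Fin 3) (Fin 3) ℤ).map (Int.cast : ℤ → ℝ) :=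
    Matrix.map_mul (f := Int.castRingHom ℝ)
  simp only [act, Matrix.SpecialLinearGroup.coe_mul, h, Matrix.toLin'_mul]

theorem act_inv_act (M : SL(3, ℤ)) (v : Fin 3 → ℝ) : act M⁻¹ (act M v) = v := by
  rw [← LinearMap.comp_apply, ← act_mul, inv_mul_cancel, act_one, LinearMap.id_apply]

/-- The Frobenius operator `A_{m,n}`. -/
def frobeniusOp (m n : ℤ) : SL(3, ℤ) :=
  ⟨!![0, 1, 0; 0, 0, 1; 1, -m, -n], by simp [Matrix.det_fin_three]⟩

/-- The operator has an irreducible characteristic polynomial over `ℚ`, with three distinct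
real roots, so that it defines a two-dimensional continued fraction of a cubic irrationality. -/
def IsCubicIrrationality (A : SL(3, ℤ)) : Prop :=
  Irreducible ((A : Matrix (Fin 3) (Fin 3) ℤ).map (Int.cast : ℤ → ℚ)).charpoly ∧
  ((A : Matrix (Fin 3) (Fin 3) ℤ).map (Int.cast : ℤ → ℝ)).charpoly.roots.card = 3 ∧
  ((A : Matrix (Fin 3) (Fin 3) ℤ).map (Int.cast : ℤ → ℝ)).charpoly.roots.Nodup

/-! ### Sails -/

/-- The points of `ℝ³` with integer coordinates. -/
def integerPoints : Set (Fin 3 → ℝ) := {p | ∃ z : Fin 3 → ℤ, p = fun i => (z i : ℝ)}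

/-- `H` is a plane spanned by two linearly independent eigenvectors of `A`. -/
def IsEigenplane (A : SL(3, ℤ)) (H : Submodule ℝ (Fin 3 → ℝ)) : Prop :=
  ∃ u v : Fin 3 → ℝ, (∃ c : ℝ, act A u = c • u) ∧ (∃ c : ℝ, act A v = c • v) ∧
    LinearIndependent ℝ ![u, v] ∧ H = Submodule.span ℝ {u, v}

/-- The open orthant of the point `p`: its connected component in the complement of the
planes spanned by pairs of eigenvectors of `A`. -/
def orthant (A : SL(3, ℤ)) (p : Fin 3 → ℝ) : Set (Fin 3 → ℝ) :=
  connectedComponentIn {q | ∀ H, IsEigenplane A H → q ∉ H} p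

/-- The convex hull of the nonzero integer points of the closed orthant of `p`. -/
def sailHull (A : SL(3, ℤ)) (p : Fin 3 → ℝ) : Set (Fin 3 → ℝ) :=
  convexHull ℝ {q | q ∈ closure (orthant A p) ∧ q ∈ integerPoints ∧ q ≠ 0}

/-- The sail of `A` in the orthant of `p`. -/
def sail (A : SL(3, ℤ)) (p : Fin 3 → ℝ) : Set (Fin 3 → ℝ) :=
  frontier (sailHull A p)

/-- `F` is a `k`-dimensional (closed) face of the sail: a nonempty proper face of the convex
hull, cut out by a supporting plane, whose affine span has dimension `k`. -/
def IsSailFace (A : SL(3, ℤ)) (p : Fin 3 → ℝ) (k : ℕ) (F : Set (Fin 3 → ℝ)) : Prop :=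
  F.Nonempty ∧ F ≠ sailHull A p ∧ IsExposed ℝ (sailHull A p) F ∧
    Module.finrank ℝ (vectorSpan ℝ F) = k

/-- The group of integer operators of determinant one that commute with `A` and map the sail
onto itself. -/
def sailGroup (A : SL(3, ℤ)) (p : Fin 3 → ℝ) : Subgroup SL(3, ℤ) where
  carrier := {M | Commute M A ∧ act M '' sail A p = sail A p}
  mul_mem' := by
    rintro M N ⟨hM, hM'⟩ ⟨hN, hN'⟩
    refine ⟨hM.mul_left hN, ?_⟩
    rw [act_mul, LinearMap.coe_comp, Set.image_comp, hN', hM']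
  one_mem' := ⟨Commute.one_left A, by simp [act_one]⟩
  inv_mem' := by
    rintro M ⟨hM, hM'⟩
    refine ⟨hM.inv_left, ?_⟩
    conv_lhs => rw [← hM']
    rw [← Set.image_comp]
    have : (act M⁻¹ : (Fin 3 → ℝ) → _) ∘ act M = id := funext fun v => act_inv_act M v
    rw [this, Set.image_id]

/-- Two points of the sail are identified if an operator of the sail group maps one to the
other. -/
def sailSetoid (A : SL(3, ℤ)) (p : Fin 3 → ℝ) : Setoid (sail A p) where
  r x y := ∃ g ∈ sailGroup A p, act g (x : Fin 3 → ℝ) = y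
  iseqv :=
    { refl := fun x => ⟨1, one_mem _, by simp [act_one]⟩
      symm := by
        rintro x y ⟨g, hg, h⟩
        exact ⟨g⁻¹, inv_mem hg, by rw [← h, act_inv_act]⟩
      trans := by
        rintro x y z ⟨g, hg, h⟩ ⟨g', hg', h'⟩
        exact ⟨g' * g, mul_mem hg' hg, by rw [act_mul, LinearMap.comp_apply, h, h']⟩ }

/-- The quotient of the sail by its group, with the quotient topology. -/
abbrev SailQuotient (A : SL(3, ℤ)) (p : Fin 3 → ℝ) : Type := Quotient (sailSetoid A p)

/-- The image in the quotient of the part of the sail lying in `F`. -/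
def sailProj (A : SL(3, ℤ)) (p : Fin 3 → ℝ) (F : Set (Fin 3 → ℝ)) : Set (SailQuotient A p) :=
  (Quotient.mk (sailSetoid A p)) '' {x | (x : Fin 3 → ℝ) ∈ F}

/-- The torus triangulation of the sail: its `k`-dimensional closed cells are the images of the
`k`-dimensional faces of the sail. -/
def torusCells (A : SL(3, ℤ)) (p : Fin 3 → ℝ) (k : ℕ) : Set (Set (SailQuotient A p)) :=
  {c | ∃ F, IsSailFace A p k F ∧ c = sailProj A p F}

/-- `R` is the set of faces that make up a fundamental region (`R k` being its faces of
dimension `k`): it contains exactly one face of each equivalence class. -/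
def IsFundamentalRegion (A : SL(3, ℤ)) (p : Fin 3 → ℝ) (R : ℕ → Set (Set (Fin 3 → ℝ))) : Prop :=
  ∀ k, (∀ F ∈ R k, IsSailFace A p k F) ∧
    ∀ F, IsSailFace A p k F → ∃! F', F' ∈ R k ∧ ∃ g ∈ sailGroup A p, act g '' F' = F

/-! ### The family of operators -/

/-- The Frobenius operator with `m = -(a+2)(b+2)+3` and `n = (a+2)(b+3)-3`. -/
def familyOp (a b : ℕ) : SL(3, ℤ) :=
  frobeniusOp (-(((a : ℤ) + 2) * ((b : ℤ) + 2)) + 3) (((a : ℤ) + 2) * ((b : ℤ) + 3) - 3)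

/-- The matrix `((b+3) I - (b+2) A⁻¹) A⁻²`. -/
def periodMatrix (a b : ℕ) : Matrix (Fin 3) (Fin 3) ℤ :=
  ((b + 3 : ℤ) • (1 : Matrix (Fin 3) (Fin 3) ℤ)
      - (b + 2 : ℤ) • (((familyOp a b)⁻¹ : SL(3, ℤ)) : Matrix (Fin 3) (Fin 3) ℤ)) *
    (((familyOp a b) ^ (-2 : ℤ) : SL(3, ℤ)) : Matrix (Fin 3) (Fin 3) ℤ)

theorem coe_frobeniusOp_inv (m n : ℤ) :
    (((frobeniusOp m n)⁻¹ : SL(3, ℤ)) : Matrix (Fin 3) (Fin 3) ℤ) =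
      !![m, n, 1; 1, 0, 0; 0, 1, 0] := by
  rw [Matrix.SpecialLinearGroup.coe_inv, frobeniusOp, Matrix.adjugate_fin_three]
  simp

theorem det_periodMatrix (a b : ℕ) : (periodMatrix a b).det = 1 := by
  rw [periodMatrix, Matrix.det_mul, Matrix.SpecialLinearGroup.det_coe, mul_one, familyOp,
    coe_frobeniusOp_inv, Matrix.det_fin_three]
  simp only [Matrix.sub_apply, Matrix.smul_apply, Matrix.one_apply, Matrix.of_apply,
    Matrix.cons_val, smul_eq_mul]
  simp
  ring

/-- The first period, `((b+3) I - (b+2) A⁻¹) A⁻²`. -/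
def periodX (a b : ℕ) : SL(3, ℤ) := ⟨periodMatrix a b, det_periodMatrix a b⟩

/-- The second period, `A⁻²`. -/
def periodY (a b : ℕ) : SL(3, ℤ) := (familyOp a b) ^ (-2 : ℤ)

/-! ### The fundamental region and the model torus -/

/-- Names of the vertices of the closed fundamental region. -/
inductive Vtx : Type
  | A | B | C | D | E | F | G

/-- Integer coordinates of the vertices. -/
def vtxCoord (a b : ℤ) : Vtx → Fin 3 → ℤ
  | .A => ![b ^ 2 + 3 * b + 3, b ^ 2 + 2 * b - a + 1,
      a ^ 2 * b + 3 * a ^ 2 + 4 * a * b + b ^ 2 + 6 * a + 5 * b + 4]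
  | .B => ![b ^ 2 + 5 * b + 6, b ^ 2 + 4 * b + 4, b ^ 2 + 3 * b + 3]
  | .C => ![-(a * b) - 2 * a - 2 * b - 1, 1, 0]
  | .D => ![0, 0, 1]
  | .E => ![b + 4, b + 3, b + 2]
  | .F => ![b + 2, b + 1, a + b + 2]
  | .G => ![1, 1, 1]

/-- The vertices as points of `ℝ³`. -/
def vtx (a b : ℕ) (v : Vtx) : Fin 3 → ℝ := fun i => (vtxCoord a b v i : ℝ)

/-- The vertex sets of the cells of dimension `k`, one for each cell of the torus. For `a = 0`
the segment `BD` is a diagonal of the pentagon `BFDGE`; for `a ≥ 1` it is an edge, which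
separates the triangle `BDF` from the quadrangle `BDGE`. -/
def cells (a : ℕ) (k : ℕ) : Set (Set Vtx) :=
  {s | (k = 0 ∧ (s = {.D} ∨ s = {.F} ∨ s = {.G})) ∨
    (k = 1 ∧ (s = {.A, .B} ∨ s = {.A, .F} ∨ s = {.F, .D} ∨ s = {.B, .F} ∨ s = {.D, .G} ∨
      s = {.E, .G} ∨ s = {.C, .G} ∨ (1 ≤ a ∧ s = {.B, .D}))) ∨
    (k = 2 ∧ (s = {.A, .B, .F} ∨ s = {.C, .D, .G} ∨ s = {.C, .E, .G} ∨
      (1 ≤ a ∧ (s = {.B, .D, .F} ∨ s = {.B, .D, .G, .E})) ∨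
      (a = 0 ∧ s = {.B, .F, .D, .G, .E})))}

/-- The faces of the fundamental region, in each dimension. -/
def regionFaces (a b : ℕ) (k : ℕ) : Set (Set (Fin 3 → ℝ)) :=
  {F | ∃ s ∈ cells a k, F = convexHull ℝ (vtx a b '' s)}

/-- Positions of the vertices in the model: `ABCD` is the unit square, `E` and `F` are the
midpoints of two opposite sides, and `G` is an inner point. -/
noncomputable def modelVtx : Vtx → ℝ × ℝ
  | .A => (0, 0)
  | .B => (0, 1)
  | .C => (1, 1)
  | .D => (1, 0)
  | .E => (1 / 2, 1)
  | .F => (1 / 2, 0)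
  | .G => (3 / 4, 3 / 4)

/-- The cell of the standard torus `ℝ²/ℤ²` spanned by the model vertices in `s`. -/
def modelCell (s : Set Vtx) : Set (UnitAddCircle × UnitAddCircle) :=
  (fun q : ℝ × ℝ => ((q.1 : UnitAddCircle), (q.2 : UnitAddCircle))) ''
    convexHull ℝ (modelVtx '' s)

/-- The model decomposition of the standard torus. -/
def modelCells (a : ℕ) (k : ℕ) : Set (Set (UnitAddCircle × UnitAddCircle)) :=
  {c | ∃ s ∈ cells a k, c = modelCell s}

open scoped MatrixGroups

namespace FrobeniusSail

/-! ### Coordinates of the operators -/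

/-! The operator has three real eigenvalues, located well enough by sign changes of the cubic to
decide every inequality needed later. In the eigenbasis everything commuting with it is diagonal:
such an operator `g` is determined by its eigenvalues `eigVal`, equivalently by the image of `D`.
The orthant of `D` is the cone `openCone` where the three eigenforms are positive (`orthant_eq`). No
nonzero integer point lies on its boundary, since an eigenform at an integer point is a rational
polynomial of degree at most two in a cubic irrationality (`eigForm_ne_zero`).

The sail is found by guessing the five planes `facetForm = 1` and verifying the guess. All five
forms are positive on the eigenvectors (`facetForm_eigVec_pos`). The decisive identities are
`weight_ABF`, ..., `weight_CEG`. They write a vector in the basis of the vertices of one triangle,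
and each coefficient is a positive multiple of the difference between the form of the facet across
the opposite edge (possibly a translate by a period) and the form of the facet itself; across the
diagonals `BD` and `BG` it is a multiple of `lineBD` or `lineBG`. For a point of the cone only
finitely many values of translated forms are small, so one of them is minimal (`exists_minimizer`).
At a minimum these differences are nonnegative, and a suitable triangle has nonnegative
coefficients. Hence the cones over the translated triangles cover the orthant
(`exists_tri_of_mem_openCone`).

No integer point of the orthant lies below such a triangle (`one_le_sum_weight`), so every
translated facet form is at least `1` on the hull, and these inequalities describe it exactly
(`mem_hull_iff`). The sail is the locus where one of them is an equality (`mem_sail_iff`).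

An operator `g` of the sail group maps `D` to an extreme point, hence to a translate of one of the
seven vertices. The invariant `iterDet` separates the orbits of `D`, `F` and `G`, so `g D` is a
translate of `D` and `g` is a product of periods (`sailGroup_eq`). Logarithms of eigenvalues show
that the periods are independent.

Once a vertex is encoded by its orbit representative and a vector of `ℤ × ℤ`, the incidences of
faces become finite and are decided by computation. They depend on `a` only through whether `a = 0`.
A face lies in a translated facet (`exists_facet_of_face`) and is the hull of some of its vertices.
The relations between crossing diagonals exclude all sets of vertices but the expected ones
(`crossings_mem`).

For the torus, `param` maps the model square to the sail piecewise linearly. Two points of the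
square have images equivalent under the group exactly when they differ by an integer vector
(`param_add`, `eq_add_of_param_eq`). So the quotient of the sail and the standard torus are
quotients of one compact square with the same fibres. Both are Hausdorff, the first because the
group acts properly discontinuously, and they are therefore homeomorphic. -/

theorem act_familyOp (a b : ℕ) (v : Fin 3 → ℝ) :
    act (familyOp a b) v = ![v 1, v 2, v 0 - (-(((a : ℝ) + 2) * ((b : ℝ) + 2)) + 3) * v 1
      - (((a : ℝ) + 2) * ((b : ℝ) + 3) - 3) * v 2] := by
  rw [act_apply]
  funext i
  fin_cases i
  · simp [familyOp, frobeniusOp, Matrix.mulVec, dotProduct, Fin.sum_univ_three]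
  · simp [familyOp, frobeniusOp, Matrix.mulVec, dotProduct, Fin.sum_univ_three]
  · simp [familyOp, frobeniusOp, Matrix.mulVec, dotProduct, Fin.sum_univ_three]
    ring

theorem act_familyOp_inv (a b : ℕ) (v : Fin 3 → ℝ) :
    act (familyOp a b)⁻¹ v = ![(-(((a : ℝ) + 2) * ((b : ℝ) + 2)) + 3) * v 0
      + (((a : ℝ) + 2) * ((b : ℝ) + 3) - 3) * v 1 + v 2, v 0, v 1] := by
  rw [act_apply, familyOp, coe_frobeniusOp_inv]
  funext i
  fin_cases i <;>
    simp [Matrix.mulVec, dotProduct, Fin.sum_univ_three]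

theorem act_act_inv (M : SL(3, ℤ)) (v : Fin 3 → ℝ) : act M (act M⁻¹ v) = v := by
  simpa using act_inv_act M⁻¹ v

theorem act_mul_apply (M N : SL(3, ℤ)) (v : Fin 3 → ℝ) : act (M * N) v = act M (act N v) := by
  rw [act_mul, LinearMap.comp_apply]

theorem act_periodY (a b : ℕ) (v : Fin 3 → ℝ) :
    act (periodY a b) v = act (familyOp a b)⁻¹ (act (familyOp a b)⁻¹ v) := by
  rw [← act_mul_apply, periodY]
  congr 2
  group

theorem act_periodX (a b : ℕ) (v : Fin 3 → ℝ) :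
    act (periodX a b) v = ((b : ℝ) + 3) • act (periodY a b) v
      - ((b : ℝ) + 2) • act (familyOp a b)⁻¹ (act (periodY a b) v) := by
  simp only [act_apply]
  have h : ((periodX a b : SL(3, ℤ)) : Matrix (Fin 3) (Fin 3) ℤ).map (Int.cast : ℤ → ℝ) =
      (((b : ℝ) + 3) • (1 : Matrix (Fin 3) (Fin 3) ℝ) - ((b : ℝ) + 2) •
        (((familyOp a b)⁻¹ : SL(3, ℤ)) : Matrix (Fin 3) (Fin 3) ℤ).map (Int.cast : ℤ → ℝ)) *
        ((periodY a b : SL(3, ℤ)) : Matrix (Fin 3) (Fin 3) ℤ).map (Int.cast : ℤ → ℝ) := by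
    change (periodMatrix a b).map (Int.castRingHom ℝ) = _
    rw [periodMatrix, Matrix.map_mul]
    congr 1
    ext i j
    simp only [Matrix.map_apply, Matrix.sub_apply, Matrix.smul_apply, smul_eq_mul,
      Int.coe_castRingHom, Matrix.one_apply]
    push_cast
    rfl
  rw [h, ← Matrix.mulVec_mulVec, Matrix.sub_mulVec, Matrix.smul_mulVec, Matrix.smul_mulVec,
    Matrix.one_mulVec]

theorem commute_periodY (a b : ℕ) : Commute (periodY a b) (familyOp a b) :=
  (Commute.refl _).zpow_left _

theorem commute_periodX (a b : ℕ) : Commute (periodX a b) (familyOp a b) := by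
  have h : periodX a b * familyOp a b = familyOp a b * periodX a b := by
    apply Subtype.ext
    have h1 : (((familyOp a b) ^ (-2 : ℤ) : SL(3, ℤ)) : Matrix (Fin 3) (Fin 3) ℤ) *
        (familyOp a b : Matrix (Fin 3) (Fin 3) ℤ) = (familyOp a b : Matrix (Fin 3) (Fin 3) ℤ) *
        (((familyOp a b) ^ (-2 : ℤ) : SL(3, ℤ)) : Matrix (Fin 3) (Fin 3) ℤ) := by
      rw [← Matrix.SpecialLinearGroup.coe_mul, ← Matrix.SpecialLinearGroup.coe_mul]
      exact congrArg _ (commute_periodY a b)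
    have h2 : (((familyOp a b)⁻¹ : SL(3, ℤ)) : Matrix (Fin 3) (Fin 3) ℤ) *
        (familyOp a b : Matrix (Fin 3) (Fin 3) ℤ) = (familyOp a b : Matrix (Fin 3) (Fin 3) ℤ) *
        (((familyOp a b)⁻¹ : SL(3, ℤ)) : Matrix (Fin 3) (Fin 3) ℤ) := by
      rw [← Matrix.SpecialLinearGroup.coe_mul, ← Matrix.SpecialLinearGroup.coe_mul]
      simp
    change periodMatrix a b * (familyOp a b : Matrix (Fin 3) (Fin 3) ℤ) =
      (familyOp a b : Matrix (Fin 3) (Fin 3) ℤ) * periodMatrix a b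
    rw [periodMatrix, Matrix.mul_assoc, h1, ← Matrix.mul_assoc, ← Matrix.mul_assoc, Matrix.sub_mul,
      Matrix.mul_sub, Matrix.smul_mul, Matrix.smul_mul, Matrix.mul_smul, Matrix.mul_smul, h2]
    simp
  exact h

theorem commute_periods (a b : ℕ) : Commute (periodX a b) (periodY a b) :=
  (commute_periodX a b).zpow_right _

/-! ### The roots of the characteristic polynomial -/

/-- The cubic changes sign on each of three explicit intervals. Their endpoints are chosen so that
the forms and the eigenvalues of the periods have controllable signs: the first root stays above
`(b+2)/(b+3)`, which makes `X` positive, and the third one is about `-n`. -/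
theorem exists_roots (a b : ℕ) : ∃ r : Fin 3 → ℝ,
    (∀ k, r k ^ 3 + (((a : ℝ) + 2) * ((b : ℝ) + 3) - 3) * r k ^ 2
      + (-(((a : ℝ) + 2) * ((b : ℝ) + 2)) + 3) * r k - 1 = 0) ∧
    (b : ℝ) + 2 < (b + 3) * r 0 ∧ r 0 < 1 ∧
    -1 < (((a : ℝ) + 2) * (b + 2) - 2) * r 1 ∧ r 1 < 0 ∧
    -(((a : ℝ) + 2) * ((b : ℝ) + 3) - 2) < r 2 ∧ r 2 < -(((a : ℝ) + 2) * ((b : ℝ) + 3) - 3) := by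
  have ha : (0 : ℝ) ≤ a := a.cast_nonneg
  have hb : (0 : ℝ) ≤ b := b.cast_nonneg
  have hab : (0 : ℝ) ≤ a * b := mul_nonneg ha hb
  set f : ℝ → ℝ := fun x => x ^ 3 + (((a : ℝ) + 2) * ((b : ℝ) + 3) - 3) * x ^ 2
      + (-(((a : ℝ) + 2) * ((b : ℝ) + 2)) + 3) * x - 1 with hf
  have hc : Continuous f := by fun_prop
  -- Here the cubic takes the value `-1/(b+3)³`, which is the reason why `(b+3) I - (b+2) A⁻¹` has
  -- determinant one.
  have h1 : f (((b : ℝ) + 2) / (b + 3)) < 0 := by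
    have : f (((b : ℝ) + 2) / (b + 3)) = -(1 / (b + 3)) ^ 3 := by
      simp only [hf]; field_simp; ring
    rw [this]
    have : 0 < (1 / ((b : ℝ) + 3)) ^ 3 := by positivity
    linarith
  have h2 : 0 < f 1 := by simp only [hf]; nlinarith
  have hd : 0 < ((a : ℝ) + 2) * (b + 2) - 2 := by nlinarith
  have h3 : 0 < f (-(1 / (((a : ℝ) + 2) * (b + 2) - 2))) := by
    have : f (-(1 / (((a : ℝ) + 2) * (b + 2) - 2))) =
        (((a : ℝ) + 2) * ((b : ℝ) + 3) - 3 - (((a : ℝ) + 2) * (b + 2) - 2)) /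
          (((a : ℝ) + 2) * (b + 2) - 2) ^ 2 - 1 / (((a : ℝ) + 2) * (b + 2) - 2) ^ 3 := by
      simp only [hf]; field_simp; ring
    rw [this]
    have : (((a : ℝ) + 2) * ((b : ℝ) + 3) - 3 - (((a : ℝ) + 2) * (b + 2) - 2)) /
          (((a : ℝ) + 2) * (b + 2) - 2) ^ 2 - 1 / (((a : ℝ) + 2) * (b + 2) - 2) ^ 3 =
        ((a + 1) * (((a : ℝ) + 2) * (b + 2) - 2) - 1) / (((a : ℝ) + 2) * (b + 2) - 2) ^ 3 := by
      field_simp; ring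
    rw [this]
    apply div_pos _ (by positivity)
    nlinarith
  have h4 : f 0 < 0 := by simp [hf]
  have hn : 3 ≤ ((a : ℝ) + 2) * ((b : ℝ) + 3) - 3 := by nlinarith
  have h5 : f (-(((a : ℝ) + 2) * ((b : ℝ) + 3) - 2)) < 0 := by
    have : f (-(((a : ℝ) + 2) * ((b : ℝ) + 3) - 2)) = -((((a : ℝ) + 2) * ((b : ℝ) + 3) - 2) *
        (((a : ℝ) + 2) * ((b : ℝ) + 3) - 2 - (((a : ℝ) + 2) * (b + 2) - 3))) - 1 := by
      simp only [hf]; ring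
    rw [this]
    have := mul_pos (show 0 < ((a : ℝ) + 2) * ((b : ℝ) + 3) - 2 by linarith)
      (show 0 < ((a : ℝ) + 2) * ((b : ℝ) + 3) - 2 - (((a : ℝ) + 2) * (b + 2) - 3) by nlinarith)
    linarith
  have h6 : 0 < f (-(((a : ℝ) + 2) * ((b : ℝ) + 3) - 3)) := by
    have : f (-(((a : ℝ) + 2) * ((b : ℝ) + 3) - 3)) =
        (((a : ℝ) + 2) * ((b : ℝ) + 3) - 3) * (((a : ℝ) + 2) * (b + 2) - 3) - 1 := by
      simp only [hf]; ring
    rw [this]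
    nlinarith
  obtain ⟨x, hx, hx0⟩ := intermediate_value_Ioo (a := ((b : ℝ) + 2) / (b + 3)) (b := 1)
    (by rw [div_le_one (by positivity)]; linarith) hc.continuousOn ⟨h1, h2⟩
  obtain ⟨y, hy, hy0⟩ := intermediate_value_Ioo' (a := -(1 / (((a : ℝ) + 2) * (b + 2) - 2))) (b := 0)
    (by have := one_div_pos.2 hd; linarith) hc.continuousOn ⟨h4, h3⟩
  obtain ⟨z, hz, hz0⟩ := intermediate_value_Ioo (a := -(((a : ℝ) + 2) * ((b : ℝ) + 3) - 2))
    (b := -(((a : ℝ) + 2) * ((b : ℝ) + 3) - 3)) (by linarith) hc.continuousOn ⟨h5, h6⟩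
  refine ⟨![x, y, z], ?_, ?_, hx.2, ?_, hy.2, hz.1, hz.2⟩
  · intro k
    fin_cases k
    exacts [hx0, hy0, hz0]
  · have := (div_lt_iff₀ (show (0 : ℝ) < b + 3 by positivity)).1 hx.1
    simp only [Matrix.cons_val_zero]; linarith
  · have h := hy.1
    have := mul_lt_mul_of_pos_left h hd
    rw [mul_neg, mul_one_div_cancel hd.ne'] at this
    simpa using this

/-- The eigenvalues of `familyOp a b`. -/
noncomputable def root (a b : ℕ) : Fin 3 → ℝ := (exists_roots a b).choose

theorem root_eq (a b : ℕ) (k : Fin 3) :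
    root a b k ^ 3 + (((a : ℝ) + 2) * ((b : ℝ) + 3) - 3) * root a b k ^ 2
      + (-(((a : ℝ) + 2) * ((b : ℝ) + 2)) + 3) * root a b k - 1 = 0 :=
  (exists_roots a b).choose_spec.1 k

theorem lt_root_zero (a b : ℕ) : (b : ℝ) + 2 < (b + 3) * root a b 0 :=
  (exists_roots a b).choose_spec.2.1

theorem root_zero_lt (a b : ℕ) : root a b 0 < 1 := (exists_roots a b).choose_spec.2.2.1

theorem lt_root_one (a b : ℕ) : -1 < (((a : ℝ) + 2) * (b + 2) - 2) * root a b 1 :=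
  (exists_roots a b).choose_spec.2.2.2.1

theorem root_one_lt (a b : ℕ) : root a b 1 < 0 := (exists_roots a b).choose_spec.2.2.2.2.1

theorem root_two_lt (a b : ℕ) : root a b 2 < -(((a : ℝ) + 2) * ((b : ℝ) + 3) - 3) :=
  (exists_roots a b).choose_spec.2.2.2.2.2.2

theorem root_zero_pos (a b : ℕ) : 0 < root a b 0 := by
  have h := lt_root_zero a b
  have hb : (0 : ℝ) ≤ b := b.cast_nonneg
  by_contra hc
  push Not at hc
  nlinarith

theorem neg_one_lt_root_one (a b : ℕ) : -1 < 2 * root a b 1 := by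
  have h := lt_root_one a b
  have h' := root_one_lt a b
  have ha : (0 : ℝ) ≤ a := a.cast_nonneg
  have hb : (0 : ℝ) ≤ b := b.cast_nonneg
  nlinarith [mul_nonneg ha hb]

theorem root_two_lt_neg_three (a b : ℕ) : root a b 2 < -3 := by
  have h := root_two_lt a b
  have ha : (0 : ℝ) ≤ a := a.cast_nonneg
  have hb : (0 : ℝ) ≤ b := b.cast_nonneg
  nlinarith [mul_nonneg ha hb]

theorem root_lt_one (a b : ℕ) (k : Fin 3) : root a b k < 1 := by
  fin_cases k
  · exact root_zero_lt a b
  · exact (root_one_lt a b).trans one_pos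
  · exact (root_two_lt_neg_three a b).trans (by norm_num)

/-- Vieta's formula, obtained by eliminating the two lower coefficients from the three equations and
dividing by the Vandermonde product. -/
theorem sum_root (a b : ℕ) :
    root a b 0 + root a b 1 + root a b 2 = -(((a : ℝ) + 2) * ((b : ℝ) + 3) - 3) := by
  have h0 := root_eq a b 0
  have h1 := root_eq a b 1
  have h2 := root_eq a b 2
  have h01 : root a b 0 - root a b 1 ≠ 0 := by
    linarith [root_zero_pos a b, root_one_lt a b] |> fun h : 0 < root a b 0 - root a b 1 => h.ne'
  have h02 : root a b 0 - root a b 2 ≠ 0 := by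
    linarith [root_zero_pos a b, root_two_lt_neg_three a b] |>
      fun h : 0 < root a b 0 - root a b 2 => h.ne'
  have h12 : root a b 1 - root a b 2 ≠ 0 := by
    linarith [neg_one_lt_root_one a b, root_two_lt_neg_three a b] |>
      fun h : 0 < root a b 1 - root a b 2 => h.ne'
  apply mul_left_cancel₀ (mul_ne_zero (mul_ne_zero h01 h02) h12)
  linear_combination (root a b 1 - root a b 2) * h0 - (root a b 0 - root a b 2) * h1
    + (root a b 0 - root a b 1) * h2

/-! ### Eigenforms and eigenvectors -/

/-- The inverse of an eigenvalue. -/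
noncomputable def rootInv (a b : ℕ) (k : Fin 3) : ℝ :=
  root a b k ^ 2 + (((a : ℝ) + 2) * ((b : ℝ) + 3) - 3) * root a b k
    + (-(((a : ℝ) + 2) * ((b : ℝ) + 2)) + 3)

theorem root_mul_rootInv (a b : ℕ) (k : Fin 3) : root a b k * rootInv a b k = 1 := by
  have := root_eq a b k
  rw [rootInv]
  linear_combination this

theorem rootInv_ne_zero (a b : ℕ) (k : Fin 3) : rootInv a b k ≠ 0 := by
  intro h
  have := root_mul_rootInv a b k
  simp [h] at this

/-- The linear form with value `x, y, z` at the standard basis. -/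
def rowForm (x y z : ℝ) : (Fin 3 → ℝ) →ₗ[ℝ] ℝ :=
  x • LinearMap.proj 0 + y • LinearMap.proj 1 + z • LinearMap.proj 2

@[simp] theorem rowForm_apply (x y z : ℝ) (v : Fin 3 → ℝ) :
    rowForm x y z v = x * v 0 + y * v 1 + z * v 2 := by
  simp [rowForm]

/-- The eigenforms of the operator, normalized to `1` at `(0, 0, 1)`. -/
noncomputable def eigForm (a b : ℕ) (k : Fin 3) : (Fin 3 → ℝ) →ₗ[ℝ] ℝ :=
  rowForm (rootInv a b k) (root a b k + (((a : ℝ) + 2) * ((b : ℝ) + 3) - 3)) 1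

theorem eigForm_apply (a b : ℕ) (k : Fin 3) (v : Fin 3 → ℝ) :
    eigForm a b k v = rootInv a b k * v 0
      + (root a b k + (((a : ℝ) + 2) * ((b : ℝ) + 3) - 3)) * v 1 + v 2 := by
  simp [eigForm]

theorem eigForm_act_familyOp (a b : ℕ) (k : Fin 3) (v : Fin 3 → ℝ) :
    eigForm a b k (act (familyOp a b) v) = root a b k * eigForm a b k v := by
  have h := root_mul_rootInv a b k
  rw [act_familyOp, eigForm_apply, eigForm_apply]
  simp only [Matrix.cons_val]
  rw [rootInv] at *
  linear_combination (-v 0) * h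

theorem eigForm_act_familyOp_inv (a b : ℕ) (k : Fin 3) (v : Fin 3 → ℝ) :
    eigForm a b k (act (familyOp a b)⁻¹ v) = rootInv a b k * eigForm a b k v := by
  have h := eigForm_act_familyOp a b k (act (familyOp a b)⁻¹ v)
  rw [act_act_inv] at h
  rw [h, ← mul_assoc, mul_comm (rootInv a b k), root_mul_rootInv, one_mul]

theorem eigForm_act_periodY (a b : ℕ) (k : Fin 3) (v : Fin 3 → ℝ) :
    eigForm a b k (act (periodY a b) v) = rootInv a b k ^ 2 * eigForm a b k v := by
  rw [act_periodY, eigForm_act_familyOp_inv, eigForm_act_familyOp_inv]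
  ring

/-- The eigenvalues of the first period. -/
noncomputable def eigX (a b : ℕ) (k : Fin 3) : ℝ :=
  (((b : ℝ) + 3) - (b + 2) * rootInv a b k) * rootInv a b k ^ 2

theorem eigForm_act_periodX (a b : ℕ) (k : Fin 3) (v : Fin 3 → ℝ) :
    eigForm a b k (act (periodX a b) v) = eigX a b k * eigForm a b k v := by
  rw [act_periodX, map_sub, map_smul, map_smul, eigForm_act_familyOp_inv, eigForm_act_periodY, eigX,
    smul_eq_mul, smul_eq_mul]
  ring

/-- Clear for the two negative eigenvalues. For the positive one this is the lower bound
`(b+2)/(b+3)` on the root. -/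
theorem sub_rootInv_pos (a b : ℕ) (k : Fin 3) : 0 < ((b : ℝ) + 3) - (b + 2) * rootInv a b k := by
  have hb : (0 : ℝ) ≤ b := b.cast_nonneg
  have h := root_mul_rootInv a b k
  have hneg : ∀ k, root a b k < 0 → 0 < ((b : ℝ) + 3) - (b + 2) * rootInv a b k := by
    intro k hk
    have h := root_mul_rootInv a b k
    have : rootInv a b k < 0 := by
      by_contra hc
      push Not at hc
      nlinarith
    nlinarith
  fin_cases k
  · have h0 := lt_root_zero a b
    have h1 := root_zero_pos a b
    simp only [Fin.zero_eta] at h ⊢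
    by_contra hc
    push Not at hc
    nlinarith
  · exact hneg _ (root_one_lt a b)
  · exact hneg _ ((root_two_lt_neg_three a b).trans (by norm_num))

theorem eigX_pos (a b : ℕ) (k : Fin 3) : 0 < eigX a b k :=
  mul_pos (sub_rootInv_pos a b k) (by have := rootInv_ne_zero a b k; positivity)

/-- The derivative of the characteristic polynomial at the eigenvalues. -/
noncomputable def rootDeriv (a b : ℕ) : Fin 3 → ℝ :=
  ![(root a b 0 - root a b 1) * (root a b 0 - root a b 2),
    (root a b 1 - root a b 0) * (root a b 1 - root a b 2),
    (root a b 2 - root a b 0) * (root a b 2 - root a b 1)]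

theorem rootDeriv_zero_pos (a b : ℕ) : 0 < rootDeriv a b 0 :=
  mul_pos (by linarith [root_zero_pos a b, root_one_lt a b])
    (by linarith [root_zero_pos a b, root_two_lt_neg_three a b])

theorem rootDeriv_one_neg (a b : ℕ) : rootDeriv a b 1 < 0 :=
  mul_neg_of_neg_of_pos (by linarith [root_zero_pos a b, root_one_lt a b])
    (by linarith [neg_one_lt_root_one a b, root_two_lt_neg_three a b])

theorem rootDeriv_two_pos (a b : ℕ) : 0 < rootDeriv a b 2 :=
  mul_pos_of_neg_of_neg (by linarith [root_zero_pos a b, root_two_lt_neg_three a b])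
    (by linarith [neg_one_lt_root_one a b, root_two_lt_neg_three a b])

theorem rootDeriv_ne_zero (a b : ℕ) (k : Fin 3) : rootDeriv a b k ≠ 0 := by
  fin_cases k
  exacts [(rootDeriv_zero_pos a b).ne', (rootDeriv_one_neg a b).ne, (rootDeriv_two_pos a b).ne']

/-- The eigenvectors of the operator, dual to the eigenforms. -/
noncomputable def eigVec (a b : ℕ) (k : Fin 3) : Fin 3 → ℝ :=
  (rootDeriv a b k)⁻¹ • ![1, root a b k, root a b k ^ 2]

theorem root_pairs (a b : ℕ) : root a b 0 * root a b 1 + root a b 0 * root a b 2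
    + root a b 1 * root a b 2 = -(((a : ℝ) + 2) * ((b : ℝ) + 2)) + 3 := by
  have h0 := root_eq a b 0
  have h1 := root_eq a b 1
  have hs := sum_root a b
  have h01 : root a b 0 - root a b 1 ≠ 0 := by
    linarith [root_zero_pos a b, root_one_lt a b] |> fun h : 0 < root a b 0 - root a b 1 => h.ne'
  apply mul_left_cancel₀ h01
  linear_combination h1 - h0 + (root a b 0 ^ 2 - root a b 1 ^ 2) * hs

theorem eigForm_zero (a b : ℕ) (v : Fin 3 → ℝ) : eigForm a b 0 v =
    root a b 1 * root a b 2 * v 0 - (root a b 1 + root a b 2) * v 1 + v 2 := by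
  rw [eigForm_apply, rootInv]
  linear_combination (v 1 + root a b 0 * v 0) * sum_root a b - v 0 * root_pairs a b

theorem eigForm_one (a b : ℕ) (v : Fin 3 → ℝ) : eigForm a b 1 v =
    root a b 0 * root a b 2 * v 0 - (root a b 0 + root a b 2) * v 1 + v 2 := by
  rw [eigForm_apply, rootInv]
  linear_combination (v 1 + root a b 1 * v 0) * sum_root a b - v 0 * root_pairs a b

theorem eigForm_two (a b : ℕ) (v : Fin 3 → ℝ) : eigForm a b 2 v =
    root a b 0 * root a b 1 * v 0 - (root a b 0 + root a b 1) * v 1 + v 2 := by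
  rw [eigForm_apply, rootInv]
  linear_combination (v 1 + root a b 2 * v 0) * sum_root a b - v 0 * root_pairs a b

/-- Left and right eigenvectors of a companion matrix are dual after division by the derivative of
the characteristic polynomial (Lagrange interpolation). This gives coordinates in which commuting
operators are diagonal. -/
theorem sum_eigForm_smul_eigVec (a b : ℕ) (v : Fin 3 → ℝ) :
    ∑ k, eigForm a b k v • eigVec a b k = v := by
  have h01 : root a b 0 - root a b 1 ≠ 0 := by
    linarith [root_zero_pos a b, root_one_lt a b] |> fun h : 0 < root a b 0 - root a b 1 => h.ne'
  have h02 : root a b 0 - root a b 2 ≠ 0 := by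
    linarith [root_zero_pos a b, root_two_lt_neg_three a b] |>
      fun h : 0 < root a b 0 - root a b 2 => h.ne'
  have h12 : root a b 1 - root a b 2 ≠ 0 := by
    linarith [neg_one_lt_root_one a b, root_two_lt_neg_three a b] |>
      fun h : 0 < root a b 1 - root a b 2 => h.ne'
  rw [Fin.sum_univ_three, eigForm_zero, eigForm_one, eigForm_two]
  simp only [eigVec, rootDeriv, Matrix.cons_val]
  generalize root a b 0 = x at *
  generalize root a b 1 = y at *
  generalize root a b 2 = z at *
  have h10 : y - x ≠ 0 := by rwa [← neg_sub, neg_ne_zero]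
  have h20 : z - x ≠ 0 := by rwa [← neg_sub, neg_ne_zero]
  have h21 : z - y ≠ 0 := by rwa [← neg_sub, neg_ne_zero]
  funext i
  fin_cases i <;>
    simp only [Pi.add_apply, Pi.smul_apply, smul_eq_mul, Matrix.cons_val, Fin.zero_eta, Fin.mk_one,
      Fin.reduceFinMk] <;>
    field_simp <;> ring

theorem form_eq_sum (a b : ℕ) (φ : (Fin 3 → ℝ) →ₗ[ℝ] ℝ) (v : Fin 3 → ℝ) :
    φ v = ∑ k, eigForm a b k v * φ (eigVec a b k) := by
  conv_lhs => rw [← sum_eigForm_smul_eigVec a b v]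
  simp

theorem eigForm_ext (a b : ℕ) {v w : Fin 3 → ℝ} (h : ∀ k, eigForm a b k v = eigForm a b k w) :
    v = w := by
  rw [← sum_eigForm_smul_eigVec a b v, ← sum_eigForm_smul_eigVec a b w]
  simp [h]

theorem eigForm_eigVec (a b : ℕ) (j k : Fin 3) :
    eigForm a b j (eigVec a b k) = if j = k then 1 else 0 := by
  have h := rootDeriv_ne_zero a b k
  rw [eigVec, map_smul, smul_eq_mul, inv_mul_eq_iff_eq_mul₀ h]
  fin_cases j <;> fin_cases k <;>
    simp [eigForm_zero, eigForm_one, eigForm_two, rootDeriv] <;> ring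

theorem act_eigVec (a b : ℕ) (k : Fin 3) :
    act (familyOp a b) (eigVec a b k) = root a b k • eigVec a b k := by
  apply eigForm_ext a b
  intro j
  rw [eigForm_act_familyOp, map_smul, smul_eq_mul, eigForm_eigVec]
  split_ifs with h
  · rw [h]
  · simp

theorem act_periodX_eigVec (a b : ℕ) (k : Fin 3) :
    act (periodX a b) (eigVec a b k) = eigX a b k • eigVec a b k := by
  apply eigForm_ext a b
  intro j
  rw [eigForm_act_periodX, map_smul, smul_eq_mul, eigForm_eigVec]
  split_ifs with h
  · rw [h]
  · simp

/-! ### The open cone -/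

/-- The open orthant of the operator that contains `(0, 0, 1)`. -/
def openCone (a b : ℕ) : Set (Fin 3 → ℝ) := {v | ∀ k, 0 < eigForm a b k v}

theorem continuous_eigForm (a b : ℕ) (k : Fin 3) : Continuous (eigForm a b k) :=
  (eigForm a b k).continuous_of_finiteDimensional

theorem isOpen_openCone (a b : ℕ) : IsOpen (openCone a b) := by
  rw [openCone, Set.ofPred_forall]
  exact isOpen_iInter_of_finite fun k => isOpen_lt continuous_const (continuous_eigForm a b k)

theorem add_mem_openCone {a b : ℕ} {v w : Fin 3 → ℝ} (hv : v ∈ openCone a b)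
    (hw : w ∈ openCone a b) : v + w ∈ openCone a b := fun k => by
  rw [map_add]; exact add_pos (hv k) (hw k)

theorem smul_mem_openCone {a b : ℕ} {v : Fin 3 → ℝ} {c : ℝ} (hc : 0 < c)
    (hv : v ∈ openCone a b) : c • v ∈ openCone a b := fun k => by
  rw [map_smul]; exact mul_pos hc (hv k)

theorem convex_openCone (a b : ℕ) : Convex ℝ (openCone a b) := by
  rw [openCone, Set.ofPred_forall]
  exact convex_iInter fun k => convex_halfSpace_gt (eigForm a b k).isLinear 0

/-- The points of the cone are the positive combinations of the eigenvectors, so it suffices to test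
three vectors. -/
theorem form_pos {a b : ℕ} {φ : (Fin 3 → ℝ) →ₗ[ℝ] ℝ} (hφ : ∀ k, 0 < φ (eigVec a b k))
    {v : Fin 3 → ℝ} (hv : v ∈ openCone a b) : 0 < φ v := by
  rw [form_eq_sum a b]
  exact Finset.sum_pos (fun k _ => mul_pos (hv k) (hφ k)) Finset.univ_nonempty

theorem mem_openCone_act_periodX {a b : ℕ} {v : Fin 3 → ℝ} :
    act (periodX a b) v ∈ openCone a b ↔ v ∈ openCone a b := by
  simp only [openCone, Set.mem_ofPred_eq, eigForm_act_periodX, mul_pos_iff_of_pos_left (eigX_pos a b _)]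

theorem mem_openCone_act_periodY {a b : ℕ} {v : Fin 3 → ℝ} :
    act (periodY a b) v ∈ openCone a b ↔ v ∈ openCone a b := by
  have h : ∀ k, 0 < rootInv a b k ^ 2 := fun k => by have := rootInv_ne_zero a b k; positivity
  simp only [openCone, Set.mem_ofPred_eq, eigForm_act_periodY, mul_pos_iff_of_pos_left (h _)]

/-! ### Vertices -/

instance : DecidableEq Vtx := fun x y => by
  cases x <;> cases y <;> first | exact isTrue rfl | exact isFalse (fun h => nomatch h)

instance : Fintype Vtx := ⟨{.A, .B, .C, .D, .E, .F, .G}, fun x => by cases x <;> decide⟩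

theorem sum_vtx {M : Type*} [AddCommMonoid M] (f : Vtx → M) :
    ∑ v, f v = f .A + (f .B + (f .C + (f .D + (f .E + (f .F + f .G))))) := by
  have h : (Finset.univ : Finset Vtx) = {.A, .B, .C, .D, .E, .F, .G} := rfl
  rw [h]
  repeat rw [Finset.sum_insert (by decide)]
  rw [Finset.sum_singleton]

theorem vtx_A (a b : ℕ) : vtx a b .A = ![(b : ℝ) ^ 2 + 3 * b + 3, (b : ℝ) ^ 2 + 2 * b - a + 1,
    (a : ℝ) ^ 2 * b + 3 * a ^ 2 + 4 * a * b + b ^ 2 + 6 * a + 5 * b + 4] := by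
  funext i; fin_cases i <;> simp [vtx, vtxCoord]

theorem vtx_B (a b : ℕ) : vtx a b .B = ![(b : ℝ) ^ 2 + 5 * b + 6, (b : ℝ) ^ 2 + 4 * b + 4,
    (b : ℝ) ^ 2 + 3 * b + 3] := by
  funext i; fin_cases i <;> simp [vtx, vtxCoord]

theorem vtx_C (a b : ℕ) : vtx a b .C = ![-((a : ℝ) * b) - 2 * a - 2 * b - 1, 1, 0] := by
  funext i; fin_cases i <;> simp [vtx, vtxCoord]

theorem vtx_D (a b : ℕ) : vtx a b .D = ![(0 : ℝ), 0, 1] := by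
  funext i; fin_cases i <;> simp [vtx, vtxCoord]

theorem vtx_E (a b : ℕ) : vtx a b .E = ![(b : ℝ) + 4, (b : ℝ) + 3, (b : ℝ) + 2] := by
  funext i; fin_cases i <;> simp [vtx, vtxCoord]

theorem vtx_F (a b : ℕ) : vtx a b .F = ![(b : ℝ) + 2, (b : ℝ) + 1, (a : ℝ) + b + 2] := by
  funext i; fin_cases i <;> simp [vtx, vtxCoord]

theorem vtx_G (a b : ℕ) : vtx a b .G = ![(1 : ℝ), 1, 1] := by
  funext i; fin_cases i <;> simp [vtx, vtxCoord]

theorem act_periodX_apply (a b : ℕ) (v : Fin 3 → ℝ) : act (periodX a b) v =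
    ((b : ℝ) + 3) • act (familyOp a b)⁻¹ (act (familyOp a b)⁻¹ v)
      - ((b : ℝ) + 2) • act (familyOp a b)⁻¹ (act (familyOp a b)⁻¹ (act (familyOp a b)⁻¹ v)) := by
  rw [act_periodX, act_periodY]

theorem act_periodX_A (a b : ℕ) : act (periodX a b) (vtx a b .A) = vtx a b .D := by
  rw [act_periodX_apply, vtx_A, vtx_D]
  simp only [act_familyOp_inv]
  funext i; fin_cases i <;> simp <;> ring

theorem act_periodX_B (a b : ℕ) : act (periodX a b) (vtx a b .B) = vtx a b .C := by
  rw [act_periodX_apply, vtx_B, vtx_C]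
  simp only [act_familyOp_inv]
  funext i; fin_cases i <;> simp <;> ring

theorem act_periodY_A (a b : ℕ) : act (periodY a b) (vtx a b .A) = vtx a b .B := by
  rw [act_periodY, vtx_A, vtx_B]
  simp only [act_familyOp_inv]
  funext i; fin_cases i <;> simp <;> ring

theorem act_periodY_F (a b : ℕ) : act (periodY a b) (vtx a b .F) = vtx a b .E := by
  rw [act_periodY, vtx_F, vtx_E]
  simp only [act_familyOp_inv]
  funext i; fin_cases i <;> simp <;> ring

theorem act_periodY_D (a b : ℕ) : act (periodY a b) (vtx a b .D) = vtx a b .C := by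
  rw [act_periodY, vtx_D, vtx_C]
  simp only [act_familyOp_inv]
  funext i; fin_cases i <;> simp
  ring

/-- `D` has all eigenforms equal to `1`. The periods have positive eigenvalues and carry this to
`A`, `B`, `C`, and carry `F` to `E`. For `F` and `G` an eigenform times a positive factor is
computed to be `1 - root` and `a + 2`. -/
theorem vtx_mem_openCone (a b : ℕ) (v : Vtx) : vtx a b v ∈ openCone a b := by
  have hD : vtx a b .D ∈ openCone a b := fun k => by
    rw [vtx_D, eigForm_apply]; simp
  have hC : vtx a b .C ∈ openCone a b := by
    rw [← act_periodY_D]; exact mem_openCone_act_periodY.2 hD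
  have hA : vtx a b .A ∈ openCone a b := by
    rw [← mem_openCone_act_periodX, act_periodX_A]; exact hD
  have hB : vtx a b .B ∈ openCone a b := by
    rw [← act_periodY_A]; exact mem_openCone_act_periodY.2 hA
  have hF : vtx a b .F ∈ openCone a b := fun k => by
    have h1 := root_mul_rootInv a b k
    have h2 : eigForm a b k (vtx a b .F) * ((b + 3) - (b + 2) * rootInv a b k) =
        1 - root a b k := by
      have h3 := root_eq a b k
      rw [vtx_F, eigForm_apply]
      simp only [Matrix.cons_val]
      rw [rootInv] at *
      generalize root a b k = x at *
      linear_combination (-((a : ℝ) * b ^ 3) - 7 * a * b ^ 2 - 16 * a * b - 12 * a - 2 * b ^ 3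
        - 12 * b ^ 2 - 23 * b - 14 - (b + 2) ^ 2 * x) * h3
    have := sub_rootInv_pos a b k
    have h3 := root_lt_one a b k
    by_contra hc
    push Not at hc
    nlinarith
  have hE : vtx a b .E ∈ openCone a b := by
    rw [← act_periodY_F]; exact mem_openCone_act_periodY.2 hF
  have hG : vtx a b .G ∈ openCone a b := fun k => by
    have h2 : eigForm a b k (vtx a b .G) * (1 - root a b k) = a + 2 := by
      have h3 := root_eq a b k
      rw [vtx_G, eigForm_apply]
      simp only [Matrix.cons_val]
      rw [rootInv] at *
      linear_combination -h3
    have h3 := root_lt_one a b k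
    have ha : (0 : ℝ) ≤ a := a.cast_nonneg
    by_contra hc
    push Not at hc
    nlinarith
  cases v <;> assumption

/-! ### Facets -/

/-- The facets of the fundamental region. -/
inductive Facet : Type
  | ABF | CDG | CEG | BDF | BDGE

instance : DecidableEq Facet := fun x y => by
  cases x <;> cases y <;> first | exact isTrue rfl | exact isFalse (fun h => nomatch h)

instance : Fintype Facet := ⟨{.ABF, .CDG, .CEG, .BDF, .BDGE}, fun x => by cases x <;> decide⟩

/-- The linear forms with value `1` on the facets. -/
noncomputable def facetForm (a b : ℕ) : Facet → (Fin 3 → ℝ) →ₗ[ℝ] ℝ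
  -- `X` maps `A` and `B` to `D` and `C`, where the sum of the last two coordinates is `1`; the
  -- image of `F` gives `1` too.
  | .ABF => (rowForm 0 1 1).comp (act (periodX a b))
  | .CDG => ((a : ℝ) * b + 2 * a + 2 * b + 2)⁻¹ • rowForm (-1) 1 (a * b + 2 * a + 2 * b + 2)
  | .CEG => ((a : ℝ) * b + 2 * a + 2 * b + 3)⁻¹ • rowForm (-(b + 2))
      (b + 3 - (b + 1) * (a * b + 2 * a + 2 * b + 2)) ((b + 2) * (a * b + 2 * a + 2 * b + 2))
  | .BDF => rowForm (-(a * b + 2 * a + b + 1)) (a * b + 3 * a + b + 1) 1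
  | .BDGE => rowForm (-(b + 1)) (b + 1) 1

/-- The derivative of the cubic has signs `+, -, +` at the roots, so positivity on the normalized
eigenvectors means the sign pattern `+, -, +` on the vectors `(1, r, r²)`. -/
theorem pos_of_signs {a b : ℕ} {φ : (Fin 3 → ℝ) →ₗ[ℝ] ℝ}
    (h0 : 0 < φ ![1, root a b 0, root a b 0 ^ 2]) (h1 : φ ![1, root a b 1, root a b 1 ^ 2] < 0)
    (h2 : 0 < φ ![1, root a b 2, root a b 2 ^ 2]) (k : Fin 3) : 0 < φ (eigVec a b k) := by
  rw [eigVec, map_smul, smul_eq_mul]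
  fin_cases k
  · exact mul_pos (inv_pos.2 (rootDeriv_zero_pos a b)) h0
  · exact mul_pos_of_neg_of_neg (inv_lt_zero.2 (rootDeriv_one_neg a b)) h1
  · exact mul_pos (inv_pos.2 (rootDeriv_two_pos a b)) h2

-- This puts the orthant on the positive side of all the candidate facet planes. Evaluated on `(1,
-- r, r²)`, each form is a quadratic polynomial in a root, whose sign follows from the location of
-- the root.
set_option maxHeartbeats 800000 in
theorem facetForm_eigVec_pos (a b : ℕ) (i : Facet) (k : Fin 3) :
    0 < facetForm a b i (eigVec a b k) := by
  have ha : (0 : ℝ) ≤ a := a.cast_nonneg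
  have hb : (0 : ℝ) ≤ b := b.cast_nonneg
  have hab : (0 : ℝ) ≤ a * b := mul_nonneg ha hb
  have x0 := lt_root_zero a b
  have x1 := root_zero_lt a b
  have x2 := root_zero_pos a b
  have y0 := lt_root_one a b
  have y1 := root_one_lt a b
  have y2 := neg_one_lt_root_one a b
  have yeq := root_eq a b 1
  have z0 := root_two_lt a b
  have z1 := root_two_lt_neg_three a b
  -- In terms of `d` the cubic has coefficients `d + a + 1` and `-(d - 1)`, and the bound on the
  -- second root reads `-1 < d * y`.
  obtain ⟨d, hd⟩ : ∃ d : ℝ, d = a * b + 2 * a + 2 * b + 2 := ⟨_, rfl⟩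
  have hd2 : 2 ≤ d := by linarith
  have y0' : -1 < d * root a b 1 := by rw [hd]; linarith
  have yeq' : root a b 1 ^ 3 + (d + a + 1) * root a b 1 ^ 2 - (d - 1) * root a b 1 - 1 = 0 := by
    rw [hd]; linear_combination yeq
  have z0' : root a b 2 < -(d + a + 1) := by rw [hd]; linarith
  -- This is positivity of the form of `BDGE` at the first root. It follows by expanding in powers
  -- of `(b+3) x - (b+2) > 0`.
  have hq : ∀ x : ℝ, (b : ℝ) + 2 < (b + 3) * x → 0 < x → (b + 1) * (1 - x) < x ^ 2 := by
    intro x hx hx0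
    have e : ((b : ℝ) + 3) ^ 2 * (x ^ 2 - (b + 1) * (1 - x)) =
      1 + ((b + 3) * x - (b + 2)) ^ 2 + ((b + 3) * x - (b + 2)) * (2 * (b + 2) + (b + 1) * (b + 3)) := by
      ring
    have e' : 0 < ((b : ℝ) + 3) ^ 2 * (x ^ 2 - (b + 1) * (1 - x)) := by
      have := sub_pos.2 hx
      rw [e]; positivity
    exact sub_pos.1 (pos_of_mul_pos_right e' (by positivity))
  have hq0 := hq _ x0 x2
  have hysq : root a b 1 ^ 2 < 1 := by nlinarith
  generalize hx : root a b 0 = x at *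
  generalize hy : root a b 1 = y at *
  generalize hz : root a b 2 = z at *
  cases i with
  | ABF =>
    rw [facetForm, LinearMap.comp_apply, act_periodX_eigVec, map_smul, smul_eq_mul]
    refine mul_pos (eigX_pos a b k) (pos_of_signs ?_ ?_ ?_ k)
    · rw [hx]; simp; positivity
    · rw [hy]; simp; nlinarith
    · rw [hz]; simp; nlinarith
  | CDG =>
    rw [facetForm, ← hd, LinearMap.smul_apply, smul_eq_mul]
    refine mul_pos (by positivity) (pos_of_signs ?_ ?_ ?_ k)
    · rw [hx]; simp; nlinarith
    · rw [hy]; simp; nlinarith [sq_nonneg y, mul_nonneg ha (sq_nonneg y)]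
    · rw [hz]; simp; nlinarith
  | CEG =>
    rw [facetForm, ← hd, LinearMap.smul_apply, smul_eq_mul]
    refine mul_pos (by positivity) (pos_of_signs ?_ ?_ ?_ k)
    · rw [hx]; simp
      have e1 : (b + 3) * (-2 + -(b : ℝ) + (b + 3 - (b + 1) * d) * x + (b + 2) * d * x ^ 2) =
        ((b + 3) * x - (b + 2)) * ((b + 3) + (b + 2) * d * x) + d * x := by ring
      have e2 : 0 < ((b + 3) * x - (b + 2)) * ((b + 3) + (b + 2) * d * x) + d * x := by
        have := sub_pos.2 x0
        positivity
      rw [← e1] at e2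
      exact pos_of_mul_pos_right e2 (by positivity)
    · rw [hy]; simp
      have e1 : (b + 2 : ℝ) * d * y ^ 2 = (b + 2) * (1 - y ^ 3 + (d - 1) * y - (a + 1) * y ^ 2) := by
        linear_combination (b + 2 : ℝ) * yeq'
      rw [e1]
      have e3 : -y ^ 3 < y ^ 2 := by nlinarith [sq_nonneg y]
      have e4 : (b + 2 : ℝ) * (-y ^ 3 - (a + 1) * y ^ 2) < 0 :=
        mul_neg_of_pos_of_neg (by positivity) (by nlinarith [mul_nonneg ha (sq_nonneg y)])
      nlinarith [mul_nonneg ha (sq_nonneg y), mul_pos_of_neg_of_neg y1 y1]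
    · rw [hz]; simp
      nlinarith [mul_nonneg hb (sq_nonneg z), mul_nonneg hb (by linarith : 0 ≤ d)]
  | BDF =>
    refine pos_of_signs ?_ ?_ ?_ k
    · rw [hx]; simp only [facetForm, rowForm_apply, Matrix.cons_val]
      linarith [mul_nonneg ha (sub_pos.2 x0).le]
    · rw [hy]; simp only [facetForm, rowForm_apply, Matrix.cons_val]
      have hy' : (0 : ℝ) ≤ -y := by linarith
      linarith [mul_nonneg hab hy', mul_nonneg ha hy', mul_nonneg hb hy', hysq]
    · rw [hz]; simp only [facetForm, rowForm_apply, Matrix.cons_val]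
      have e1 : z + (a * b + 3 * a + b + 1) < -(b + 1) := by rw [hd] at z0'; linarith
      have e2 : z < -(a * b + 2 * a + b + 1) := by rw [hd] at z0'; linarith
      linarith [mul_pos (sub_pos.2 e1) (by linarith : (0:ℝ) < -z),
        mul_nonneg hb (by linarith : (0 : ℝ) ≤ -z)]
  | BDGE =>
    refine pos_of_signs ?_ ?_ ?_ k
    · rw [hx]; simp only [facetForm, rowForm_apply, Matrix.cons_val]
      linarith
    · rw [hy]; simp only [facetForm, rowForm_apply, Matrix.cons_val]
      linarith [mul_nonneg hb (by linarith : (0:ℝ) ≤ -y)]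
    · rw [hz]; simp only [facetForm, rowForm_apply, Matrix.cons_val]
      have e2 : z + (b + 1) < -1 := by rw [hd] at z0'; linarith
      linarith [mul_pos (sub_pos.2 e2) (by linarith : (0:ℝ) < -z)]

/-! ### The local structure of the facets -/

/-- The triangles that subdivide the fundamental region. -/
inductive Tri : Type
  | ABF | BDF | BDG | BGE | CDG | CEG

/-- The vertices of a triangle. -/
def Tri.verts : Tri → Finset Vtx
  | .ABF => {.A, .B, .F}
  | .BDF => {.B, .D, .F}
  | .BDG => {.B, .D, .G}
  | .BGE => {.B, .G, .E}
  | .CDG => {.C, .D, .G}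
  | .CEG => {.C, .E, .G}

/-- The vertices of a facet; for `a = 0` the triangle `BDF` and the quadrangle `BDGE` merge into a
pentagon. -/
def facetVerts (a : ℕ) : Facet → Finset Vtx
  | .ABF => {.A, .B, .F}
  | .CDG => {.C, .D, .G}
  | .CEG => {.C, .E, .G}
  | .BDF => if a = 0 then {.B, .F, .D, .G, .E} else {.B, .D, .F}
  | .BDGE => if a = 0 then {.B, .F, .D, .G, .E} else {.B, .D, .G, .E}

/-- Nonnegative weights supported on `S`. -/
def IsWeight (S : Finset Vtx) (w : Vtx → ℝ) : Prop := (∀ v, 0 ≤ w v) ∧ ∀ v, v ∉ S → w v = 0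

/-- The form vanishing on the line `BD` and equal to `1` at `F`. -/
def lineBD (b : ℕ) : (Fin 3 → ℝ) →ₗ[ℝ] ℝ := rowForm (b + 2) (-(b + 3)) 0

/-- A form vanishing on the line `BG` and positive at `D`. -/
def lineBG (b : ℕ) : (Fin 3 → ℝ) →ₗ[ℝ] ℝ := rowForm (b + 1) (-(2 * b + 3)) (b + 2)

/-- The two planes through `BD` differ by `a` times the form vanishing there. For `a = 0` they
coincide, which is why the pentagon appears, and why `BD` needs a form of its own in the barycentric
coordinates. -/
theorem facetForm_BDGE_sub (a b : ℕ) (v : Fin 3 → ℝ) :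
    facetForm a b .BDGE v - facetForm a b .BDF v = a * lineBD b v := by
  simp only [facetForm, lineBD, rowForm_apply]; ring

/-! ### Barycentric coordinates as differences of neighbouring facet forms -/

section Barycentric

variable (a b : ℕ) (v : Fin 3 → ℝ)

/-- The difference of the forms of two facets vanishes on their common edge, so up to scale it is
the coordinate of the opposite vertex. Across `BF` lies `BDF`; across `AF`, the preimage of `BDGE`
under `Y`; across `AB`, the preimage of `CDG` under `X`. The scale is found by evaluating at the
vertex. -/
theorem weight_ABF :
    ((facetForm a b .BDF v - facetForm a b .ABF v) / ((a : ℝ) * b + 2 * a + 2 * b + 1))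
        • vtx a b .A +
      (facetForm a b .BDGE (act (periodY a b) v) - facetForm a b .ABF v) • vtx a b .B +
      ((facetForm a b .CDG (act (periodX a b) v) - facetForm a b .ABF v)
        * ((a : ℝ) * b + 2 * a + 2 * b + 2)) • vtx a b .F = v := by
  have h1 : ((a : ℝ) * b + 2 * a + 2 * b + 1) ≠ 0 := by positivity
  have h2 : ((a : ℝ) * b + 2 * a + 2 * b + 2) ≠ 0 := by positivity
  rw [vtx_A, vtx_B, vtx_F, act_periodY]
  simp only [facetForm, LinearMap.comp_apply, act_periodX_apply, act_familyOp_inv,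
    LinearMap.smul_apply, rowForm_apply, smul_eq_mul, Pi.sub_apply, Pi.smul_apply, Matrix.cons_val]
  funext i
  fin_cases i <;>
    simp only [Pi.add_apply, Pi.smul_apply, smul_eq_mul, Matrix.cons_val, Fin.zero_eta, Fin.mk_one,
      Fin.reduceFinMk] <;>
    field_simp <;> ring

/-- Across `DF` lies the preimage of `CEG` under `Y`, and across `BF` the triangle `ABF`. The edge
`BD` is measured by `lineBD`, which also works when `a = 0`. -/
theorem weight_BDF :
    ((facetForm a b .CEG (act (periodY a b) v) - facetForm a b .BDF v)
        * ((a : ℝ) * b + 2 * a + 2 * b + 3) / ((b + 2) * ((a : ℝ) * b + 2 * a + 2 * b + 2)))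
        • vtx a b .B +
      ((facetForm a b .ABF v - facetForm a b .BDF v)
        / ((b + 2) * ((a : ℝ) * b + 2 * a + 2 * b + 1))) • vtx a b .D +
      lineBD b v • vtx a b .F = v := by
  have h1 : ((a : ℝ) * b + 2 * a + 2 * b + 1) ≠ 0 := by positivity
  have h2 : ((a : ℝ) * b + 2 * a + 2 * b + 2) ≠ 0 := by positivity
  have h3 : ((a : ℝ) * b + 2 * a + 2 * b + 3) ≠ 0 := by positivity
  have h4 : (b : ℝ) + 2 ≠ 0 := by positivity
  rw [vtx_B, vtx_D, vtx_F, act_periodY]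
  simp only [facetForm, LinearMap.comp_apply, act_periodX_apply, act_familyOp_inv, lineBD,
    LinearMap.smul_apply, rowForm_apply, smul_eq_mul, Pi.sub_apply, Pi.smul_apply, Matrix.cons_val]
  funext i
  fin_cases i <;>
    simp only [Pi.add_apply, Pi.smul_apply, smul_eq_mul, Matrix.cons_val, Fin.zero_eta, Fin.mk_one,
      Fin.reduceFinMk] <;>
    field_simp <;> ring

/-- Only `DG` is always a true edge here, with `CDG` on the other side. `BG` is a diagonal, and so
is `BD` when `a = 0`. -/
theorem weight_BDG :
    ((facetForm a b .CDG v - facetForm a b .BDGE v) * ((a : ℝ) * b + 2 * a + 2 * b + 2)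
        / ((b + 2) * ((a : ℝ) * b ^ 2 + 3 * a * b + 2 * a + 2 * b ^ 2 + 4 * b + 1))) • vtx a b .B +
      (lineBG b v / (b + 2)) • vtx a b .D + (-lineBD b v) • vtx a b .G = v := by
  have h1 : ((a : ℝ) * b ^ 2 + 3 * a * b + 2 * a + 2 * b ^ 2 + 4 * b + 1) ≠ 0 := by positivity
  have h2 : ((a : ℝ) * b + 2 * a + 2 * b + 2) ≠ 0 := by positivity
  have h4 : (b : ℝ) + 2 ≠ 0 := by positivity
  rw [vtx_B, vtx_D, vtx_G]
  simp only [facetForm, lineBD, lineBG,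
    LinearMap.smul_apply, rowForm_apply, smul_eq_mul]
  funext i
  fin_cases i <;>
    simp only [Pi.add_apply, Pi.smul_apply, smul_eq_mul, Matrix.cons_val, Fin.zero_eta, Fin.mk_one,
      Fin.reduceFinMk] <;>
    field_simp <;> ring

/-- Across `GE` lies `CEG`, across `BE` the image of `ABF` under `Y`; `BG` is a diagonal. -/
theorem weight_BGE :
    ((facetForm a b .CEG v - facetForm a b .BDGE v) * ((a : ℝ) * b + 2 * a + 2 * b + 3)
        / ((a : ℝ) * b ^ 2 + 3 * a * b + 2 * a + 2 * b ^ 2 + 4 * b + 1)) • vtx a b .B +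
      (facetForm a b .ABF (act (periodY a b)⁻¹ v) - facetForm a b .BDGE v) • vtx a b .G +
      (-lineBG b v) • vtx a b .E = v := by
  have h1 : ((a : ℝ) * b ^ 2 + 3 * a * b + 2 * a + 2 * b ^ 2 + 4 * b + 1) ≠ 0 := by positivity
  have h3 : ((a : ℝ) * b + 2 * a + 2 * b + 3) ≠ 0 := by positivity
  -- Since `X = ((b+3) I - (b+2) A⁻¹) Y`, the inverse of `Y` cancels.
  have h5 : act (periodX a b) (act (periodY a b)⁻¹ v) =
      ((b : ℝ) + 3) • v - ((b : ℝ) + 2) • act (familyOp a b)⁻¹ v := by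
    rw [act_periodX, act_act_inv]
  rw [facetForm, LinearMap.comp_apply, h5, vtx_B, vtx_G, vtx_E]
  simp only [facetForm, lineBG, act_familyOp_inv,
    LinearMap.smul_apply, rowForm_apply, smul_eq_mul, Pi.sub_apply, Pi.smul_apply, Matrix.cons_val]
  funext i
  fin_cases i <;>
    simp only [Pi.add_apply, Pi.smul_apply, smul_eq_mul, Matrix.cons_val, Fin.zero_eta, Fin.mk_one,
      Fin.reduceFinMk] <;>
    field_simp <;> ring

theorem weight_CDG :
    ((facetForm a b .BDGE v - facetForm a b .CDG v)
        / ((a : ℝ) * b ^ 2 + 3 * a * b + 2 * a + 2 * b ^ 2 + 4 * b + 1)) • vtx a b .C +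
      ((facetForm a b .CEG v - facetForm a b .CDG v) * ((a : ℝ) * b + 2 * a + 2 * b + 3)
        / ((a : ℝ) * b ^ 2 + 3 * a * b + 2 * a + 2 * b ^ 2 + 4 * b + 1)) • vtx a b .D +
      (facetForm a b .ABF (act (periodX a b)⁻¹ v) - facetForm a b .CDG v) • vtx a b .G = v := by
  have h1 : ((a : ℝ) * b ^ 2 + 3 * a * b + 2 * a + 2 * b ^ 2 + 4 * b + 1) ≠ 0 := by positivity
  have h2 : ((a : ℝ) * b + 2 * a + 2 * b + 2) ≠ 0 := by positivity
  have h3 : ((a : ℝ) * b + 2 * a + 2 * b + 3) ≠ 0 := by positivity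
  rw [facetForm, LinearMap.comp_apply, act_act_inv, vtx_C, vtx_D, vtx_G]
  simp only [facetForm,
    LinearMap.smul_apply, rowForm_apply, smul_eq_mul]
  funext i
  fin_cases i <;>
    simp only [Pi.add_apply, Pi.smul_apply, smul_eq_mul, Matrix.cons_val, Fin.zero_eta, Fin.mk_one,
      Fin.reduceFinMk] <;>
    field_simp <;> ring

theorem weight_CEG :
    ((facetForm a b .BDGE v - facetForm a b .CEG v)
        / ((a : ℝ) * b ^ 2 + 3 * a * b + 2 * a + 2 * b ^ 2 + 4 * b + 1)) • vtx a b .C +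
      ((facetForm a b .CDG v - facetForm a b .CEG v) * ((a : ℝ) * b + 2 * a + 2 * b + 2)
        / ((a : ℝ) * b ^ 2 + 3 * a * b + 2 * a + 2 * b ^ 2 + 4 * b + 1)) • vtx a b .E +
      ((facetForm a b .BDF (act (periodY a b)⁻¹ v) - facetForm a b .CEG v)
        / ((a : ℝ) * b + 2 * a + 2 * b + 2)) • vtx a b .G = v := by
  have h1 : ((a : ℝ) * b ^ 2 + 3 * a * b + 2 * a + 2 * b ^ 2 + 4 * b + 1) ≠ 0 := by positivity
  have h2 : ((a : ℝ) * b + 2 * a + 2 * b + 2) ≠ 0 := by positivity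
  have h3 : ((a : ℝ) * b + 2 * a + 2 * b + 3) ≠ 0 := by positivity
  have h5 : (periodY a b)⁻¹ = familyOp a b * familyOp a b := by
    rw [periodY, zpow_neg, inv_inv]; exact zpow_two _
  rw [vtx_C, vtx_E, vtx_G, h5, act_mul_apply]
  simp only [facetForm, act_familyOp,
    LinearMap.smul_apply, rowForm_apply, smul_eq_mul, Matrix.cons_val]
  funext i
  fin_cases i <;>
    simp only [Pi.add_apply, Pi.smul_apply, smul_eq_mul, Matrix.cons_val, Fin.zero_eta, Fin.mk_one,
      Fin.reduceFinMk] <;>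
    field_simp <;> ring

end Barycentric

theorem facetForm_vtx {a b : ℕ} {i : Facet} {v : Vtx} (h : v ∈ facetVerts a i) :
    facetForm a b i (vtx a b v) = 1 := by
  have h2 : ((a : ℝ) * b + 2 * a + 2 * b + 2) ≠ 0 := by positivity
  have h3 : ((a : ℝ) * b + 2 * a + 2 * b + 3) ≠ 0 := by positivity
  cases i with
  | ABF =>
    simp only [facetVerts, Finset.mem_insert, Finset.mem_singleton] at h
    rcases h with rfl | rfl | rfl <;>
      simp only [facetForm, LinearMap.comp_apply, act_periodX_A, act_periodX_B]
    · rw [vtx_D]; simp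
    · rw [vtx_C]; simp
    · rw [act_periodX_apply, vtx_F]
      simp only [act_familyOp_inv, rowForm_apply, Pi.sub_apply, Pi.smul_apply, Matrix.cons_val,
        smul_eq_mul]
      ring
  | CDG =>
    simp only [facetVerts, Finset.mem_insert, Finset.mem_singleton] at h
    rcases h with rfl | rfl | rfl <;> simp [facetForm, vtx_C, vtx_D, vtx_G] <;> (field_simp; try ring)
  | CEG =>
    simp only [facetVerts, Finset.mem_insert, Finset.mem_singleton] at h
    rcases h with rfl | rfl | rfl <;> simp [facetForm, vtx_C, vtx_E, vtx_G] <;> field_simp <;> ring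
  | BDF =>
    rcases eq_or_ne a 0 with rfl | ha
    · simp only [facetVerts, if_true, Finset.mem_insert, Finset.mem_singleton] at h
      rcases h with rfl | rfl | rfl | rfl | rfl <;>
        simp [facetForm, vtx_B, vtx_D, vtx_E, vtx_F, vtx_G] <;> ring
    · simp only [facetVerts, if_neg ha, Finset.mem_insert, Finset.mem_singleton] at h
      rcases h with rfl | rfl | rfl <;>
        simp [facetForm, vtx_B, vtx_D, vtx_F] <;> ring
  | BDGE =>
    rcases eq_or_ne a 0 with rfl | ha
    · simp only [facetVerts, if_true, Finset.mem_insert, Finset.mem_singleton] at h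
      rcases h with rfl | rfl | rfl | rfl | rfl <;>
        simp [facetForm, vtx_B, vtx_D, vtx_E, vtx_F, vtx_G] <;> ring
    · simp only [facetVerts, if_neg ha, Finset.mem_insert, Finset.mem_singleton] at h
      rcases h with rfl | rfl | rfl | rfl <;>
        simp [facetForm, vtx_B, vtx_D, vtx_E, vtx_G] <;> ring

/-- The group generated by the periods. -/
def periodGroup (a b : ℕ) : Subgroup SL(3, ℤ) := Subgroup.closure {periodX a b, periodY a b}

theorem periodX_mem (a b : ℕ) : periodX a b ∈ periodGroup a b :=
  Subgroup.subset_closure (by simp)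

theorem periodY_mem (a b : ℕ) : periodY a b ∈ periodGroup a b :=
  Subgroup.subset_closure (by simp)

theorem exists_isWeight {E : Type*} [AddCommGroup E] [Module ℝ E] {f : Vtx → E} {p q r : Vtx}
    {x y z : ℝ} {v : E} (hx : 0 ≤ x) (hy : 0 ≤ y) (hz : 0 ≤ z)
    (h : x • f p + y • f q + z • f r = v) :
    ∃ w, IsWeight {p, q, r} w ∧ ∑ u, w u • f u = v := by
  refine ⟨Pi.single p x + Pi.single q y + Pi.single r z, ⟨fun u => ?_, fun u hu => ?_⟩, ?_⟩
  · have h0 : ∀ (s : Vtx) (c : ℝ), 0 ≤ c → 0 ≤ (Pi.single s c : Vtx → ℝ) u := fun s c hc => by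
      rw [Pi.single_apply]; split_ifs <;> simp [hc]
    exact add_nonneg (add_nonneg (h0 _ _ hx) (h0 _ _ hy)) (h0 _ _ hz)
  · simp only [Finset.mem_insert, Finset.mem_singleton, not_or] at hu
    simp [hu.1, hu.2.1, hu.2.2]
  · rw [← h]
    simp [add_smul, Finset.sum_add_distrib, Pi.single_apply, ite_smul]

/-- At a minimum over all translated forms the differences in the barycentric identities are
nonnegative. The remaining coefficients are settled by the signs of `lineBD` and `lineBG`, which
select a triangle of the quadrangle or pentagon. -/
theorem exists_tri_weight {a b : ℕ} {v : Fin 3 → ℝ} {i : Facet}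
    (hmin : ∀ h ∈ periodGroup a b, ∀ j, facetForm a b i v ≤ facetForm a b j (act h v)) :
    ∃ t : Tri, t.verts ⊆ facetVerts a i ∧ ∃ w, IsWeight t.verts w ∧ ∑ u, w u • vtx a b u = v := by
  have hsub := facetForm_BDGE_sub a b v
  have hone : ∀ i, (∀ h ∈ periodGroup a b, ∀ j, facetForm a b i v ≤ facetForm a b j (act h v)) →
      ∀ j, 0 ≤ facetForm a b j v - facetForm a b i v := fun i hmin j => by
    have := hmin 1 (one_mem _) j
    rw [act_one] at this
    exact sub_nonneg.2 this
  have hBDF : (∀ h ∈ periodGroup a b, ∀ j, facetForm a b .BDF v ≤ facetForm a b j (act h v)) →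
      0 ≤ lineBD b v → ∃ w, IsWeight Tri.BDF.verts w ∧ ∑ u, w u • vtx a b u = v := fun hm hl => by
    refine exists_isWeight ?_ ?_ hl (weight_BDF a b v)
    · have := sub_nonneg.2 (hm _ (periodY_mem a b) .CEG)
      positivity
    · have := hone _ hm .ABF
      positivity
  have hBDGE : (∀ h ∈ periodGroup a b, ∀ j, facetForm a b .BDGE v ≤ facetForm a b j (act h v)) →
      lineBD b v ≤ 0 → (∃ w, IsWeight Tri.BDG.verts w ∧ ∑ u, w u • vtx a b u = v) ∨
        ∃ w, IsWeight Tri.BGE.verts w ∧ ∑ u, w u • vtx a b u = v := fun hm hl => by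
    rcases le_total 0 (lineBG b v) with h | h
    · left
      refine exists_isWeight ?_ ?_ (neg_nonneg.2 hl) (weight_BDG a b v)
      · have := hone _ hm .CDG
        positivity
      · positivity
    · right
      refine exists_isWeight ?_ ?_ (neg_nonneg.2 h) (weight_BGE a b v)
      · have := hone _ hm .CEG
        positivity
      · exact sub_nonneg.2 (hm _ (inv_mem (periodY_mem a b)) .ABF)
  have ha : (0 : ℝ) ≤ a := a.cast_nonneg
  cases i with
  | ABF =>
    refine ⟨.ABF, subset_rfl, exists_isWeight ?_ ?_ ?_ (weight_ABF a b v)⟩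
    · have := hone _ hmin .BDF
      positivity
    · exact sub_nonneg.2 (hmin _ (periodY_mem a b) _)
    · have := sub_nonneg.2 (hmin _ (periodX_mem a b) .CDG)
      positivity
  | CDG =>
    refine ⟨.CDG, subset_rfl, exists_isWeight ?_ ?_ ?_ (weight_CDG a b v)⟩
    · have := hone _ hmin .BDGE
      positivity
    · have := hone _ hmin .CEG
      positivity
    · exact sub_nonneg.2 (hmin _ (inv_mem (periodX_mem a b)) _)
  | CEG =>
    refine ⟨.CEG, subset_rfl, exists_isWeight ?_ ?_ ?_ (weight_CEG a b v)⟩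
    · have := hone _ hmin .BDGE
      positivity
    · have := hone _ hmin .CDG
      positivity
    · have := sub_nonneg.2 (hmin _ (inv_mem (periodY_mem a b)) .BDF)
      positivity
  | BDF =>
    rcases le_or_gt 0 (lineBD b v) with h | h
    · refine ⟨.BDF, ?_, hBDF hmin h⟩
      simp only [facetVerts]; split_ifs <;> decide
    · have h0 := hone _ hmin .BDGE
      -- For `a > 0` minimality of `BDF` against `BDGE` would give `lineBD ≥ 0`. So the wrong side
      -- of `BD` is possible only in the pentagon, where both forms are the same.
      have ha0 : a = 0 := by
        by_contra hne
        have : (0 : ℝ) < a := by exact_mod_cast Nat.pos_of_ne_zero hne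
        nlinarith
      subst ha0
      have heq : facetForm 0 b .BDGE v = facetForm 0 b .BDF v := by
        simpa [sub_eq_zero] using hsub
      rcases hBDGE (by rw [heq]; exact hmin) h.le with h | h
      · exact ⟨.BDG, by decide, h⟩
      · exact ⟨.BGE, by decide, h⟩
  | BDGE =>
    rcases le_or_gt (lineBD b v) 0 with h | h
    · rcases hBDGE hmin h with h | h
      · refine ⟨.BDG, ?_, h⟩
        simp only [facetVerts]; split_ifs <;> decide
      · refine ⟨.BGE, ?_, h⟩
        simp only [facetVerts]; split_ifs <;> decide
    · have h0 := hone _ hmin .BDF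
      have ha0 : a = 0 := by
        by_contra hne
        have : (0 : ℝ) < a := by exact_mod_cast Nat.pos_of_ne_zero hne
        nlinarith
      subst ha0
      have heq : facetForm 0 b .BDGE v = facetForm 0 b .BDF v := by
        simpa [sub_eq_zero] using hsub
      exact ⟨.BDF, by decide, hBDF (by rw [← heq]; exact hmin) h.le⟩

/-! ### Integer points -/

theorem act_mem_integerPoints (M : SL(3, ℤ)) {p : Fin 3 → ℝ} (hp : p ∈ integerPoints) :
    act M p ∈ integerPoints := by
  obtain ⟨z, rfl⟩ := hp
  refine ⟨(M : Matrix (Fin 3) (Fin 3) ℤ).mulVec z, ?_⟩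
  funext i
  simp [act_apply, Matrix.mulVec, dotProduct]

theorem vtx_mem_integerPoints (a b : ℕ) (v : Vtx) : vtx a b v ∈ integerPoints :=
  ⟨vtxCoord a b v, rfl⟩

theorem facetForm_sum {a b : ℕ} {i : Facet} {S : Finset Vtx} (hS : S ⊆ facetVerts a i)
    {w : Vtx → ℝ} (hw : ∀ u, u ∉ S → w u = 0) :
    facetForm a b i (∑ u, w u • vtx a b u) = ∑ u, w u := by
  rw [map_sum]
  refine Finset.sum_congr rfl fun u _ => ?_
  rw [map_smul, smul_eq_mul]
  by_cases hu : u ∈ S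
  · rw [facetForm_vtx (hS hu), mul_one]
  · rw [hw u hu, zero_mul]

theorem zero_notMem_openCone (a b : ℕ) : (0 : Fin 3 → ℝ) ∉ openCone a b := fun h => by
  simpa using h 0

theorem facetForm_pos {a b : ℕ} {v : Fin 3 → ℝ} (hv : v ∈ openCone a b) (i : Facet) :
    0 < facetForm a b i v :=
  form_pos (facetForm_eigVec_pos a b i) hv

theorem Int.cast_eq_zero_of_lt_one {z : ℤ} {x : ℝ} (h : (z : ℝ) = x) (h0 : 0 ≤ x) (h1 : x < 1) :
    x = 0 := by
  rw [← h] at h0 h1 ⊢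
  have h0' : 0 ≤ z := by exact_mod_cast h0
  have h1' : z < 1 := by exact_mod_cast h1
  have : z = 0 := by omega
  simp [this]

/-- Four of the triangles lie in planes given by integral forms, and a positive integer is at least
`1`. The forms of `CDG` and `CEG` have denominators, so there the pyramid with apex `0` is shown to
be empty: an integer lying in `[0, 1)` is `0`, and the weights vanish one after another. -/
theorem one_le_sum_weight {a b : ℕ} {p : Fin 3 → ℝ} (hp : p ∈ integerPoints)
    (hp' : p ∈ openCone a b) {t : Tri} {w : Vtx → ℝ} (hw : IsWeight t.verts w)
    (h : ∑ u, w u • vtx a b u = p) : 1 ≤ ∑ u, w u := by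
  have hint : ∀ i, t.verts ⊆ facetVerts a i → (∃ z : ℤ, facetForm a b i p = z) → 1 ≤ ∑ u, w u := by
    rintro i hi ⟨z, hz⟩
    have h1 := facetForm_pos hp' i
    rw [← facetForm_sum hi hw.2, h, hz]
    rw [hz] at h1
    have : 0 < z := by exact_mod_cast h1
    exact_mod_cast this
  cases t with
  | ABF =>
    refine hint .ABF subset_rfl ?_
    obtain ⟨z, hz⟩ := act_mem_integerPoints (periodX a b) hp
    exact ⟨z 1 + z 2, by simp [facetForm, hz]⟩
  | BDF =>
    refine hint .BDF (by simp only [facetVerts]; split_ifs <;> decide) ?_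
    obtain ⟨z, rfl⟩ := hp
    exact ⟨-(a * b + 2 * a + b + 1) * z 0 + (a * b + 3 * a + b + 1) * z 1 + z 2,
      by simp [facetForm]⟩
  | BDG =>
    refine hint .BDGE (by simp only [facetVerts]; split_ifs <;> decide) ?_
    obtain ⟨z, rfl⟩ := hp
    exact ⟨-(b + 1) * z 0 + (b + 1) * z 1 + z 2, by simp [facetForm]⟩
  | BGE =>
    refine hint .BDGE (by simp only [facetVerts]; split_ifs <;> decide) ?_
    obtain ⟨z, rfl⟩ := hp
    exact ⟨-(b + 1) * z 0 + (b + 1) * z 1 + z 2, by simp [facetForm]⟩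
  | CDG =>
    by_contra hc
    push Not at hc
    obtain ⟨z, rfl⟩ := hp
    have hA := hw.2 .A (by decide)
    have hB := hw.2 .B (by decide)
    have hE := hw.2 .E (by decide)
    have hF := hw.2 .F (by decide)
    have hC := hw.1 .C
    have hD := hw.1 .D
    have hG := hw.1 .G
    rw [sum_vtx] at h hc
    rw [hA, hB, hE, hF] at h hc
    have e1 := congrFun h 1
    have e2 := congrFun h 2
    simp [vtx_C, vtx_D, vtx_G] at e1 e2
    have e3 := Int.cast_eq_zero_of_lt_one e1.symm (by linarith) (by linarith)
    have hC0 : w .C = 0 := by linarith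
    have hG0 : w .G = 0 := by linarith
    have hD0 := Int.cast_eq_zero_of_lt_one e2.symm (by linarith) (by linarith)
    rw [hG0, add_zero] at hD0
    refine zero_notMem_openCone a b ?_
    rw [← h, hC0, hG0, hD0] at hp'
    simpa using hp'
  | CEG =>
    by_contra hc
    push Not at hc
    obtain ⟨z, rfl⟩ := hp
    have hA := hw.2 .A (by decide)
    have hB := hw.2 .B (by decide)
    have hD := hw.2 .D (by decide)
    have hF := hw.2 .F (by decide)
    have hC := hw.1 .C
    have hE := hw.1 .E
    have hG := hw.1 .G
    rw [sum_vtx] at h hc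
    rw [hA, hB, hD, hF] at h hc
    have e1 := congrFun h 1
    have e2 := congrFun h 2
    simp [vtx_C, vtx_E, vtx_G] at e1 e2
    -- The difference of the last two coordinates is `1` at `C` and `E` and `0` at `G`.
    have e3 : ((z 1 - z 2 : ℤ) : ℝ) = w .C + w .E := by
      push_cast; linarith
    have e3 := Int.cast_eq_zero_of_lt_one e3 (by linarith) (by linarith)
    have hC0 : w .C = 0 := by linarith
    have hE0 : w .E = 0 := by linarith
    rw [hE0, zero_mul, zero_add] at e2
    have hG0 := Int.cast_eq_zero_of_lt_one e2.symm (by linarith) (by linarith)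
    refine zero_notMem_openCone a b ?_
    rw [← h, hC0, hE0, hG0] at hp'
    simpa using hp'

/-! ### Operators commuting with the Frobenius operator -/

theorem root_injective (a b : ℕ) : Function.Injective (root a b) := by
  have h0 := root_zero_pos a b
  have h1 := root_one_lt a b
  have h1' := neg_one_lt_root_one a b
  have h2 := root_two_lt_neg_three a b
  intro j k hjk
  fin_cases j <;> fin_cases k <;> simp at hjk ⊢ <;> linarith

theorem act_commute {a b : ℕ} {g : SL(3, ℤ)} (hg : Commute g (familyOp a b)) (v : Fin 3 → ℝ) :
    act g (act (familyOp a b) v) = act (familyOp a b) (act g v) := by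
  rw [← act_mul_apply, ← act_mul_apply, hg.eq]

/-- The eigenvalues of an operator commuting with the Frobenius operator. -/
noncomputable def eigVal (a b : ℕ) (g : SL(3, ℤ)) (k : Fin 3) : ℝ :=
  eigForm a b k (act g (vtx a b .D))

theorem eigForm_D (a b : ℕ) (k : Fin 3) : eigForm a b k (vtx a b .D) = 1 := by
  rw [vtx_D, eigForm_apply]; simp

/-- The eigenvalues are distinct, so an operator commuting with the Frobenius operator is diagonal
in its eigenbasis. -/
theorem eigForm_act {a b : ℕ} {g : SL(3, ℤ)} (hg : Commute g (familyOp a b)) (k : Fin 3)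
    (v : Fin 3 → ℝ) : eigForm a b k (act g v) = eigVal a b g k * eigForm a b k v := by
  have h : ∀ w, eigForm a b k (act g w) =
      eigForm a b k w * eigForm a b k (act g (eigVec a b k)) := by
    intro w
    have h1 := form_eq_sum a b ((eigForm a b k).comp (act g)) w
    rw [LinearMap.comp_apply] at h1
    rw [h1, Finset.sum_eq_single k]
    · rfl
    · intro j _ hjk
      have h2 := congrArg (eigForm a b k) (act_commute hg (eigVec a b j))
      rw [act_eigVec, map_smul, map_smul, eigForm_act_familyOp, smul_eq_mul] at h2
      have h3 : eigForm a b k (act g (eigVec a b j)) = 0 := by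
        by_contra hne
        exact hjk (root_injective a b (mul_right_cancel₀ hne h2))
      rw [LinearMap.comp_apply, h3, mul_zero]
    · simp
  rw [eigVal, h v, h (vtx a b .D), eigForm_D]
  ring

theorem act_injective : Function.Injective act := by
  intro g g' h
  apply Subtype.ext
  have h1 := Matrix.toLin'.injective h
  exact Matrix.map_injective Int.cast_injective h1

theorem eq_of_eigVal {a b : ℕ} {g g' : SL(3, ℤ)} (hg : Commute g (familyOp a b))
    (hg' : Commute g' (familyOp a b)) (h : ∀ k, eigVal a b g k = eigVal a b g' k) : g = g' := by
  refine act_injective (LinearMap.ext fun v => eigForm_ext a b fun k => ?_)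
  rw [eigForm_act hg, eigForm_act hg', h]

theorem eq_of_act_D {a b : ℕ} {g g' : SL(3, ℤ)} (hg : Commute g (familyOp a b))
    (hg' : Commute g' (familyOp a b)) (h : act g (vtx a b .D) = act g' (vtx a b .D)) : g = g' :=
  eq_of_eigVal hg hg' fun k => by rw [eigVal, eigVal, h]

theorem eigVal_mul {a b : ℕ} {g g' : SL(3, ℤ)} (hg : Commute g (familyOp a b)) (k : Fin 3) :
    eigVal a b (g * g') k = eigVal a b g k * eigVal a b g' k := by
  rw [eigVal, act_mul_apply, eigForm_act hg, eigVal, eigVal]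

theorem eigVal_one (a b : ℕ) (k : Fin 3) : eigVal a b 1 k = 1 := by
  rw [eigVal, act_one, LinearMap.id_apply, eigForm_D]

/-- Bounded eigenvalues bound the image of `D`, which is the last column of the matrix. It is an
integer vector and determines the operator. -/
theorem finite_eigVal_le (a b : ℕ) (C : ℝ) :
    {g : SL(3, ℤ) | Commute g (familyOp a b) ∧ ∀ k, |eigVal a b g k| ≤ C}.Finite := by
  obtain ⟨N, hN⟩ : ∃ N : ℤ, ∀ i, ∑ k, C * |eigVec a b k i| ≤ N := by
    refine ⟨⌈∑ i, abs (∑ k, C * |eigVec a b k i|)⌉, fun i => ?_⟩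
    refine le_trans ?_ (Int.le_ceil _)
    refine (le_abs_self _).trans ?_
    exact Finset.single_le_sum (f := fun i => abs (∑ k, C * |eigVec a b k i|))
      (fun _ _ => abs_nonneg _) (Finset.mem_univ i)
  have hcol : ∀ (g : SL(3, ℤ)) (i : Fin 3), act g (vtx a b .D) i = (g : Matrix (Fin 3) (Fin 3) ℤ) i 2 := by
    intro g i
    rw [vtx_D, act_apply]
    simp [Matrix.mulVec, dotProduct, Fin.sum_univ_three]
  refine Set.Finite.of_finite_image (f := fun g i => (g : Matrix (Fin 3) (Fin 3) ℤ) i 2)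
    ((Set.finite_Icc (fun _ => -N) (fun _ => N)).subset ?_) ?_
  · rintro _ ⟨g, ⟨hg, hC⟩, rfl⟩
    have hb : ∀ i, |((g : Matrix (Fin 3) (Fin 3) ℤ) i 2 : ℝ)| ≤ N := by
      intro i
      refine le_trans ?_ (hN i)
      have h := congrFun (sum_eigForm_smul_eigVec a b (act g (vtx a b .D))) i
      rw [← hcol, ← h, Finset.sum_apply]
      refine (Finset.abs_sum_le_sum_abs _ _).trans (Finset.sum_le_sum fun k _ => ?_)
      rw [Pi.smul_apply, smul_eq_mul, abs_mul]
      exact mul_le_mul_of_nonneg_right (hC k) (abs_nonneg _)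
    constructor <;> intro i
    · have := (abs_le.1 (hb i)).1
      exact_mod_cast this
    · have := (abs_le.1 (hb i)).2
      exact_mod_cast this
  · rintro g ⟨hg, -⟩ g' ⟨hg', -⟩ h
    refine eq_of_act_D hg hg' (funext fun i => ?_)
    rw [hcol, hcol]
    exact congrArg _ (congrFun h i)

/-- The operators that commute with the Frobenius operator and have positive eigenvalues. -/
def positiveGroup (a b : ℕ) : Subgroup SL(3, ℤ) where
  carrier := {g | Commute g (familyOp a b) ∧ ∀ k, 0 < eigVal a b g k}
  mul_mem' := fun {g g'} hg hg' => ⟨hg.1.mul_left hg'.1, fun k => by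
    rw [eigVal_mul hg.1]; exact mul_pos (hg.2 k) (hg'.2 k)⟩
  one_mem' := ⟨Commute.one_left _, fun k => by rw [eigVal_one]; exact one_pos⟩
  inv_mem' := fun {g} hg => ⟨hg.1.inv_left, fun k => by
    have h := eigVal_mul (g' := g⁻¹) hg.1 k
    rw [mul_inv_cancel, eigVal_one] at h
    have h0 := hg.2 k
    by_contra hc
    push Not at hc
    nlinarith⟩

theorem periodGroup_le (a b : ℕ) : periodGroup a b ≤ positiveGroup a b := by
  rw [periodGroup, Subgroup.closure_le]
  rintro g (rfl | rfl)
  · exact ⟨commute_periodX a b, fun k => mem_openCone_act_periodX.2 (vtx_mem_openCone a b .D) k⟩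
  · exact ⟨commute_periodY a b, fun k => mem_openCone_act_periodY.2 (vtx_mem_openCone a b .D) k⟩

theorem act_mem_openCone {a b : ℕ} {g : SL(3, ℤ)} (hg : g ∈ positiveGroup a b) {v : Fin 3 → ℝ}
    (hv : v ∈ openCone a b) : act g v ∈ openCone a b := fun k => by
  rw [eigForm_act hg.1]; exact mul_pos (hg.2 k) (hv k)

/-! ### The minimum of the facet forms -/

/-- A value of a translated form is a sum of positive terms, one for each eigenvalue of the period.
A bound on the value therefore bounds the eigenvalues, leaving finitely many periods to compare. -/
theorem exists_minimizer {a b : ℕ} {v : Fin 3 → ℝ} (hv : v ∈ openCone a b) :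
    ∃ h ∈ periodGroup a b, ∃ i, ∀ h' ∈ periodGroup a b, ∀ j,
      facetForm a b i (act h v) ≤ facetForm a b j (act h' v) := by
  set C := facetForm a b .ABF v with hC
  have hfin : {q : SL(3, ℤ) × Facet | q.1 ∈ periodGroup a b ∧
      facetForm a b q.2 (act q.1 v) ≤ C}.Finite := by
    have hj : ∀ j : Facet, {g : SL(3, ℤ) | g ∈ periodGroup a b ∧
        facetForm a b j (act g v) ≤ C}.Finite := by
      intro j
      have hpos : ∀ k, 0 < eigForm a b k v * facetForm a b j (eigVec a b k) := fun k =>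
        mul_pos (hv k) (facetForm_eigVec_pos a b j k)
      refine (finite_eigVal_le a b
        (∑ k, C / (eigForm a b k v * facetForm a b j (eigVec a b k)))).subset ?_
      rintro g ⟨hg, hle⟩
      have hg' := periodGroup_le a b hg
      refine ⟨hg'.1, fun k => ?_⟩
      rw [abs_of_pos (hg'.2 k)]
      have hC0 : 0 ≤ C := (facetForm_pos hv _).le
      refine le_trans ?_ (Finset.single_le_sum
        (f := fun k => C / (eigForm a b k v * facetForm a b j (eigVec a b k)))
        (fun k _ => div_nonneg hC0 (hpos k).le) (Finset.mem_univ k))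
      rw [le_div_iff₀ (hpos k)]
      refine le_trans ?_ hle
      rw [form_eq_sum a b (facetForm a b j) (act g v)]
      have hs := Finset.single_le_sum
        (f := fun k => eigForm a b k (act g v) * facetForm a b j (eigVec a b k))
        (fun k _ => (mul_pos (act_mem_openCone hg' hv k) (facetForm_eigVec_pos a b j k)).le)
        (Finset.mem_univ k)
      refine le_trans (le_of_eq ?_) hs
      rw [eigForm_act hg'.1]
      ring
    refine (Set.finite_iUnion fun j => (hj j).image fun g => (g, j)).subset ?_
    rintro ⟨g, j⟩ hq
    exact Set.mem_iUnion.2 ⟨j, g, hq, rfl⟩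
  obtain ⟨⟨g, i⟩, ⟨hg, hgC⟩, hmin⟩ := Set.exists_min_image _
    (fun q : SL(3, ℤ) × Facet => facetForm a b q.2 (act q.1 v)) hfin
    ⟨(1, .ABF), one_mem _, by rw [act_one]; exact le_rfl⟩
  refine ⟨g, hg, i, fun h' hh' j => ?_⟩
  rcases le_or_gt (facetForm a b j (act h' v)) C with h | h
  · exact hmin (h', j) ⟨hh', h⟩
  · exact hgC.trans h.le

/-- The covering statement: every point of the orthant lies in the cone over a translated triangle,
and the form of a facet containing that triangle is minimal there. -/
theorem exists_tri_of_mem_openCone {a b : ℕ} {v : Fin 3 → ℝ} (hv : v ∈ openCone a b) :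
    ∃ h ∈ periodGroup a b, ∃ (i : Facet) (t : Tri), t.verts ⊆ facetVerts a i ∧
      (∃ w, IsWeight t.verts w ∧ ∑ u, w u • vtx a b u = act h v) ∧
      ∀ h' ∈ periodGroup a b, ∀ j, facetForm a b i (act h v) ≤ facetForm a b j (act h' v) := by
  obtain ⟨h, hh, i, hmin⟩ := exists_minimizer hv
  obtain ⟨t, ht, w, hw, hwv⟩ := exists_tri_weight (v := act h v) (i := i) fun h' hh' j => by
    rw [← act_mul_apply]; exact hmin _ (mul_mem hh' hh) j
  exact ⟨h, hh, i, t, ht, ⟨w, hw, hwv⟩, hmin⟩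

/-- The minimal value at `p` is the sum of its weights in a triangle, which is at least `1` by
emptiness of the pyramids. -/
theorem one_le_facetForm {a b : ℕ} {p : Fin 3 → ℝ} (hp : p ∈ integerPoints)
    (hp' : p ∈ openCone a b) {h : SL(3, ℤ)} (hh : h ∈ periodGroup a b) (j : Facet) :
    1 ≤ facetForm a b j (act h p) := by
  obtain ⟨h0, hh0, i, t, ht, ⟨w, hw, hwv⟩, hmin⟩ := exists_tri_of_mem_openCone hp'
  refine le_trans ?_ (hmin h hh j)
  rw [← hwv, facetForm_sum ht hw.2]
  exact one_le_sum_weight (act_mem_integerPoints h0 hp)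
    (act_mem_openCone (periodGroup_le a b hh0) hp') hw hwv

/-! ### Irreducibility -/

open Polynomial in
theorem charpoly_familyOp (a b : ℕ) (K : Type*) [CommRing K] :
    ((familyOp a b : Matrix (Fin 3) (Fin 3) ℤ).map (Int.cast : ℤ → K)).charpoly =
      X ^ 3 + C (((a : K) + 2) * ((b : K) + 3) - 3) * X ^ 2
        + C (-(((a : K) + 2) * ((b : K) + 2)) + 3) * X - 1 := by
  rw [Matrix.charpoly, Matrix.det_fin_three]
  simp [familyOp, frobeniusOp]
  ring

open Polynomial in
theorem charpoly_natDegree (a b : ℕ) (K : Type*) [CommRing K] [Nontrivial K] :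
    (X ^ 3 + C (((a : K) + 2) * ((b : K) + 3) - 3) * X ^ 2
        + C (-(((a : K) + 2) * ((b : K) + 2)) + 3) * X - 1).natDegree = 3 := by
  compute_degree!

open Polynomial in
theorem charpoly_monic (a b : ℕ) (K : Type*) [CommRing K] [Nontrivial K] :
    (X ^ 3 + C (((a : K) + 2) * ((b : K) + 3) - 3) * X ^ 2
        + C (-(((a : K) + 2) * ((b : K) + 2)) + 3) * X - 1).Monic := by
  monicity!

theorem no_rational_root (a b : ℕ) (x : ℚ) : x ^ 3 + (((a : ℚ) + 2) * ((b : ℚ) + 3) - 3) * x ^ 2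
    + (-(((a : ℚ) + 2) * ((b : ℚ) + 2)) + 3) * x - 1 ≠ 0 := by
  intro h
  have hint : IsIntegral ℤ x := by
    refine ⟨_, charpoly_monic a b ℤ, ?_⟩
    simpa [Polynomial.eval₂_add, Polynomial.eval₂_sub, Polynomial.eval₂_mul] using h
  obtain ⟨z, hz⟩ := IsIntegrallyClosed.isIntegral_iff.1 hint
  simp only [algebraMap_int_eq, eq_intCast] at hz
  rw [← hz] at h
  have h' : z ^ 3 + (((a : ℤ) + 2) * ((b : ℤ) + 3) - 3) * z ^ 2
    + (-(((a : ℤ) + 2) * ((b : ℤ) + 2)) + 3) * z - 1 = 0 := by exact_mod_cast h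
  have hu : z * (z ^ 2 + (((a : ℤ) + 2) * ((b : ℤ) + 3) - 3) * z
    + (-(((a : ℤ) + 2) * ((b : ℤ) + 2)) + 3)) = 1 := by linear_combination h'
  have ha : (0 : ℤ) ≤ a := by positivity
  have hb : (0 : ℤ) ≤ b := by positivity
  -- A rational root is an integer dividing `1`. The cubic equals `a + 2` at `1` and is positive at
  -- `-1`.
  rcases Int.isUnit_iff.1 (IsUnit.of_mul_eq_one _ hu) with rfl | rfl
  · nlinarith
  · nlinarith [mul_nonneg ha hb]

theorem irreducible_charpoly (a b : ℕ) :
    Irreducible ((familyOp a b : Matrix (Fin 3) (Fin 3) ℤ).map (Int.cast : ℤ → ℚ)).charpoly := by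
  rw [charpoly_familyOp]
  have hd := charpoly_natDegree a b ℚ
  have hm := charpoly_monic a b ℚ
  rw [hm.irreducible_iff_roots_eq_zero_of_degree_le_three (by rw [hd]; norm_num) (by rw [hd])]
  refine Multiset.eq_zero_of_forall_notMem fun x hx => no_rational_root a b x ?_
  have := (Polynomial.mem_roots'.1 hx).2
  simpa [Polynomial.IsRoot] using this

theorem prod_root (a b : ℕ) : root a b 0 * root a b 1 * root a b 2 = 1 := by
  linear_combination root_eq a b 0 - root a b 0 ^ 2 * sum_root a b + root a b 0 * root_pairs a b

open Polynomial in
theorem isCubicIrrationality_familyOp (a b : ℕ) : IsCubicIrrationality (familyOp a b) := by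
  have h : ((familyOp a b : Matrix (Fin 3) (Fin 3) ℤ).map (Int.cast : ℤ → ℝ)).charpoly =
      ((Finset.univ.val.map (root a b)).map fun x => X - C x).prod := by
    rw [charpoly_familyOp]
    have h1 := congrArg (C : ℝ → ℝ[X]) (sum_root a b)
    have h2 := congrArg (C : ℝ → ℝ[X]) (root_pairs a b)
    have h3 := congrArg (C : ℝ → ℝ[X]) (prod_root a b)
    rw [Multiset.map_map]
    change _ = ∏ k, (X - C (root a b k))
    rw [Fin.prod_univ_three]
    simp only [C_add, C_mul, C_neg, C_sub, C_1] at h1 h2 h3 ⊢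
    linear_combination X ^ 2 * h1 - X * h2 + h3
  refine ⟨irreducible_charpoly a b, ?_, ?_⟩
  · rw [h, roots_multiset_prod_X_sub_C]
    simp
  · rw [h, roots_multiset_prod_X_sub_C]
    exact Multiset.Nodup.map (root_injective a b) Finset.univ.nodup

open Polynomial in
theorem eigForm_ne_zero {a b : ℕ} {p : Fin 3 → ℝ} (hp : p ∈ integerPoints) (hp0 : p ≠ 0)
    (k : Fin 3) : eigForm a b k p ≠ 0 := by
  obtain ⟨z, rfl⟩ := hp
  intro h
  set P : ℚ[X] := X ^ 3 + C (((a : ℚ) + 2) * ((b : ℚ) + 3) - 3) * X ^ 2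
        + C (-(((a : ℚ) + 2) * ((b : ℚ) + 2)) + 3) * X - 1 with hP
  have hmin : P = minpoly ℚ (root a b k) := by
    refine minpoly.eq_of_irreducible_of_monic ?_ ?_ (charpoly_monic a b ℚ)
    · have := irreducible_charpoly a b
      rwa [charpoly_familyOp] at this
    · have := root_eq a b k
      simpa [hP] using this
  set q : ℚ[X] := C (z 0 : ℚ) * X ^ 2
    + C ((z 0 : ℚ) * (((a : ℚ) + 2) * ((b : ℚ) + 3) - 3) + z 1) * X
    + C ((z 0 : ℚ) * (-(((a : ℚ) + 2) * ((b : ℚ) + 2)) + 3)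
      + z 1 * (((a : ℚ) + 2) * ((b : ℚ) + 3) - 3) + z 2) with hq
  have hroot : aeval (root a b k) q = 0 := by
    rw [eigForm_apply, rootInv] at h
    simp only [hq, map_add, map_mul, aeval_C, aeval_X, map_pow]
    simp
    linear_combination h
  have hq0 : q = 0 := by
    by_contra hne
    have h1 := minpoly.degree_le_of_ne_zero ℚ (root a b k) hne hroot
    rw [← hmin, degree_eq_natDegree (charpoly_monic a b ℚ).ne_zero, charpoly_natDegree] at h1
    have h2 : q.degree ≤ 2 := degree_quadratic_le
    have := h1.trans h2
    norm_cast at this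
  have hc : ∀ x y w : ℚ, (C x * X ^ 2 + C y * X + C w).coeff 2 = x ∧
      (C x * X ^ 2 + C y * X + C w).coeff 1 = y ∧ (C x * X ^ 2 + C y * X + C w).coeff 0 = w := by
    intro x y w
    simp [coeff_X, coeff_C]
  obtain ⟨c2, c1, c0⟩ := hc _ _ _
  rw [← hq] at c0 c1 c2
  rw [hq0, coeff_zero] at c0 c1 c2
  rw [← c2] at c1 c0
  have e1 : (z 1 : ℚ) = 0 := by linarith
  rw [e1] at c0
  have e2 : (z 2 : ℚ) = 0 := by linarith
  apply hp0
  funext i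
  fin_cases i
  · simpa using c2.symm
  · simpa using e1
  · simpa using e2

/-! ### The orthant -/

theorem exists_third (j k : Fin 3) : ∃ l, l ≠ j ∧ l ≠ k := by
  revert j k; decide

theorem exists_others (l : Fin 3) : ∃ j k, j ≠ k ∧ j ≠ l ∧ k ≠ l ∧ ∀ i, i = j ∨ i = k ∨ i = l := by
  revert l; decide

theorem eigenvector_cases {a b : ℕ} {u : Fin 3 → ℝ} {c : ℝ} (hu : act (familyOp a b) u = c • u) :
    ∃ k, ∀ j, j ≠ k → eigForm a b j u = 0 := by
  by_cases h : ∃ k, eigForm a b k u ≠ 0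
  · obtain ⟨k, hk⟩ := h
    have hr : ∀ j, eigForm a b j u ≠ 0 → root a b j = c := by
      intro j hj
      have := congrArg (eigForm a b j) hu
      rw [eigForm_act_familyOp, map_smul, smul_eq_mul] at this
      exact mul_right_cancel₀ hj this
    refine ⟨k, fun j hjk => ?_⟩
    by_contra hj
    exact hjk (root_injective a b ((hr j hj).trans (hr k hk).symm))
  · push Not at h
    exact ⟨0, fun j _ => h j⟩

theorem isEigenplane_compl (a b : ℕ) :
    {q : Fin 3 → ℝ | ∀ H, IsEigenplane (familyOp a b) H → q ∉ H} =
      {q | ∀ k, eigForm a b k q ≠ 0} := by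
  ext q
  simp only [Set.mem_ofPred_eq]
  constructor
  · intro hq l hl
    obtain ⟨j, k, hjk, hjl, hkl, hall⟩ := exists_others l
    refine hq (Submodule.span ℝ {eigVec a b j, eigVec a b k})
      ⟨_, _, ⟨_, act_eigVec a b j⟩, ⟨_, act_eigVec a b k⟩, ?_, rfl⟩ ?_
    · rw [LinearIndependent.pair_iff]
      intro s t hst
      have h1 := congrArg (eigForm a b j) hst
      have h2 := congrArg (eigForm a b k) hst
      simp [eigForm_eigVec, hjk, hjk.symm] at h1 h2
      exact ⟨h1, h2⟩
    · rw [Submodule.mem_span_pair]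
      refine ⟨eigForm a b j q, eigForm a b k q, eigForm_ext a b fun i => ?_⟩
      rcases hall i with rfl | rfl | rfl
      · simp [eigForm_eigVec, hjk]
      · simp [eigForm_eigVec, hjk.symm]
      · simp [eigForm_eigVec, hjl.symm, hkl.symm, hl]
  · rintro hq _ ⟨u, v, ⟨c, hu⟩, ⟨c', hv⟩, -, rfl⟩ hmem
    obtain ⟨j, hj⟩ := eigenvector_cases hu
    obtain ⟨k, hk⟩ := eigenvector_cases hv
    obtain ⟨l, hlj, hlk⟩ := exists_third j k
    obtain ⟨s, t, rfl⟩ := Submodule.mem_span_pair.1 hmem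
    apply hq l
    simp [hj l hlj, hk l hlk]

/-- The complement of the eigenplanes is where no eigenform vanishes. The cone is convex, hence
connected, and an eigenform cannot change sign on a connected set where it has no zero. -/
theorem orthant_eq (a b : ℕ) : orthant (familyOp a b) ![0, 0, 1] = openCone a b := by
  rw [orthant, isEigenplane_compl]
  have hD : (![0, 0, 1] : Fin 3 → ℝ) ∈ openCone a b := by
    rw [← vtx_D a b]; exact vtx_mem_openCone a b _
  have hsub : openCone a b ⊆ {q | ∀ k, eigForm a b k q ≠ 0} := fun q hq k => (hq k).ne'
  refine Set.Subset.antisymm (fun q hq k => ?_)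
    ((convex_openCone a b).isPreconnected.subset_connectedComponentIn hD hsub)
  have hpre := (isPreconnected_connectedComponentIn (x := (![0, 0, 1] : Fin 3 → ℝ))
    (F := {q | ∀ k, eigForm a b k q ≠ 0})).image _ (continuous_eigForm a b k).continuousOn
  by_contra hneg
  push Not at hneg
  have h0 := hpre.ordConnected.out ⟨q, hq, rfl⟩ ⟨_, mem_connectedComponentIn (hsub hD), rfl⟩
    (show (0 : ℝ) ∈ Set.Icc _ _ from ⟨hneg, (hD k).le⟩)
  obtain ⟨w, hw, hw0⟩ := h0
  exact connectedComponentIn_subset _ _ hw k hw0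

theorem sail_generators (a b : ℕ) :
    {q | q ∈ closure (orthant (familyOp a b) ![0, 0, 1]) ∧ q ∈ integerPoints ∧ q ≠ 0} =
      {q | q ∈ openCone a b ∧ q ∈ integerPoints} := by
  rw [orthant_eq]
  ext q
  simp only [Set.mem_ofPred_eq]
  constructor
  · rintro ⟨hq, hint, h0⟩
    refine ⟨fun k => lt_of_le_of_ne ?_ (eigForm_ne_zero hint h0 k).symm, hint⟩
    have : closure (openCone a b) ⊆ {q | 0 ≤ eigForm a b k q} :=
      closure_minimal (fun x hx => (hx k).le)
        (isClosed_le continuous_const (continuous_eigForm a b k))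
    exact this hq
  · rintro ⟨hq, hint⟩
    exact ⟨subset_closure hq, hint, fun h => zero_notMem_openCone a b (h ▸ hq)⟩

/-! ### The convex hull -/

/-- The convex hull bounded by the sail. -/
abbrev hull (a b : ℕ) : Set (Fin 3 → ℝ) := sailHull (familyOp a b) ![0, 0, 1]

theorem hull_eq (a b : ℕ) : hull a b = convexHull ℝ {q | q ∈ openCone a b ∧ q ∈ integerPoints} := by
  rw [hull, sailHull, sail_generators]

theorem convex_hull (a b : ℕ) : Convex ℝ (hull a b) := convex_convexHull ℝ _

theorem mem_hull_of_integer {a b : ℕ} {p : Fin 3 → ℝ} (hp : p ∈ openCone a b)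
    (hp' : p ∈ integerPoints) : p ∈ hull a b := by
  rw [hull_eq]; exact subset_convexHull ℝ _ ⟨hp, hp'⟩

theorem nsmul_mem_integerPoints (n : ℕ) {p : Fin 3 → ℝ} (hp : p ∈ integerPoints) :
    (n : ℝ) • p ∈ integerPoints := by
  obtain ⟨z, rfl⟩ := hp
  exact ⟨fun i => n * z i, by funext i; simp⟩

/-- For an integer point `p` the point `c p` lies between `p` and the integer point `n p`; convexity
extends this to the hull. -/
theorem smul_mem_hull {a b : ℕ} {x : Fin 3 → ℝ} (hx : x ∈ hull a b) {c : ℝ} (hc : 1 ≤ c) :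
    c • x ∈ hull a b := by
  have hconv : Convex ℝ {y : Fin 3 → ℝ | c • y ∈ hull a b} :=
    (convex_hull a b).smul_preimage c
  have hsub : {q | q ∈ openCone a b ∧ q ∈ integerPoints} ⊆ {y | c • y ∈ hull a b} := by
    rintro p ⟨hp, hp'⟩
    obtain ⟨n, hn⟩ := exists_nat_gt c
    have hn0 : (0 : ℝ) < n := by linarith
    have h1 := mem_hull_of_integer hp hp'
    have h2 := mem_hull_of_integer (smul_mem_openCone hn0 hp) (nsmul_mem_integerPoints n hp')
    have hn1 : (0 : ℝ) < n - 1 := by linarith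
    have h3 := convex_hull a b h1 h2
      (show 0 ≤ (n - c) / (n - 1) from div_nonneg (by linarith) hn1.le)
      (show 0 ≤ (c - 1) / (n - 1) from div_nonneg (by linarith) hn1.le)
      (by rw [← add_div, div_eq_one_iff_eq hn1.ne']; ring)
    have e : ((n - c) / (n - 1)) • p + ((c - 1) / (n - 1)) • (n : ℝ) • p = c • p := by
      rw [smul_smul, ← add_smul]
      congr 1
      field_simp
      ring
    rw [e] at h3
    exact h3
  rw [hull_eq] at hx
  exact convexHull_min hsub hconv hx

theorem act_vtx_mem_hull {a b : ℕ} {g : SL(3, ℤ)} (hg : g ∈ positiveGroup a b) (v : Vtx) :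
    act g (vtx a b v) ∈ hull a b :=
  mem_hull_of_integer (act_mem_openCone hg (vtx_mem_openCone a b v))
    (act_mem_integerPoints g (vtx_mem_integerPoints a b v))

theorem mem_hull_of_weight {a b : ℕ} {g : SL(3, ℤ)} (hg : g ∈ positiveGroup a b) {w : Vtx → ℝ}
    (hw : ∀ u, 0 ≤ w u) (hs : 1 ≤ ∑ u, w u) : act g (∑ u, w u • vtx a b u) ∈ hull a b := by
  have hpos : 0 < ∑ u, w u := by linarith
  have h := (convex_hull a b).sum_mem (t := Finset.univ) (w := fun u => w u / ∑ u, w u)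
    (z := fun u => act g (vtx a b u)) (fun u _ => div_nonneg (hw u) hpos.le)
    (by rw [← Finset.sum_div, div_self hpos.ne']) (fun u _ => act_vtx_mem_hull hg u)
  have h2 := smul_mem_hull h hs
  rw [Finset.smul_sum] at h2
  rw [map_sum]
  convert h2 using 2 with u
  rw [map_smul, smul_smul, mul_div_cancel₀ _ hpos.ne']

/-- The inequalities hold at the generators, hence on the hull. Conversely, a point satisfying them
lies in the cone over some translated triangle, at or beyond the triangle itself, and the hull is
closed under scaling up. -/
theorem mem_hull_iff {a b : ℕ} {x : Fin 3 → ℝ} : x ∈ hull a b ↔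
    x ∈ openCone a b ∧ ∀ h ∈ periodGroup a b, ∀ j, 1 ≤ facetForm a b j (act h x) := by
  constructor
  · intro hx
    rw [hull_eq] at hx
    refine ⟨convexHull_min (fun p hp => hp.1) (convex_openCone a b) hx, fun h hh j => ?_⟩
    exact convexHull_min (t := {x | 1 ≤ (facetForm a b j).comp (act h) x})
      (fun p hp => one_le_facetForm hp.2 hp.1 hh j)
      (convex_halfSpace_ge ((facetForm a b j).comp (act h)).isLinear 1) hx
  · rintro ⟨hx, hle⟩
    obtain ⟨h, hh, i, t, ht, ⟨w, hw, hwv⟩, -⟩ := exists_tri_of_mem_openCone hx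
    rw [← act_inv_act h x, ← hwv]
    refine mem_hull_of_weight (inv_mem (periodGroup_le a b hh)) hw.1 ?_
    rw [← facetForm_sum ht hw.2, hwv]
    exact hle h hh i

theorem add_mem_hull {a b : ℕ} {x y : Fin 3 → ℝ} (hx : x ∈ hull a b) (hy : y ∈ openCone a b) :
    x + y ∈ hull a b := by
  rw [mem_hull_iff] at hx ⊢
  refine ⟨add_mem_openCone hx.1 hy, fun h hh j => ?_⟩
  rw [map_add, map_add]
  have := facetForm_pos (act_mem_openCone (periodGroup_le a b hh) hy) j
  linarith [hx.2 h hh j]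

/-! ### The norm form and the closedness of the hull -/

theorem prod_rootInv (a b : ℕ) : ∏ k, rootInv a b k = 1 := by
  have h : (∏ k, root a b k) * ∏ k, rootInv a b k = 1 := by
    rw [← Finset.prod_mul_distrib]
    exact Finset.prod_eq_one fun k _ => root_mul_rootInv a b k
  rwa [Fin.prod_univ_three (root a b), prod_root, one_mul] at h

theorem prod_eigX (a b : ℕ) : ∏ k, eigX a b k = 1 := by
  have hs := sum_root a b
  have hp := root_pairs a b
  have ht := prod_root a b
  have h0 : rootInv a b 0 = root a b 1 * root a b 2 := by
    rw [rootInv]; linear_combination root a b 0 * hs - hp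
  have h1 : rootInv a b 1 = root a b 0 * root a b 2 := by
    rw [rootInv]; linear_combination root a b 1 * hs - hp
  have h2 : rootInv a b 2 = root a b 0 * root a b 1 := by
    rw [rootInv]; linear_combination root a b 2 * hs - hp
  have h : ∏ k, (((b : ℝ) + 3) - (b + 2) * rootInv a b k) = 1 := by
    rw [Fin.prod_univ_three, h0, h1, h2]
    generalize root a b 0 = x at *
    generalize root a b 1 = y at *
    generalize root a b 2 = z at *
    have e : ((b : ℝ) + 3 - (b + 2) * (y * z)) * (b + 3 - (b + 2) * (x * z)) *
        (b + 3 - (b + 2) * (x * y)) = (b + 3) ^ 3 - (b + 3) ^ 2 * (b + 2) * (x * y + x * z + y * z)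
        + (b + 3) * (b + 2) ^ 2 * (x * y * z) * (x + y + z) - (b + 2) ^ 3 * (x * y * z) ^ 2 := by
      ring
    rw [e, hs, hp, ht]
    ring
  have hr := prod_rootInv a b
  simp only [eigX, Finset.prod_mul_distrib, Finset.prod_pow, h, hr]
  norm_num

theorem prod_eigVal {a b : ℕ} {h : SL(3, ℤ)} (hh : h ∈ periodGroup a b) :
    ∏ k, eigVal a b h k = 1 := by
  induction hh using Subgroup.closure_induction with
  | mem g hg =>
    rcases hg with rfl | rfl
    · simp only [eigVal, eigForm_act_periodX, eigForm_D, mul_one, prod_eigX]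
    · simp only [eigVal, eigForm_act_periodY, eigForm_D, mul_one, Finset.prod_pow, prod_rootInv,
        one_pow]
  | one => simp [eigVal_one]
  | mul x y hx hy ex ey =>
    simp only [eigVal_mul (periodGroup_le a b hx).1, Finset.prod_mul_distrib, ex, ey, one_mul]
  | inv x hx ex =>
    have h : ∏ k, eigVal a b x k * eigVal a b x⁻¹ k = 1 := by
      refine Finset.prod_eq_one fun k _ => ?_
      rw [← eigVal_mul (periodGroup_le a b hx).1, mul_inv_cancel, eigVal_one]
    rwa [Finset.prod_mul_distrib, ex, one_mul] at h

/-- The product of the eigenforms is invariant under the periods, so the point may be moved into the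
cone over one of finitely many triangles. There each eigenform is at least its smallest value at the
seven vertices. -/
theorem exists_norm_bound (a b : ℕ) : ∃ c > 0, ∀ x ∈ hull a b, c ≤ ∏ k, eigForm a b k x := by
  obtain ⟨⟨k0, u0⟩, -, hmin⟩ := Finset.exists_min_image (Finset.univ : Finset (Fin 3 × Vtx))
    (fun q => eigForm a b q.1 (vtx a b q.2)) ⟨(0, .A), Finset.mem_univ _⟩
  set c := eigForm a b k0 (vtx a b u0) with hc
  have hc0 : 0 < c := vtx_mem_openCone a b u0 k0
  refine ⟨c ^ 3, by positivity, fun x hx => ?_⟩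
  rw [mem_hull_iff] at hx
  obtain ⟨h, hh, i, t, ht, ⟨w, hw, hwv⟩, -⟩ := exists_tri_of_mem_openCone hx.1
  have hs : 1 ≤ ∑ u, w u := by
    rw [← facetForm_sum ht hw.2, hwv]; exact hx.2 h hh i
  have hle : ∀ k, c ≤ eigForm a b k (act h x) := by
    intro k
    rw [← hwv, map_sum]
    calc c ≤ (∑ u, w u) * c := le_mul_of_one_le_left hc0.le hs
      _ = ∑ u, w u * c := Finset.sum_mul _ _ _
      _ ≤ _ := Finset.sum_le_sum fun u _ => by
        rw [map_smul, smul_eq_mul]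
        exact mul_le_mul_of_nonneg_left (hmin (k, u) (Finset.mem_univ _)) (hw.1 u)
  have hprod : ∏ k, eigForm a b k x = ∏ k, eigForm a b k (act h x) := by
    simp only [eigForm_act (periodGroup_le a b hh).1, Finset.prod_mul_distrib, prod_eigVal hh,
      one_mul]
  rw [hprod]
  calc c ^ 3 = ∏ _k : Fin 3, c := by simp
    _ ≤ _ := Finset.prod_le_prod (fun _ _ => hc0.le) fun k _ => hle k

theorem continuous_facetForm_act (a b : ℕ) (j : Facet) (h : SL(3, ℤ)) :
    Continuous fun x => facetForm a b j (act h x) :=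
  ((facetForm a b j).comp (act h)).continuous_of_finiteDimensional

/-- The norm bound replaces the strict positivity of the eigenforms by closed conditions: a point of
the closed orthant with positive norm is interior to it. -/
theorem isClosed_hull (a b : ℕ) : IsClosed (hull a b) := by
  obtain ⟨c, hc, hb⟩ := exists_norm_bound a b
  have h : hull a b = {x | ∀ k, 0 ≤ eigForm a b k x} ∩ {x | c ≤ ∏ k, eigForm a b k x} ∩
      {x | ∀ h ∈ periodGroup a b, ∀ j, 1 ≤ facetForm a b j (act h x)} := by
    ext x
    constructor
    · intro hx
      have hx' := mem_hull_iff.1 hx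
      exact ⟨⟨fun k => (hx'.1 k).le, hb x hx⟩, hx'.2⟩
    · rintro ⟨⟨h1, h2⟩, h3⟩
      refine mem_hull_iff.2 ⟨fun k => lt_of_le_of_ne (h1 k) fun h0 => ?_, h3⟩
      rw [Set.mem_ofPred_eq, Finset.prod_eq_zero (Finset.mem_univ k) h0.symm] at h2
      linarith
  rw [h]
  refine (IsClosed.inter ?_ ?_).inter ?_
  · simp only [Set.ofPred_forall]
    exact isClosed_iInter fun k => isClosed_le continuous_const (continuous_eigForm a b k)
  · exact isClosed_le continuous_const (continuous_finsetProd _ fun k _ => continuous_eigForm a b k)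
  · simp only [Set.ofPred_forall]
    exact isClosed_iInter fun h => isClosed_iInter fun _ => isClosed_iInter fun j =>
      isClosed_le continuous_const (continuous_facetForm_act a b j h)

/-! ### The sail -/

theorem notMem_interior_of_form {E : Type*} [AddCommGroup E] [Module ℝ E] [TopologicalSpace E]
    [ContinuousSMul ℝ E] {S : Set E} {φ : E →ₗ[ℝ] ℝ} {c : ℝ} (hc : 0 < c) (hS : ∀ y ∈ S, c ≤ φ y)
    {x : E} (hx : φ x = c) : x ∉ interior S := by
  intro hint
  -- Shrinking `x` slightly would stay inside `S` but bring the form below `c`.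
  have hcont : Filter.Tendsto (fun s : ℝ => s • x) (nhdsWithin 1 (Set.Iio 1)) (nhds x) := by
    have : Continuous fun s : ℝ => s • x := by fun_prop
    have h := this.tendsto 1
    rw [one_smul] at h
    exact h.mono_left nhdsWithin_le_nhds
  have hev := hcont.eventually (isOpen_interior.mem_nhds hint)
  obtain ⟨s, hs, hs1⟩ := (hev.and self_mem_nhdsWithin).exists
  have h := hS _ (interior_subset hs)
  rw [map_smul, smul_eq_mul, hx] at h
  have : s < 1 := hs1
  nlinarith

/-- If the minimal form value `t` at `x` exceeds `1`, then `x / t` is still in the hull, and its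
translate of the open cone is a neighbourhood of `x` inside the hull. -/
theorem mem_sail_iff {a b : ℕ} {x : Fin 3 → ℝ} : x ∈ sail (familyOp a b) ![0, 0, 1] ↔
    x ∈ hull a b ∧ ∃ h ∈ periodGroup a b, ∃ j, facetForm a b j (act h x) = 1 := by
  rw [sail, (isClosed_hull a b).frontier_eq]
  constructor
  · rintro ⟨hx, hint⟩
    refine ⟨hx, ?_⟩
    obtain ⟨hx0, hx1⟩ := mem_hull_iff.1 hx
    obtain ⟨h, hh, i, hmin⟩ := exists_minimizer hx0
    refine ⟨h, hh, i, le_antisymm ?_ (hx1 h hh i)⟩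
    by_contra hlt
    push Not at hlt
    set t := facetForm a b i (act h x) with ht
    have ht0 : 0 < t := by linarith
    have hx' : t⁻¹ • x ∈ hull a b := by
      refine mem_hull_iff.2 ⟨smul_mem_openCone (by positivity) hx0, fun h' hh' j => ?_⟩
      rw [map_smul, map_smul, smul_eq_mul, inv_mul_eq_div, le_div_iff₀ ht0, one_mul]
      exact hmin h' hh' j
    apply hint
    rw [mem_interior]
    refine ⟨{y | y - t⁻¹ • x ∈ openCone a b}, fun y hy => ?_,
      (isOpen_openCone a b).preimage (continuous_sub_right _), ?_⟩
    · have := add_mem_hull hx' hy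
      rwa [add_sub_cancel] at this
    · have e : x - t⁻¹ • x = (1 - t⁻¹) • x := by rw [sub_smul, one_smul]
      rw [Set.mem_ofPred_eq, e]
      exact smul_mem_openCone (sub_pos.2 (inv_lt_one_of_one_lt₀ hlt)) hx0
  · rintro ⟨hx, h, hh, j, hj⟩
    exact ⟨hx, notMem_interior_of_form (φ := (facetForm a b j).comp (act h)) one_pos
      (fun y hy => (mem_hull_iff.1 hy).2 h hh j) hj⟩

theorem isClosed_sail (a b : ℕ) : IsClosed (sail (familyOp a b) ![0, 0, 1]) := isClosed_frontier

/-! ### The period lattice -/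

/-- The period with the given coordinates. -/
def period (a b : ℕ) (z : ℤ × ℤ) : SL(3, ℤ) := periodX a b ^ z.1 * periodY a b ^ z.2

theorem period_mem (a b : ℕ) (z : ℤ × ℤ) : period a b z ∈ periodGroup a b :=
  mul_mem (zpow_mem (periodX_mem a b) _) (zpow_mem (periodY_mem a b) _)

theorem period_zero (a b : ℕ) : period a b 0 = 1 := by simp [period]

theorem period_add (a b : ℕ) (z z' : ℤ × ℤ) :
    period a b (z + z') = period a b z * period a b z' := by
  have h : Commute (periodX a b ^ z'.1) (periodY a b ^ z.2) :=
    ((commute_periods a b).zpow_left _).zpow_right _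
  simp only [period, Prod.fst_add, Prod.snd_add, zpow_add]
  rw [mul_assoc, mul_assoc, ← mul_assoc (periodX a b ^ z'.1), h.eq, mul_assoc]

theorem period_neg (a b : ℕ) (z : ℤ × ℤ) : period a b (-z) = (period a b z)⁻¹ := by
  rw [eq_inv_iff_mul_eq_one, ← period_add, neg_add_cancel, period_zero]

theorem period_sub (a b : ℕ) (z z' : ℤ × ℤ) :
    period a b (z - z') = period a b z * (period a b z')⁻¹ := by
  rw [sub_eq_add_neg, period_add, period_neg]

theorem mem_periodGroup_iff {a b : ℕ} {g : SL(3, ℤ)} :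
    g ∈ periodGroup a b ↔ ∃ z, period a b z = g := by
  constructor
  · intro hg
    induction hg using Subgroup.closure_induction with
    | mem g hg =>
      rcases hg with rfl | rfl
      · exact ⟨(1, 0), by simp [period]⟩
      · exact ⟨(0, 1), by simp [period]⟩
    | one => exact ⟨0, period_zero a b⟩
    | mul x y hx hy ex ey =>
      obtain ⟨z, rfl⟩ := ex
      obtain ⟨z', rfl⟩ := ey
      exact ⟨z + z', period_add a b z z'⟩
    | inv x hx ex =>
      obtain ⟨z, rfl⟩ := ex
      exact ⟨-z, period_neg a b z⟩
  · rintro ⟨z, rfl⟩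
    exact period_mem a b z

theorem eigVal_inv {a b : ℕ} {g : SL(3, ℤ)} (hg : Commute g (familyOp a b)) (k : Fin 3) :
    eigVal a b g⁻¹ k = (eigVal a b g k)⁻¹ := by
  have h := eigVal_mul (g' := g⁻¹) hg k
  rw [mul_inv_cancel, eigVal_one] at h
  exact eq_inv_of_mul_eq_one_right h.symm

theorem eigVal_zpow {a b : ℕ} {g : SL(3, ℤ)} (hg : Commute g (familyOp a b)) (i : ℤ) (k : Fin 3) :
    eigVal a b (g ^ i) k = eigVal a b g k ^ i := by
  have hn : ∀ n : ℕ, eigVal a b (g ^ n) k = eigVal a b g k ^ n := by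
    intro n
    induction n with
    | zero => simp [eigVal_one]
    | succ n ih => rw [pow_succ, eigVal_mul (hg.pow_left n), ih, pow_succ]
  cases i with
  | ofNat n => simpa using hn n
  | negSucc n => rw [zpow_negSucc, zpow_negSucc, eigVal_inv (hg.pow_left _), hn]

/-- Logarithms of the first two eigenvalues turn the relation into a linear system. They have signs
`-, +` for `X` and `+, +` for `Y`, so its determinant is negative. -/
theorem periods_independent (a b : ℕ) (i j : ℤ) (h : periodX a b ^ i * periodY a b ^ j = 1) :
    i = 0 ∧ j = 0 := by
  have hb : (0 : ℝ) ≤ b := b.cast_nonneg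
  have hk : ∀ k, (i : ℝ) * Real.log (eigX a b k) + j * Real.log (rootInv a b k ^ 2) = 0 := by
    intro k
    have h1 := congrArg (fun g => eigVal a b g k) h
    simp only [eigVal_mul ((commute_periodX a b).zpow_left i), eigVal_zpow (commute_periodX a b),
      eigVal_zpow (commute_periodY a b), eigVal_one] at h1
    have hx : eigVal a b (periodX a b) k = eigX a b k := by
      rw [eigVal, eigForm_act_periodX, eigForm_D, mul_one]
    have hy : eigVal a b (periodY a b) k = rootInv a b k ^ 2 := by
      rw [eigVal, eigForm_act_periodY, eigForm_D, mul_one]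
    rw [hx, hy] at h1
    have h2 := congrArg Real.log h1
    have hx0 := eigX_pos a b k
    have hy0 := rootInv_ne_zero a b k
    rw [Real.log_mul (zpow_pos hx0 _).ne' (zpow_ne_zero _ (pow_ne_zero _ hy0)), Real.log_zpow,
      Real.log_zpow, Real.log_one] at h2
    exact h2
  have m0 : 1 < rootInv a b 0 := by
    have h1 := root_mul_rootInv a b 0
    have h2 := root_zero_pos a b
    have h3 := root_zero_lt a b
    by_contra hc
    push Not at hc
    nlinarith
  have m1 : rootInv a b 1 < -1 := by
    have h1 := root_mul_rootInv a b 1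
    have h2 := root_one_lt a b
    have h3 := neg_one_lt_root_one a b
    by_contra hc
    push Not at hc
    nlinarith
  have x0 : Real.log (eigX a b 0) < 0 := by
    refine Real.log_neg (eigX_pos a b 0) ?_
    have e : 1 - eigX a b 0 = (rootInv a b 0 - 1) *
        ((b + 2) * rootInv a b 0 ^ 2 - rootInv a b 0 - 1) := by rw [eigX]; ring
    have : 0 < (rootInv a b 0 - 1) * ((b + 2) * rootInv a b 0 ^ 2 - rootInv a b 0 - 1) :=
      mul_pos (by linarith) (by nlinarith [mul_nonneg hb (sq_nonneg (rootInv a b 0))])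
    linarith
  have y0 : 0 < Real.log (rootInv a b 0 ^ 2) := Real.log_pos (by nlinarith)
  have y1 : 0 < Real.log (rootInv a b 1 ^ 2) := Real.log_pos (by nlinarith)
  have x1 : 0 < Real.log (eigX a b 1) := by
    refine Real.log_pos ?_
    have h1 : 1 < rootInv a b 1 ^ 2 := by nlinarith
    have h2 : 1 < ((b : ℝ) + 3) - (b + 2) * rootInv a b 1 := by nlinarith
    rw [eigX]
    nlinarith
  have h0 := hk 0
  have h1 := hk 1
  have hi : (i : ℝ) * (Real.log (eigX a b 0) * Real.log (rootInv a b 1 ^ 2)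
      - Real.log (eigX a b 1) * Real.log (rootInv a b 0 ^ 2)) = 0 := by
    linear_combination Real.log (rootInv a b 1 ^ 2) * h0 - Real.log (rootInv a b 0 ^ 2) * h1
  have hi0 : (i : ℝ) = 0 := by
    refine (mul_eq_zero.1 hi).resolve_right (ne_of_lt ?_)
    have := mul_pos (neg_pos.2 x0) y1
    have := mul_pos x1 y0
    linarith
  rw [hi0, zero_mul, zero_add] at h0
  have hj0 := (mul_eq_zero.1 h0).resolve_right y0.ne'
  exact ⟨by exact_mod_cast hi0, by exact_mod_cast hj0⟩

theorem period_injective (a b : ℕ) : Function.Injective (period a b) := by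
  intro z z' h
  have h1 : period a b (z - z') = 1 := by rw [period_sub, h, mul_inv_cancel]
  obtain ⟨h2, h3⟩ := periods_independent a b _ _ h1
  exact Prod.ext (sub_eq_zero.1 h2) (sub_eq_zero.1 h3)

/-! ### Vertices up to periods -/

/-- The determinant of the first three iterates of a vector. -/
noncomputable def iterDet (a b : ℕ) (v : Fin 3 → ℝ) : ℝ :=
  (Matrix.of ![v, act (familyOp a b) v, act (familyOp a b) (act (familyOp a b) v)]).det

/-- A commuting `g` transforms all three iterates at once, and has determinant one. Up to sign the
invariant is the product of the eigenforms; it is `1`, `a + 2` and `(a + 2)²` in absolute value at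
`D`, `F` and `G`. -/
theorem iterDet_act {a b : ℕ} {g : SL(3, ℤ)} (hg : Commute g (familyOp a b)) (v : Fin 3 → ℝ) :
    iterDet a b (act g v) = iterDet a b v := by
  rw [iterDet, ← act_commute hg, ← act_commute hg, iterDet]
  have h : Matrix.of ![act g v, act g (act (familyOp a b) v),
      act g (act (familyOp a b) (act (familyOp a b) v))] =
      Matrix.of ![v, act (familyOp a b) v, act (familyOp a b) (act (familyOp a b) v)] *
        ((g : Matrix (Fin 3) (Fin 3) ℤ).map (Int.cast : ℤ → ℝ)).transpose := by
    ext i j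
    rw [Matrix.mul_apply]
    fin_cases i <;>
      simp only [Matrix.of_apply, Fin.zero_eta, Fin.mk_one, Fin.reduceFinMk, Matrix.cons_val] <;>
      rw [act_apply g] <;>
      simp only [Matrix.mulVec, dotProduct, Matrix.transpose_apply, mul_comm]
  have hdet : ((g : Matrix (Fin 3) (Fin 3) ℤ).map (Int.cast : ℤ → ℝ)).det = 1 := by
    have := (Int.castRingHom ℝ).map_det (g : Matrix (Fin 3) (Fin 3) ℤ)
    rw [Matrix.SpecialLinearGroup.det_coe, map_one] at this
    exact this.symm
  rw [h, Matrix.det_mul, Matrix.det_transpose, hdet, mul_one]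

theorem iterDet_D (a b : ℕ) : iterDet a b (vtx a b .D) = -1 := by
  rw [vtx_D, iterDet, Matrix.det_fin_three]
  simp only [act_familyOp, Matrix.of_apply, Matrix.cons_val]
  ring

theorem iterDet_F (a b : ℕ) : iterDet a b (vtx a b .F) = -(a + 2) := by
  rw [vtx_F, iterDet, Matrix.det_fin_three]
  simp only [act_familyOp, Matrix.of_apply, Matrix.cons_val]
  ring

theorem iterDet_G (a b : ℕ) : iterDet a b (vtx a b .G) = -(a + 2) ^ 2 := by
  rw [vtx_G, iterDet, Matrix.det_fin_three]
  simp only [act_familyOp, Matrix.of_apply, Matrix.cons_val]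
  ring

/-- The representative of a vertex up to periods. -/
def rep : Vtx → Vtx
  | .A => .D | .B => .D | .C => .D | .D => .D | .E => .F | .F => .F | .G => .G

/-- The period moving the representative to the vertex. -/
def shift : Vtx → ℤ × ℤ
  | .A => (-1, 0) | .B => (-1, 1) | .C => (0, 1) | .D => 0 | .E => (0, 1) | .F => 0 | .G => 0

theorem vtx_eq_act_rep (a b : ℕ) (v : Vtx) :
    vtx a b v = act (period a b (shift v)) (vtx a b (rep v)) := by
  have hA : vtx a b .A = act (periodX a b)⁻¹ (vtx a b .D) := by
    rw [← act_periodX_A, act_inv_act]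
  cases v with
  | A => simp [shift, rep, period, hA]
  | B =>
    have : period a b (-1, 1) = periodY a b * (periodX a b)⁻¹ := by
      simp [period, (commute_periods a b).inv_left.eq]
    rw [shift, rep, this, act_mul_apply, ← hA, act_periodY_A]
  | C => simp [shift, rep, period, act_periodY_D]
  | D => simp [shift, rep, period_zero, act_one]
  | E => simp [shift, rep, period, act_periodY_F]
  | F => simp [shift, rep, period_zero, act_one]
  | G => simp [shift, rep, period_zero, act_one]

theorem commute_period (a b : ℕ) (z : ℤ × ℤ) : Commute (period a b z) (familyOp a b) :=
  (periodGroup_le a b (period_mem a b z)).1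

theorem eq_one_of_act_eq {a b : ℕ} {g : SL(3, ℤ)} (hg : Commute g (familyOp a b)) {p : Fin 3 → ℝ}
    (hp : p ∈ openCone a b) (h : act g p = p) : g = 1 := by
  refine eq_of_eigVal hg (Commute.one_left _) fun k => ?_
  have h1 := congrArg (eigForm a b k) h
  rw [eigForm_act hg] at h1
  rw [eigVal_one]
  exact mul_right_cancel₀ (hp k).ne' (by rw [h1, one_mul])

/-- `iterDet` forces equal representatives since `a + 2 > 1`. After undoing the shifts, `g` becomes
an operator fixing a point of the cone, which is the identity. From here on coincidences of
translated vertices are pure combinatorics. -/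
theorem act_vtx_eq_vtx {a b : ℕ} {g : SL(3, ℤ)} (hg : Commute g (familyOp a b)) {v w : Vtx}
    (h : act g (vtx a b v) = vtx a b w) : rep v = rep w ∧ g = period a b (shift w - shift v) := by
  have hdet : iterDet a b (vtx a b (rep v)) = iterDet a b (vtx a b (rep w)) := by
    have h1 := congrArg (iterDet a b) h
    rw [iterDet_act hg, vtx_eq_act_rep a b v, vtx_eq_act_rep a b w,
      iterDet_act (commute_period a b _), iterDet_act (commute_period a b _)] at h1
    exact h1
  have ha : (0 : ℝ) ≤ a := a.cast_nonneg
  have hrep : rep v = rep w := by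
    have hv : ∀ u, rep u = .D ∨ rep u = .F ∨ rep u = .G := by intro u; cases u <;> simp [rep]
    rcases hv v with h1 | h1 | h1 <;> rcases hv w with h2 | h2 | h2 <;> rw [h1, h2] at hdet ⊢ <;>
      simp only [iterDet_D, iterDet_F, iterDet_G] at hdet <;> exfalso <;> nlinarith
  refine ⟨hrep, ?_⟩
  rw [vtx_eq_act_rep a b v, vtx_eq_act_rep a b w, ← hrep, ← act_mul_apply] at h
  have h2 := congrArg (act (period a b (shift w))⁻¹) h
  rw [act_inv_act, ← act_mul_apply] at h2
  have h3 := eq_one_of_act_eq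
    ((commute_period a b _).inv_left.mul_left (hg.mul_left (commute_period a b _)))
    (vtx_mem_openCone a b _) h2
  rw [inv_mul_eq_one, ← mul_inv_eq_iff_eq_mul] at h3
  rw [period_sub, h3]

theorem vtx_injective (a b : ℕ) : Function.Injective (vtx a b) := by
  intro v w h
  have h0 : act 1 (vtx a b v) = vtx a b w := by rw [act_one, LinearMap.id_apply, h]
  obtain ⟨h1, h2⟩ := act_vtx_eq_vtx (Commute.one_left _) h0
  rw [← period_zero a b] at h2
  have h3 := period_injective a b h2
  have key : ∀ v w : Vtx, rep v = rep w → (0 : ℤ × ℤ) = shift w - shift v → v = w := by decide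
  exact key v w h1 h3

/-! ### Extreme points -/

/-- The action of an operator as a homeomorphism. -/
noncomputable def actHomeo (g : SL(3, ℤ)) : (Fin 3 → ℝ) ≃ₜ (Fin 3 → ℝ) where
  toFun := act g
  invFun := act g⁻¹
  left_inv := act_inv_act g
  right_inv := act_act_inv g
  continuous_toFun := (act g).continuous_of_finiteDimensional
  continuous_invFun := (act g⁻¹).continuous_of_finiteDimensional

theorem continuous_act (g : SL(3, ℤ)) : Continuous (act g) :=
  (act g).continuous_of_finiteDimensional

theorem act_mem_hull {a b : ℕ} {g : SL(3, ℤ)} (hg : g ∈ positiveGroup a b) {x : Fin 3 → ℝ}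
    (hx : x ∈ hull a b) : act g x ∈ hull a b := by
  have h : act g '' hull a b ⊆ hull a b := by
    rw [hull_eq, LinearMap.image_convexHull]
    refine convexHull_mono ?_
    rintro _ ⟨p, ⟨hp, hp'⟩, rfl⟩
    exact ⟨act_mem_openCone hg hp, act_mem_integerPoints g hp'⟩
  exact h ⟨x, hx, rfl⟩

theorem act_image_hull {a b : ℕ} {g : SL(3, ℤ)} (hg : g ∈ positiveGroup a b) :
    act g '' hull a b = hull a b := by
  refine Set.Subset.antisymm (by rintro _ ⟨x, hx, rfl⟩; exact act_mem_hull hg hx) fun x hx => ?_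
  exact ⟨act g⁻¹ x, act_mem_hull (inv_mem hg) hx, act_act_inv g x⟩

theorem act_image_sail {a b : ℕ} {g : SL(3, ℤ)} (hg : g ∈ positiveGroup a b) :
    act g '' sail (familyOp a b) ![0, 0, 1] = sail (familyOp a b) ![0, 0, 1] := by
  have h := (actHomeo g).image_frontier (hull a b)
  have h2 : (actHomeo g : (Fin 3 → ℝ) → (Fin 3 → ℝ)) = act g := rfl
  rw [h2, act_image_hull hg] at h
  exact h

theorem act_mem_extremePoints {a b : ℕ} {g : SL(3, ℤ)} (hg : g ∈ positiveGroup a b)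
    {x : Fin 3 → ℝ} (hx : x ∈ (hull a b).extremePoints ℝ) :
    act g x ∈ (hull a b).extremePoints ℝ := by
  rw [mem_extremePoints] at hx ⊢
  refine ⟨act_mem_hull hg hx.1, fun y hy z hz hyz => ?_⟩
  have h1 : x ∈ openSegment ℝ (act g⁻¹ y) (act g⁻¹ z) := by
    obtain ⟨s, t, hs, ht, hst, h⟩ := hyz
    refine ⟨s, t, hs, ht, hst, ?_⟩
    rw [← act_inv_act g x, ← h, map_add, map_smul, map_smul]
  obtain ⟨h2, h3⟩ := hx.2 _ (act_mem_hull (inv_mem hg) hy) _ (act_mem_hull (inv_mem hg) hz) h1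
  exact ⟨by rw [← h2, act_act_inv], by rw [← h3, act_act_inv]⟩

/-- If `p` is inside a segment of the hull, every form attaining its lower bound `1` at `p` attains
it at both ends. -/
theorem mem_extremePoints_of_forms {a b : ℕ} {p : Fin 3 → ℝ} (hp : p ∈ hull a b)
    (T : Set (SL(3, ℤ) × Facet)) (hT : ∀ q ∈ T, q.1 ∈ periodGroup a b ∧
      facetForm a b q.2 (act q.1 p) = 1)
    (huniq : ∀ x, (∀ q ∈ T, facetForm a b q.2 (act q.1 x) = 1) → x = p) :
    p ∈ (hull a b).extremePoints ℝ := by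
  rw [mem_extremePoints]
  refine ⟨hp, fun y hy z hz hyz => ?_⟩
  obtain ⟨s, t, hs, ht, hst, h⟩ := hyz
  have hq : ∀ q ∈ T, facetForm a b q.2 (act q.1 y) = 1 ∧ facetForm a b q.2 (act q.1 z) = 1 := by
    intro q hq
    obtain ⟨hq1, hq2⟩ := hT q hq
    have h1 := (mem_hull_iff.1 hy).2 q.1 hq1 q.2
    have h2 := (mem_hull_iff.1 hz).2 q.1 hq1 q.2
    rw [← h, map_add, map_smul, map_smul, map_add, map_smul, map_smul, smul_eq_mul,
      smul_eq_mul] at hq2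
    constructor <;> nlinarith
  exact ⟨huniq y fun q h => (hq q h).1, huniq z fun q h => (hq q h).2⟩

theorem vtx_mem_hull (a b : ℕ) (v : Vtx) : vtx a b v ∈ hull a b :=
  mem_hull_of_integer (vtx_mem_openCone a b v) (vtx_mem_integerPoints a b v)

theorem eq_of_smul_eq {E : Type*} [AddCommGroup E] [Module ℝ E] {φ : E →ₗ[ℝ] ℝ} {x p : E} {c : ℝ}
    (hx : φ x = 1) (hp : φ p = 1) (h : c • p = x) : x = p := by
  have h1 := congrArg φ h
  rw [map_smul, hp, hx, smul_eq_mul, mul_one] at h1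
  rw [← h, h1, one_smul]

theorem vtx_mem_extremePoints (a b : ℕ) (v : Vtx) :
    vtx a b v ∈ (hull a b).extremePoints ℝ := by
  have key : ∀ u, vtx a b (rep u) ∈ (hull a b).extremePoints ℝ := by
    have hD : vtx a b .D ∈ (hull a b).extremePoints ℝ := by
      refine mem_extremePoints_of_forms (vtx_mem_hull a b _)
        {(1, .CDG), (1, .BDGE), ((periodX a b)⁻¹, .ABF)} ?_ ?_
      · rintro _ (rfl | rfl | rfl)
        · refine ⟨one_mem _, ?_⟩
          rw [act_one]; exact facetForm_vtx (by simp [facetVerts])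
        · refine ⟨one_mem _, ?_⟩
          rw [act_one]; exact facetForm_vtx (by simp only [facetVerts]; split_ifs <;> decide)
        · refine ⟨inv_mem (periodX_mem a b), ?_⟩
          rw [← act_periodX_A, act_inv_act]; exact facetForm_vtx (by simp [facetVerts])
      · intro x hx
        have h1 := hx (1, .CDG) (by simp)
        have h2 := hx (1, .BDGE) (by simp)
        have h3 := hx ((periodX a b)⁻¹, .ABF) (by simp)
        simp only [act_one, LinearMap.id_apply] at h1 h2 h3
        -- Three planes meet at `D`. The equal form values kill the weights of `C` and `G`, so `x`
        -- is a multiple of `D`; `F` and `G` are treated in the same way.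
        have h := weight_CDG a b x
        rw [h1, h2, h3, sub_self, zero_div, zero_smul, zero_smul, zero_add, add_zero] at h
        exact eq_of_smul_eq h1 (facetForm_vtx (by simp [facetVerts])) h
    have hF : vtx a b .F ∈ (hull a b).extremePoints ℝ := by
      refine mem_extremePoints_of_forms (vtx_mem_hull a b _)
        {(1, .BDF), (1, .ABF), (periodY a b, .CEG)} ?_ ?_
      · rintro _ (rfl | rfl | rfl)
        · refine ⟨one_mem _, ?_⟩
          rw [act_one]; exact facetForm_vtx (by simp only [facetVerts]; split_ifs <;> decide)
        · refine ⟨one_mem _, ?_⟩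
          rw [act_one]; exact facetForm_vtx (by simp [facetVerts])
        · refine ⟨periodY_mem a b, ?_⟩
          rw [act_periodY_F]; exact facetForm_vtx (by simp [facetVerts])
      · intro x hx
        have h1 := hx (1, .BDF) (by simp)
        have h2 := hx (1, .ABF) (by simp)
        have h3 := hx (periodY a b, .CEG) (by simp)
        simp only [act_one, LinearMap.id_apply] at h1 h2 h3
        have h := weight_BDF a b x
        rw [h1, h2, h3, sub_self, zero_mul, zero_div, zero_div, zero_smul, zero_smul, zero_add,
          zero_add] at h
        exact eq_of_smul_eq h2 (facetForm_vtx (by simp [facetVerts])) h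
    have hG : vtx a b .G ∈ (hull a b).extremePoints ℝ := by
      refine mem_extremePoints_of_forms (vtx_mem_hull a b _)
        {(1, .CDG), (1, .BDGE), (1, .CEG)} ?_ ?_
      · rintro _ (rfl | rfl | rfl)
        · refine ⟨one_mem _, ?_⟩
          rw [act_one]; exact facetForm_vtx (by simp [facetVerts])
        · refine ⟨one_mem _, ?_⟩
          rw [act_one]; exact facetForm_vtx (by simp only [facetVerts]; split_ifs <;> decide)
        · refine ⟨one_mem _, ?_⟩
          rw [act_one]; exact facetForm_vtx (by simp [facetVerts])
      · intro x hx
        have h1 := hx (1, .CDG) (by simp)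
        have h2 := hx (1, .BDGE) (by simp)
        have h3 := hx (1, .CEG) (by simp)
        simp only [act_one, LinearMap.id_apply] at h1 h2 h3
        have h := weight_CDG a b x
        rw [h1, h2, h3, sub_self, zero_mul, zero_div, zero_smul, zero_smul, zero_add,
          zero_add] at h
        exact eq_of_smul_eq h1 (facetForm_vtx (by simp [facetVerts])) h
    intro u
    cases u <;> assumption
  rw [vtx_eq_act_rep]
  exact act_mem_extremePoints (periodGroup_le a b (period_mem a b _)) (key v)

/-! ### Facets as convex hulls -/

theorem exists_weight_of_form_eq_one {a b : ℕ} {x : Fin 3 → ℝ} (hx : x ∈ hull a b) {h : SL(3, ℤ)}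
    (hh : h ∈ periodGroup a b) {i : Facet} (h1 : facetForm a b i (act h x) = 1) :
    ∃ t : Tri, t.verts ⊆ facetVerts a i ∧ ∃ w, IsWeight t.verts w ∧ ∑ u, w u = 1 ∧
      ∑ u, w u • vtx a b u = act h x := by
  obtain ⟨t, ht, w, hw, hwv⟩ := exists_tri_weight (a := a) (b := b) (v := act h x) (i := i)
    fun h' hh' j => by
      rw [h1, ← act_mul_apply]
      exact (mem_hull_iff.1 hx).2 _ (mul_mem hh' hh) j
  refine ⟨t, ht, w, hw, ?_, hwv⟩
  rw [← facetForm_sum ht hw.2, hwv, h1]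

theorem sum_mem_convexHull {E : Type*} [AddCommGroup E] [Module ℝ E] {f : Vtx → E} {S : Finset Vtx}
    {w : Vtx → ℝ} (hw : IsWeight S w) (hs : ∑ u, w u = 1) :
    ∑ u, w u • f u ∈ convexHull ℝ (f '' S) := by
  have h1 : ∑ u ∈ S, w u = 1 := by
    rw [← hs]; exact Finset.sum_subset (Finset.subset_univ _) fun u _ hu => hw.2 u hu
  have h2 : ∑ u, w u • f u = ∑ u ∈ S, w u • f u :=
    (Finset.sum_subset (Finset.subset_univ _) fun u _ hu => by rw [hw.2 u hu, zero_smul]).symm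
  rw [h2]
  exact (convex_convexHull ℝ _).sum_mem (fun u _ => hw.1 u) h1
    fun u hu => subset_convexHull ℝ _ ⟨u, hu, rfl⟩

theorem exists_weight_of_mem_convexHull {E : Type*} [AddCommGroup E] [Module ℝ E] {f : Vtx → E}
    {S : Finset Vtx} {x : E} (hx : x ∈ convexHull ℝ (f '' S)) :
    ∃ w, IsWeight S w ∧ ∑ u, w u = 1 ∧ ∑ u, w u • f u = x := by
  refine convexHull_min (t := {x | ∃ w, IsWeight S w ∧ ∑ u, w u = 1 ∧ ∑ u, w u • f u = x})
    ?_ ?_ hx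
  · rintro _ ⟨v, hv, rfl⟩
    refine ⟨Pi.single v 1, ⟨fun u => ?_, fun u hu => ?_⟩, by simp [Pi.single_apply],
      by simp [Pi.single_apply, ite_smul]⟩
    · rw [Pi.single_apply]; split_ifs <;> norm_num
    · rw [Pi.single_apply, if_neg]
      rintro rfl
      exact hu hv
  · rintro _ ⟨w, hw, hs, rfl⟩ _ ⟨w', hw', hs', rfl⟩ s t hs0 ht0 hst
    refine ⟨fun u => s * w u + t * w' u, ⟨fun u => ?_, fun u hu => ?_⟩, ?_, ?_⟩
    · exact add_nonneg (mul_nonneg hs0 (hw.1 u)) (mul_nonneg ht0 (hw'.1 u))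
    · simp only [hw.2 u hu, hw'.2 u hu, mul_zero, add_zero]
    · rw [Finset.sum_add_distrib, ← Finset.mul_sum, ← Finset.mul_sum, hs, hs', mul_one, mul_one, hst]
    · simp only [add_smul, mul_smul, Finset.sum_add_distrib, ← Finset.smul_sum]

theorem IsWeight.mono {S T : Finset Vtx} {w : Vtx → ℝ} (hw : IsWeight S w) (h : S ⊆ T) :
    IsWeight T w :=
  ⟨hw.1, fun v hv => hw.2 v fun hS => hv (h hS)⟩

/-- On the plane of the facet the form attains its global lower bound, so the point is minimal and
the barycentric identities place it in one of the triangles of the facet. -/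
theorem facet_eq_convexHull (a b : ℕ) (i : Facet) :
    {x | x ∈ hull a b ∧ facetForm a b i x = 1} = convexHull ℝ (vtx a b '' facetVerts a i) := by
  ext x
  constructor
  · rintro ⟨hx, h1⟩
    obtain ⟨t, ht, w, hw, hs, hwx⟩ := exists_weight_of_form_eq_one hx (one_mem _) (i := i)
      (by rwa [act_one])
    rw [act_one, LinearMap.id_apply] at hwx
    rw [← hwx]
    exact sum_mem_convexHull (hw.mono ht) hs
  · intro hx
    have hsub : vtx a b '' facetVerts a i ⊆ hull a b := by
      rintro _ ⟨v, -, rfl⟩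
      exact vtx_mem_hull a b v
    refine ⟨convexHull_min hsub (convex_hull a b) hx, ?_⟩
    obtain ⟨w, hw, hs, rfl⟩ := exists_weight_of_mem_convexHull hx
    rw [facetForm_sum subset_rfl hw.2, hs]

theorem eq_vtx_of_extreme {a b : ℕ} {x : Fin 3 → ℝ} (hx : x ∈ (hull a b).extremePoints ℝ)
    {S : Finset Vtx} (hS : x ∈ convexHull ℝ (vtx a b '' S)) : ∃ v ∈ S, vtx a b v = x := by
  have hsub : convexHull ℝ (vtx a b '' S) ⊆ hull a b := by
    refine convexHull_min ?_ (convex_hull a b)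
    rintro _ ⟨v, -, rfl⟩
    exact vtx_mem_hull a b v
  have h := inter_extremePoints_subset_extremePoints_of_subset hsub ⟨hS, hx⟩
  obtain ⟨v, hv, hvx⟩ := extremePoints_convexHull_subset h
  exact ⟨v, hv, hvx⟩

theorem exists_vtx_of_extreme {a b : ℕ} {x : Fin 3 → ℝ} (hx : x ∈ (hull a b).extremePoints ℝ)
    {h : SL(3, ℤ)} (hh : h ∈ periodGroup a b) {i : Facet} (h1 : facetForm a b i (act h x) = 1) :
    ∃ v ∈ facetVerts a i, vtx a b v = act h x := by
  have hx' := act_mem_extremePoints (periodGroup_le a b hh) hx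
  refine eq_vtx_of_extreme hx' ?_
  rw [← facet_eq_convexHull]
  exact ⟨hx'.1, h1⟩

/-! ### The sail group -/

theorem vtx_mem_sail (a b : ℕ) (v : Vtx) : vtx a b v ∈ sail (familyOp a b) ![0, 0, 1] := by
  refine mem_sail_iff.2 ⟨vtx_mem_hull a b v, 1, one_mem _, ?_⟩
  have h : ∃ i, v ∈ facetVerts a i := by
    cases v
    exacts [⟨.ABF, by simp [facetVerts]⟩, ⟨.ABF, by simp [facetVerts]⟩, ⟨.CDG, by simp [facetVerts]⟩, ⟨.CDG, by simp [facetVerts]⟩,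
      ⟨.CEG, by simp [facetVerts]⟩, ⟨.ABF, by simp [facetVerts]⟩, ⟨.CDG, by simp [facetVerts]⟩]
  obtain ⟨i, hi⟩ := h
  exact ⟨i, by rw [act_one]; exact facetForm_vtx hi⟩

/-- The image of `D` is an extreme point of the sail, so some period `h` moves it to one of the
seven vertices. By the classification of such coincidences `h * g` is itself a period. -/
theorem positiveGroup_le_periodGroup (a b : ℕ) : positiveGroup a b ≤ periodGroup a b := by
  intro g hg
  have h1 : act g (vtx a b .D) ∈ sail (familyOp a b) ![0, 0, 1] := by
    rw [← act_image_sail hg]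
    exact ⟨_, vtx_mem_sail a b .D, rfl⟩
  obtain ⟨h2, h, hh, j, hj⟩ := mem_sail_iff.1 h1
  obtain ⟨v, -, hv⟩ := exists_vtx_of_extreme
    (act_mem_extremePoints hg (vtx_mem_extremePoints a b .D)) hh hj
  rw [← act_mul_apply] at hv
  have h3 := (act_vtx_eq_vtx ((periodGroup_le a b hh).1.mul_left hg.1) hv.symm).2
  have h4 : h * g ∈ periodGroup a b := by rw [h3]; exact period_mem a b _
  exact (Subgroup.mul_mem_cancel_left _ hh).1 h4

/-- All eigenforms are `1` at `D`, so the eigenvalues of `g` are the eigenforms of `g D`. These are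
positive because `g D` is on the sail. -/
theorem sailGroup_eq (a b : ℕ) : sailGroup (familyOp a b) ![0, 0, 1] = periodGroup a b := by
  refine le_antisymm (fun g hg => positiveGroup_le_periodGroup a b ⟨hg.1, fun k => ?_⟩)
    fun g hg => ⟨(periodGroup_le a b hg).1, act_image_sail (periodGroup_le a b hg)⟩
  have h : act g (vtx a b .D) ∈ sail (familyOp a b) ![0, 0, 1] := by
    have := hg.2
    rw [← this]
    exact ⟨_, vtx_mem_sail a b .D, rfl⟩
  exact (mem_hull_iff.1 (mem_sail_iff.1 h).1).1 k

/-! ### Independence of the vertices of a triangle -/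

theorem tri_span (a b : ℕ) (t : Tri) (x : Fin 3 → ℝ) :
    x ∈ Submodule.span ℝ (vtx a b '' t.verts) := by
  have h3 : ∀ {p q r : Vtx} {α β γ : ℝ}, α • vtx a b p + β • vtx a b q + γ • vtx a b r = x →
      p ∈ t.verts → q ∈ t.verts → r ∈ t.verts → x ∈ Submodule.span ℝ (vtx a b '' t.verts) := by
    intro p q r α β γ h hp hq hr
    rw [← h]
    exact add_mem (add_mem (Submodule.smul_mem _ _ (Submodule.subset_span ⟨p, hp, rfl⟩))
      (Submodule.smul_mem _ _ (Submodule.subset_span ⟨q, hq, rfl⟩)))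
      (Submodule.smul_mem _ _ (Submodule.subset_span ⟨r, hr, rfl⟩))
  cases t with
  | ABF => exact h3 (weight_ABF a b x) (by decide) (by decide) (by decide)
  | BDF => exact h3 (weight_BDF a b x) (by decide) (by decide) (by decide)
  | BDG => exact h3 (weight_BDG a b x) (by decide) (by decide) (by decide)
  | BGE => exact h3 (weight_BGE a b x) (by decide) (by decide) (by decide)
  | CDG => exact h3 (weight_CDG a b x) (by decide) (by decide) (by decide)
  | CEG => exact h3 (weight_CEG a b x) (by decide) (by decide) (by decide)

theorem Tri.card_verts (t : Tri) : t.verts.card = 3 := by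
  cases t <;> rfl

/-- The barycentric identities express every vector through the three vertices, and three vectors
spanning a space of dimension three are independent. -/
theorem tri_linearIndependent (a b : ℕ) (t : Tri) :
    LinearIndependent ℝ (fun v : t.verts => vtx a b v) := by
  refine linearIndependent_of_top_le_span_of_card_eq_finrank (fun x _ => ?_) ?_
  · have h : Set.range (fun v : t.verts => vtx a b v) = vtx a b '' t.verts := by
      ext y; simp
    rw [h]
    exact tri_span a b t x
  · simp [t.card_verts]

theorem weight_eq_of_tri {a b : ℕ} {t : Tri} {w w' : Vtx → ℝ} (hw : ∀ u, u ∉ t.verts → w u = 0)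
    (hw' : ∀ u, u ∉ t.verts → w' u = 0)
    (h : ∑ u, w u • vtx a b u = ∑ u, w' u • vtx a b u) : w = w' := by
  have hli := tri_linearIndependent a b t
  rw [Fintype.linearIndependent_iff] at hli
  have h0 : ∑ u : t.verts, (w u - w' u) • vtx a b u = 0 := by
    rw [Finset.sum_coe_sort t.verts (fun u => (w u - w' u) • vtx a b u)]
    rw [Finset.sum_subset (Finset.subset_univ _) fun u _ hu => by simp [hw u hu, hw' u hu]]
    simp only [sub_smul, Finset.sum_sub_distrib]
    rw [h, sub_self]
  funext u
  by_cases hu : u ∈ t.verts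
  · exact sub_eq_zero.1 (hli (fun u => w u - w' u) h0 ⟨u, hu⟩)
  · rw [hw u hu, hw' u hu]

/-! ### Dimensions -/

/-- The action of an operator as a linear equivalence. -/
noncomputable def actEquiv (g : SL(3, ℤ)) : (Fin 3 → ℝ) ≃ₗ[ℝ] (Fin 3 → ℝ) :=
  LinearEquiv.ofLinearMap (act g) (act g⁻¹) (LinearMap.ext (act_act_inv g))
    (LinearMap.ext (act_inv_act g))

theorem finrank_vectorSpan_act (g : SL(3, ℤ)) (S : Set (Fin 3 → ℝ)) :
    Module.finrank ℝ (vectorSpan ℝ (act g '' S)) = Module.finrank ℝ (vectorSpan ℝ S) := by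
  have h := (act g).toAffineMap.map_vectorSpan (s := S)
  rw [← (actEquiv g).finrank_map_eq (vectorSpan ℝ S)]
  exact congrArg (fun p : Submodule ℝ (Fin 3 → ℝ) => Module.finrank ℝ p) h.symm

theorem vectorSpan_convexHull {E : Type*} [AddCommGroup E] [Module ℝ E] (S : Set E) :
    vectorSpan ℝ (convexHull ℝ S) = vectorSpan ℝ S := by
  rw [← direction_affineSpan, affineSpan_convexHull, direction_affineSpan]

theorem finrank_singleton (a b : ℕ) (v : Vtx) :
    Module.finrank ℝ (vectorSpan ℝ (convexHull ℝ (vtx a b '' {v}))) = 0 := by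
  rw [vectorSpan_convexHull, Set.image_singleton, vectorSpan_singleton, finrank_bot]

theorem finrank_pair {a b : ℕ} {v w : Vtx} (h : v ≠ w) :
    Module.finrank ℝ (vectorSpan ℝ (convexHull ℝ (vtx a b '' {v, w}))) = 1 := by
  rw [vectorSpan_convexHull, Set.image_pair]
  have h1 := affineIndependent_of_ne ℝ ((vtx_injective a b).ne h)
  have h2 := h1.finrank_vectorSpan (n := 1) (by simp)
  rwa [Matrix.range_cons, Matrix.range_cons, Matrix.range_empty, Set.union_empty,
    Set.singleton_union] at h2

theorem exists_tri_subset (a : ℕ) (i : Facet) : ∃ t : Tri, t.verts ⊆ facetVerts a i := by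
  cases i
  · exact ⟨.ABF, subset_rfl⟩
  · exact ⟨.CDG, subset_rfl⟩
  · exact ⟨.CEG, subset_rfl⟩
  · exact ⟨.BDF, by simp only [facetVerts]; split_ifs <;> decide⟩
  · exact ⟨.BDG, by simp only [facetVerts]; split_ifs <;> decide⟩

theorem finrank_facet (a b : ℕ) (i : Facet) :
    Module.finrank ℝ (vectorSpan ℝ (convexHull ℝ (vtx a b '' facetVerts a i))) = 2 := by
  rw [vectorSpan_convexHull]
  obtain ⟨t, ht⟩ := exists_tri_subset a i
  apply le_antisymm
  · have hle : vectorSpan ℝ (vtx a b '' facetVerts a i) ≤ LinearMap.ker (facetForm a b i) := by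
      rw [vectorSpan, Submodule.span_le]
      rintro _ ⟨_, ⟨v, hv, rfl⟩, _, ⟨w, hw, rfl⟩, rfl⟩
      simp only [SetLike.mem_coe, LinearMap.mem_ker, vsub_eq_sub, map_sub]
      rw [facetForm_vtx hv, facetForm_vtx hw, sub_self]
    refine (Submodule.finrank_mono hle).trans ?_
    have h := (facetForm a b i).finrank_range_add_finrank_ker
    have h1 : LinearMap.range (facetForm a b i) = ⊤ := by
      refine LinearMap.range_eq_top.2 fun c => ?_
      obtain ⟨v, hv⟩ := Finset.card_pos.1 (by rw [t.card_verts]; norm_num : 0 < t.verts.card)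
      exact ⟨c • vtx a b v, by rw [map_smul, facetForm_vtx (ht hv), smul_eq_mul, mul_one]⟩
    rw [h1, finrank_top] at h
    simp at h
    omega
  · have h := ((tri_linearIndependent a b t).affineIndependent ℝ).finrank_vectorSpan (n := 2)
      (by simp [t.card_verts])
    rw [← h]
    refine Submodule.finrank_mono (vectorSpan_mono ℝ ?_)
    rintro _ ⟨⟨v, hv⟩, rfl⟩
    exact ⟨v, ht hv, rfl⟩

/-! ### Exposed faces -/

theorem isExposed_form {E : Type*} [AddCommGroup E] [Module ℝ E] [TopologicalSpace E]
    [IsTopologicalAddGroup E] [ContinuousSMul ℝ E] [T2Space E] [FiniteDimensional ℝ E]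
    {K : Set E} (φ : E →ₗ[ℝ] ℝ) {c : ℝ} (hφ : ∀ x ∈ K, c ≤ φ x) :
    IsExposed ℝ K {x | x ∈ K ∧ φ x = c} := by
  rintro ⟨y, hy, hyc⟩
  -- Exposed faces are defined by maximizing a functional, while here the form is minimal on the
  -- face.
  refine ⟨-LinearMap.toContinuousLinearMap φ, ?_⟩
  ext x
  simp only [Set.mem_ofPred_eq, neg_apply, neg_le_neg_iff,
    LinearMap.coe_toContinuousLinearMap']
  constructor
  · rintro ⟨hx, hxc⟩
    exact ⟨hx, fun z hz => by rw [hxc]; exact hφ z hz⟩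
  · rintro ⟨hx, hz⟩
    exact ⟨hx, le_antisymm (by rw [← hyc]; exact hz y hy) (hφ x hx)⟩

/-- The vertices of a facet that lie on all facets of a list; a facet in the list is given by its
name and the period mapping it to the fundamental region. -/
def linkVerts (a : ℕ) (i : Facet) (T : List ((ℤ × ℤ) × Facet)) : Finset Vtx :=
  (facetVerts a i).filter fun v => ∀ q ∈ T, ∃ v' ∈ facetVerts a q.2,
    rep v = rep v' ∧ shift v' - shift v = q.1

/-- A vertex on the plane of a translated facet is extreme, hence one of its vertices. So the
incidence of vertices and facets is decidable from `rep` and `shift`. -/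
theorem facetForm_period_vtx {a b : ℕ} {z : ℤ × ℤ} {j : Facet} {v : Vtx} :
    facetForm a b j (act (period a b z) (vtx a b v)) = 1 ↔
      ∃ v' ∈ facetVerts a j, rep v = rep v' ∧ shift v' - shift v = z := by
  constructor
  · intro h
    obtain ⟨v', hv', h1⟩ := exists_vtx_of_extreme (vtx_mem_extremePoints a b v)
      (period_mem a b z) h
    obtain ⟨h2, h3⟩ := act_vtx_eq_vtx (commute_period a b z) h1.symm
    exact ⟨v', hv', h2, (period_injective a b h3).symm⟩
  · rintro ⟨v', hv', h1, rfl⟩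
    rw [vtx_eq_act_rep a b v, ← act_mul_apply, ← period_add, sub_add_cancel, h1, ← vtx_eq_act_rep]
    exact facetForm_vtx hv'

/-- Each form is at least `1` at all vertices, so a convex combination has value `1` only if every
vertex of positive weight does. Thus an intersection of facets is the hull of the common vertices.
-/
theorem mem_convexHull_linkVerts {a b : ℕ} {i : Facet} {T : List ((ℤ × ℤ) × Facet)}
    {x : Fin 3 → ℝ} : x ∈ convexHull ℝ (vtx a b '' linkVerts a i T) ↔
      x ∈ hull a b ∧ facetForm a b i x = 1 ∧
        ∀ q ∈ T, facetForm a b q.2 (act (period a b q.1) x) = 1 := by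
  constructor
  · intro hx
    have hsub : convexHull ℝ (vtx a b '' linkVerts a i T) ⊆
        convexHull ℝ (vtx a b '' facetVerts a i) :=
      convexHull_mono (Set.image_mono (by exact_mod_cast Finset.filter_subset _ _))
    have h1 := hsub hx
    rw [← facet_eq_convexHull] at h1
    refine ⟨h1.1, h1.2, fun q hq => ?_⟩
    obtain ⟨w, hw, hs, rfl⟩ := exists_weight_of_mem_convexHull hx
    rw [map_sum, map_sum, ← hs]
    refine Finset.sum_congr rfl fun u _ => ?_
    rw [map_smul, map_smul, smul_eq_mul]
    by_cases hu : u ∈ linkVerts a i T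
    · rw [facetForm_period_vtx.2 ((Finset.mem_filter.1 hu).2 q hq), mul_one]
    · rw [hw.2 u hu, zero_mul]
  · rintro ⟨hx, h1, hT⟩
    have h2 : x ∈ convexHull ℝ (vtx a b '' facetVerts a i) := by
      rw [← facet_eq_convexHull]; exact ⟨hx, h1⟩
    obtain ⟨w, hw, hs, rfl⟩ := exists_weight_of_mem_convexHull h2
    refine sum_mem_convexHull ⟨hw.1, fun u hu => ?_⟩ hs
    by_contra hne
    have hpos : 0 < w u := lt_of_le_of_ne (hw.1 u) (Ne.symm hne)
    apply hu
    refine Finset.mem_filter.2 ⟨by_contra fun hV => hne (hw.2 u hV), fun q hq => ?_⟩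
    rw [← facetForm_period_vtx (b := b)]
    have h3 := hT q hq
    have hge : ∀ v, 1 ≤ facetForm a b q.2 (act (period a b q.1) (vtx a b v)) := fun v =>
      (mem_hull_iff.1 (vtx_mem_hull a b v)).2 _ (period_mem a b _) _
    rw [map_sum, map_sum, ← hs] at h3
    have h4 : ∑ v, w v * (facetForm a b q.2 (act (period a b q.1) (vtx a b v)) - 1) = 0 := by
      rw [← sub_eq_zero.2 h3, ← Finset.sum_sub_distrib]
      refine Finset.sum_congr rfl fun v _ => ?_
      rw [map_smul, map_smul, smul_eq_mul]; ring
    rw [Finset.sum_eq_zero_iff_of_nonneg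
      fun v _ => mul_nonneg (hw.1 v) (sub_nonneg.2 (hge v))] at h4
    have h5 := h4 u (Finset.mem_univ _)
    exact sub_eq_zero.1 ((mul_eq_zero.1 h5).resolve_left hne)

theorem isExposed_linkVerts (a b : ℕ) (i : Facet) (T : List ((ℤ × ℤ) × Facet)) :
    IsExposed ℝ (hull a b) (convexHull ℝ (vtx a b '' linkVerts a i T)) := by
  have h : convexHull ℝ (vtx a b '' linkVerts a i T) = {x | x ∈ hull a b ∧ facetForm a b i x = 1 ∧
      ∀ q ∈ T, facetForm a b q.2 (act (period a b q.1) x) = 1} :=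
    Set.ext fun x => mem_convexHull_linkVerts
  rw [h]
  clear h
  induction T with
  | nil =>
    have h1 : {x | x ∈ hull a b ∧ facetForm a b i x = 1 ∧
        ∀ q ∈ ([] : List ((ℤ × ℤ) × Facet)), facetForm a b q.2 (act (period a b q.1) x) = 1} =
        {x | x ∈ hull a b ∧ facetForm a b i x = 1} := by simp
    rw [h1]
    refine isExposed_form _ fun x hx => ?_
    have := (mem_hull_iff.1 hx).2 1 (one_mem _) i
    rwa [act_one] at this
  | cons q T ih =>
    have h1 := isExposed_form (K := hull a b)
      ((facetForm a b q.2).comp (act (period a b q.1))) (c := 1) fun x hx =>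
        (mem_hull_iff.1 hx).2 _ (period_mem a b _) _
    have e : {x | x ∈ hull a b ∧ facetForm a b i x = 1 ∧
        ∀ r ∈ q :: T, facetForm a b r.2 (act (period a b r.1) x) = 1} =
        {x | x ∈ hull a b ∧ facetForm a b i x = 1 ∧
          ∀ r ∈ T, facetForm a b r.2 (act (period a b r.1) x) = 1} ∩
        {x | x ∈ hull a b ∧ ((facetForm a b q.2).comp (act (period a b q.1))) x = 1} := by
      ext x
      simp only [Set.mem_ofPred_eq, List.forall_mem_cons, Set.mem_inter_iff, LinearMap.comp_apply]
      tauto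
    rw [e]
    exact ih.inter h1

theorem isSailFace_linkVerts {a b : ℕ} {i : Facet} {T : List ((ℤ × ℤ) × Facet)} {k : ℕ}
    (hne : (linkVerts a i T).Nonempty) (hk : Module.finrank ℝ
      (vectorSpan ℝ (convexHull ℝ (vtx a b '' linkVerts a i T))) = k) :
    IsSailFace (familyOp a b) ![0, 0, 1] k (convexHull ℝ (vtx a b '' linkVerts a i T)) := by
  obtain ⟨v, hv⟩ := hne
  refine ⟨⟨vtx a b v, subset_convexHull ℝ _ ⟨v, hv, rfl⟩⟩, fun heq => ?_,
    isExposed_linkVerts a b i T, hk⟩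
  -- The doubled vertex is in the hull but off the supporting plane, so the face is proper.
  have h2 : (2 : ℝ) • vtx a b v ∈ hull a b := smul_mem_hull (vtx_mem_hull a b v) (by norm_num)
  rw [hull, ← heq, mem_convexHull_linkVerts] at h2
  have h3 := h2.2.1
  rw [map_smul, facetForm_vtx (Finset.filter_subset _ _ hv)] at h3
  norm_num at h3

/-! ### Cells as finite sets of vertices -/

/-- The cells as finite sets. -/
def cellFinsets (a : ℕ) : ℕ → Finset (Finset Vtx)
  | 0 => {{.D}, {.F}, {.G}}
  | 1 => {{.A, .B}, {.A, .F}, {.F, .D}, {.B, .F}, {.D, .G}, {.E, .G}, {.C, .G}} ∪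
      if a = 0 then ∅ else {{.B, .D}}
  | 2 => {{.A, .B, .F}, {.C, .D, .G}, {.C, .E, .G}} ∪
      if a = 0 then {{.B, .F, .D, .G, .E}} else {{.B, .D, .F}, {.B, .D, .G, .E}}
  | _ => ∅

theorem mem_cells_iff {a k : ℕ} {s : Set Vtx} :
    s ∈ cells a k ↔ ∃ S ∈ cellFinsets a k, s = S := by
  have h1 : 1 ≤ a ↔ a ≠ 0 := Nat.one_le_iff_ne_zero
  by_cases ha : a = 0
  · match k with
    | 0 => simp [cells, cellFinsets]
    | 1 => simp [cells, cellFinsets, ha]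
    | 2 => simp [cells, cellFinsets, ha]
    | k + 3 => simp [cells, cellFinsets]
  · match k with
    | 0 => simp [cells, cellFinsets]
    | 1 => simp [cells, cellFinsets, ha, h1]
    | 2 => simp [cells, cellFinsets, ha, h1]; tauto
    | k + 3 => simp [cells, cellFinsets]

theorem facetVerts_eq_one {a : ℕ} (ha : a ≠ 0) : facetVerts a = facetVerts 1 := by
  funext i
  cases i <;> simp [facetVerts, ha]

theorem cellFinsets_eq_one {a : ℕ} (ha : a ≠ 0) : cellFinsets a = cellFinsets 1 := by
  funext k
  match k with
  | 0 => rfl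
  | 1 => simp [cellFinsets, ha]
  | 2 => simp [cellFinsets, ha]
  | k + 3 => rfl

theorem linkVerts_eq_one {a : ℕ} (ha : a ≠ 0) : linkVerts a = linkVerts 1 := by
  funext i T
  simp only [linkVerts, facetVerts_eq_one ha]

/-- The label of the image of a vertex under a period. -/
def label (z : ℤ × ℤ) (v : Vtx) : Vtx × (ℤ × ℤ) := (rep v, shift v + z)

theorem act_period_vtx (a b : ℕ) (z : ℤ × ℤ) (v : Vtx) : act (period a b z) (vtx a b v) =
    act (period a b (label z v).2) (vtx a b (label z v).1) := by
  rw [label, vtx_eq_act_rep a b v, ← act_mul_apply, ← period_add, add_comm]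

theorem act_period_vtx_eq_iff {a b : ℕ} {z : ℤ × ℤ} {v w : Vtx} :
    act (period a b z) (vtx a b v) = vtx a b w ↔ label z v = label 0 w := by
  constructor
  · intro h
    obtain ⟨h1, h2⟩ := act_vtx_eq_vtx (commute_period a b z) h
    rw [label, label, h1, period_injective a b h2, add_sub_cancel, add_zero]
  · intro h
    rw [act_period_vtx, h, ← act_period_vtx, period_zero, act_one, LinearMap.id_apply]

theorem act_image_convexHull_vtx {a b : ℕ} {z : ℤ × ℤ} {S T : Finset Vtx}
    (h : S.image (label z) = T.image (label 0)) :
    act (period a b z) '' convexHull ℝ (vtx a b '' S) = convexHull ℝ (vtx a b '' T) := by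
  rw [LinearMap.image_convexHull]
  congr 1
  ext x
  constructor
  · rintro ⟨_, ⟨v, hv, rfl⟩, rfl⟩
    have h1 : label z v ∈ T.image (label 0) := h ▸ Finset.mem_image_of_mem _ hv
    obtain ⟨w, hw, hvw⟩ := Finset.mem_image.1 h1
    exact ⟨w, hw, (act_period_vtx_eq_iff.2 hvw.symm).symm⟩
  · rintro ⟨w, hw, rfl⟩
    have h1 : label 0 w ∈ S.image (label z) := h ▸ Finset.mem_image_of_mem _ hw
    obtain ⟨v, hv, hvw⟩ := Finset.mem_image.1 h1
    exact ⟨_, ⟨v, hv, rfl⟩, act_period_vtx_eq_iff.2 hvw⟩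

theorem image_label_subset {a b : ℕ} {z : ℤ × ℤ} {S T : Finset Vtx}
    (h : act (period a b z) '' convexHull ℝ (vtx a b '' S) ⊆ convexHull ℝ (vtx a b '' T)) :
    S.image (label z) ⊆ T.image (label 0) := by
  intro l hl
  obtain ⟨v, hv, rfl⟩ := Finset.mem_image.1 hl
  obtain ⟨w, hw, hwv⟩ := eq_vtx_of_extreme
    (act_mem_extremePoints (periodGroup_le a b (period_mem a b z)) (vtx_mem_extremePoints a b v))
    (h ⟨_, subset_convexHull ℝ _ ⟨v, hv, rfl⟩, rfl⟩)
  exact Finset.mem_image.2 ⟨w, hw, (act_period_vtx_eq_iff.1 hwv.symm).symm⟩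

theorem image_label_eq {a b : ℕ} {z : ℤ × ℤ} {S T : Finset Vtx}
    (h : act (period a b z) '' convexHull ℝ (vtx a b '' S) = convexHull ℝ (vtx a b '' T)) :
    S.image (label z) = T.image (label 0) := by
  refine Finset.Subset.antisymm (image_label_subset h.le) fun l hl => ?_
  obtain ⟨w, hw, rfl⟩ := Finset.mem_image.1 hl
  have h1 : act (period a b (-z)) '' convexHull ℝ (vtx a b '' T) ⊆
      convexHull ℝ (vtx a b '' S) := by
    rw [← h, ← Set.image_comp]
    rintro _ ⟨x, hx, rfl⟩
    rwa [Function.comp_apply, period_neg, act_inv_act]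
  obtain ⟨v, hv, hvw⟩ := Finset.mem_image.1 (image_label_subset h1 (Finset.mem_image_of_mem _ hw))
  refine Finset.mem_image.2 ⟨v, hv, ?_⟩
  simp only [label, Prod.mk.injEq] at hvw ⊢
  exact ⟨hvw.1, by rw [add_zero] at hvw ⊢; rw [hvw.2]; abel⟩

/-! ### The cells are faces -/

/-- Each cell is exhibited as a facet cut by adjacent ones, some of them translated: for example
`AB` is where `ABF` meets the preimage of `CDG` under `X`. -/
theorem exists_linkVerts {a k : ℕ} {S : Finset Vtx} (hS : S ∈ cellFinsets a k) :
    ∃ i T, linkVerts a i T = S := by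
  by_cases ha : a = 0
  · subst ha
    match k with
    | 0 =>
      simp only [cellFinsets, Finset.mem_insert, Finset.mem_singleton] at hS
      rcases hS with rfl | rfl | rfl
      · exact ⟨.CDG, [(0, .BDGE), ((-1, 0), .ABF)], by decide⟩
      · exact ⟨.ABF, [(0, .BDF), ((0, 1), .CEG)], by decide⟩
      · exact ⟨.CDG, [(0, .BDGE), (0, .CEG)], by decide⟩
    | 1 =>
      simp only [cellFinsets, if_true, Finset.union_empty, Finset.mem_insert,
        Finset.mem_singleton] at hS
      rcases hS with rfl | rfl | rfl | rfl | rfl | rfl | rfl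
      · exact ⟨.ABF, [((1, 0), .CDG)], by decide⟩
      · exact ⟨.ABF, [((0, 1), .BDGE)], by decide⟩
      · exact ⟨.BDF, [((0, 1), .CEG)], by decide⟩
      · exact ⟨.ABF, [(0, .BDF)], by decide⟩
      · exact ⟨.CDG, [(0, .BDGE)], by decide⟩
      · exact ⟨.CEG, [(0, .BDGE)], by decide⟩
      · exact ⟨.CDG, [(0, .CEG)], by decide⟩
    | 2 =>
      simp only [cellFinsets, if_true, Finset.mem_union, Finset.mem_insert,
        Finset.mem_singleton] at hS
      rcases hS with (rfl | rfl | rfl) | rfl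
      · exact ⟨.ABF, [], by decide⟩
      · exact ⟨.CDG, [], by decide⟩
      · exact ⟨.CEG, [], by decide⟩
      · exact ⟨.BDF, [], by decide⟩
    | k + 3 => simp [cellFinsets] at hS
  · rw [cellFinsets_eq_one ha] at hS
    rw [linkVerts_eq_one ha]
    match k with
    | 0 =>
      simp only [cellFinsets, Finset.mem_insert, Finset.mem_singleton] at hS
      rcases hS with rfl | rfl | rfl
      · exact ⟨.CDG, [(0, .BDGE), ((-1, 0), .ABF)], by decide⟩
      · exact ⟨.ABF, [(0, .BDF), ((0, 1), .CEG)], by decide⟩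
      · exact ⟨.CDG, [(0, .BDGE), (0, .CEG)], by decide⟩
    | 1 =>
      simp only [cellFinsets, one_ne_zero, if_false, Finset.mem_union, Finset.mem_insert,
        Finset.mem_singleton] at hS
      rcases hS with (rfl | rfl | rfl | rfl | rfl | rfl | rfl) | rfl
      · exact ⟨.ABF, [((1, 0), .CDG)], by decide⟩
      · exact ⟨.ABF, [((0, 1), .BDGE)], by decide⟩
      · exact ⟨.BDF, [((0, 1), .CEG)], by decide⟩
      · exact ⟨.ABF, [(0, .BDF)], by decide⟩
      · exact ⟨.CDG, [(0, .BDGE)], by decide⟩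
      · exact ⟨.CEG, [(0, .BDGE)], by decide⟩
      · exact ⟨.CDG, [(0, .CEG)], by decide⟩
      · exact ⟨.BDF, [(0, .BDGE)], by decide⟩
    | 2 =>
      simp only [cellFinsets, one_ne_zero, if_false, Finset.mem_union, Finset.mem_insert,
        Finset.mem_singleton] at hS
      rcases hS with (rfl | rfl | rfl) | rfl | rfl
      · exact ⟨.ABF, [], by decide⟩
      · exact ⟨.CDG, [], by decide⟩
      · exact ⟨.CEG, [], by decide⟩
      · exact ⟨.BDF, [], by decide⟩
      · exact ⟨.BDGE, [], by decide⟩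
    | k + 3 => simp [cellFinsets] at hS

theorem exists_facetVerts_eq {a : ℕ} {S : Finset Vtx} (hS : S ∈ cellFinsets a 2) :
    ∃ i, facetVerts a i = S := by
  have h0 : ∀ S ∈ cellFinsets 0 2, ∃ i, facetVerts 0 i = S := by decide +kernel
  have h1 : ∀ S ∈ cellFinsets 1 2, ∃ i, facetVerts 1 i = S := by decide +kernel
  by_cases ha : a = 0
  · subst ha; exact h0 S hS
  · rw [cellFinsets_eq_one ha] at hS
    rw [facetVerts_eq_one ha]
    exact h1 S hS

theorem finrank_cell {a b k : ℕ} {S : Finset Vtx} (hS : S ∈ cellFinsets a k) :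
    Module.finrank ℝ (vectorSpan ℝ (convexHull ℝ (vtx a b '' S))) = k := by
  match k with
  | 0 =>
    have h : ∀ S ∈ cellFinsets 0 0, ∃ v, S = {v} := by decide +kernel
    obtain ⟨v, rfl⟩ := h S hS
    rw [Finset.coe_singleton]
    exact finrank_singleton a b v
  | 1 =>
    have h0 : ∀ S ∈ cellFinsets 0 1, ∃ v w, v ≠ w ∧ S = {v, w} := by decide +kernel
    have h1 : ∀ S ∈ cellFinsets 1 1, ∃ v w, v ≠ w ∧ S = {v, w} := by decide +kernel
    obtain ⟨v, w, hvw, rfl⟩ : ∃ v w, v ≠ w ∧ S = {v, w} := by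
      by_cases ha : a = 0
      · subst ha; exact h0 S hS
      · rw [cellFinsets_eq_one ha] at hS; exact h1 S hS
    rw [Finset.coe_pair]
    exact finrank_pair hvw
  | 2 =>
    obtain ⟨i, rfl⟩ := exists_facetVerts_eq hS
    exact finrank_facet a b i
  | k + 3 => simp [cellFinsets] at hS

theorem cell_nonempty {a k : ℕ} {S : Finset Vtx} (hS : S ∈ cellFinsets a k) : S.Nonempty := by
  match k with
  | 0 =>
    have h : ∀ S ∈ cellFinsets 0 0, S.Nonempty := by decide +kernel
    exact h S hS
  | 1 =>
    have h0 : ∀ S ∈ cellFinsets 0 1, S.Nonempty := by decide +kernel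
    have h1 : ∀ S ∈ cellFinsets 1 1, S.Nonempty := by decide +kernel
    by_cases ha : a = 0
    · subst ha; exact h0 S hS
    · rw [cellFinsets_eq_one ha] at hS; exact h1 S hS
  | 2 =>
    obtain ⟨i, rfl⟩ := exists_facetVerts_eq hS
    obtain ⟨t, ht⟩ := exists_tri_subset a i
    exact (Finset.card_pos.1 (by rw [t.card_verts]; norm_num)).mono ht
  | k + 3 => simp [cellFinsets] at hS

theorem isSailFace_cell {a b k : ℕ} {S : Finset Vtx} (hS : S ∈ cellFinsets a k) :
    IsSailFace (familyOp a b) ![0, 0, 1] k (convexHull ℝ (vtx a b '' S)) := by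
  obtain ⟨i, T, rfl⟩ := exists_linkVerts hS
  exact isSailFace_linkVerts (cell_nonempty hS) (finrank_cell hS)

theorem mem_regionFaces_iff {a b k : ℕ} {F : Set (Fin 3 → ℝ)} : F ∈ regionFaces a b k ↔
    ∃ S ∈ cellFinsets a k, F = convexHull ℝ (vtx a b '' S) := by
  simp only [regionFaces, Set.mem_ofPred_eq, mem_cells_iff]
  constructor
  · rintro ⟨s, ⟨S, hS, rfl⟩, rfl⟩
    exact ⟨S, hS, rfl⟩
  · rintro ⟨S, hS, rfl⟩
    exact ⟨S, ⟨S, hS, rfl⟩, rfl⟩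

/-- One pair of matching vertices determines `z`, which reduces the question to finitely many cases.
-/
theorem cell_unique {a k : ℕ} {S T : Finset Vtx} {z : ℤ × ℤ} (hS : S ∈ cellFinsets a k)
    (hT : T ∈ cellFinsets a k) (h : S.image (label z) = T.image (label 0)) : S = T := by
  obtain ⟨v, hv⟩ := cell_nonempty hS
  have h1 : label z v ∈ T.image (label 0) := h ▸ Finset.mem_image_of_mem _ hv
  obtain ⟨w, hw, hvw⟩ := Finset.mem_image.1 h1
  have hz : z = shift w - shift v := by
    have := congrArg Prod.snd hvw
    simp only [label, add_zero] at this
    rw [this, add_sub_cancel_left]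
  subst hz
  have key : ∀ a' ∈ ({0, 1} : Finset ℕ), ∀ k ∈ Finset.range 3, ∀ S ∈ cellFinsets a' k,
      ∀ T ∈ cellFinsets a' k, ∀ v ∈ S, ∀ w ∈ T,
      S.image (label (shift w - shift v)) = T.image (label 0) → S = T := by decide +kernel
  have hk : k ∈ Finset.range 3 := by
    match k with
    | 0 => decide
    | 1 => decide
    | 2 => decide
    | k + 3 => simp [cellFinsets] at hS
  by_cases ha : a = 0
  · subst ha; exact key 0 (by decide) k hk S hS T hT v hv w hw h
  · rw [cellFinsets_eq_one ha] at hS hT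
    exact key 1 (by decide) k hk S hS T hT v hv w hw h

/-! ### Faces are cells up to periods -/

theorem isExposed_image_act {K F : Set (Fin 3 → ℝ)} (h : IsExposed ℝ K F) (g : SL(3, ℤ)) :
    IsExposed ℝ (act g '' K) (act g '' F) := by
  rintro ⟨_, y, hy, rfl⟩
  obtain ⟨l, rfl⟩ := h ⟨y, hy⟩
  refine ⟨l.comp (LinearMap.toContinuousLinearMap (act g⁻¹)), ?_⟩
  ext x
  simp only [Set.mem_ofPred_eq, Set.mem_image, ContinuousLinearMap.comp_apply,
    LinearMap.coe_toContinuousLinearMap', forall_exists_index, and_imp,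
    forall_apply_eq_imp_iff₂, act_inv_act]
  constructor
  · rintro ⟨x, ⟨hx, hmax⟩, rfl⟩
    exact ⟨⟨x, hx, rfl⟩, fun z hz => by rw [act_inv_act]; exact hmax z hz⟩
  · rintro ⟨⟨x, hx, rfl⟩, hmax⟩
    exact ⟨x, ⟨hx, fun z hz => by have := hmax z hz; rwa [act_inv_act] at this⟩, rfl⟩

theorem isSailFace_image_act {a b k : ℕ} {F : Set (Fin 3 → ℝ)}
    (h : IsSailFace (familyOp a b) ![0, 0, 1] k F) {g : SL(3, ℤ)} (hg : g ∈ periodGroup a b) :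
    IsSailFace (familyOp a b) ![0, 0, 1] k (act g '' F) := by
  have hK := act_image_hull (periodGroup_le a b hg)
  refine ⟨h.1.image _, fun heq => h.2.1 ?_, ?_,
    by rw [finrank_vectorSpan_act, h.2.2.2]⟩
  · exact Set.image_injective.2 (Function.LeftInverse.injective (act_inv_act g)) (heq.trans hK.symm)
  · have h1 := isExposed_image_act h.2.2.1 g
    rwa [hK] at h1

theorem notMem_interior_of_isExposed {E : Type*} [AddCommGroup E] [Module ℝ E] [TopologicalSpace E]
    [IsTopologicalAddGroup E] [ContinuousSMul ℝ E] {K F : Set E} (h : IsExposed ℝ K F) (hne : F ≠ K)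
    {x : E} (hx : x ∈ F) : x ∉ interior K := by
  intro hint
  obtain ⟨l, hl⟩ := h ⟨x, hx⟩
  apply hne
  refine Set.Subset.antisymm h.subset fun y hy => ?_
  have hcont : Filter.Tendsto (fun s : ℝ => x + s • (x - y)) (nhdsWithin 0 (Set.Ioi 0)) (nhds x) := by
    have : Continuous fun s : ℝ => x + s • (x - y) := by fun_prop
    have h := this.tendsto 0
    rw [zero_smul, add_zero] at h
    exact h.mono_left nhdsWithin_le_nhds
  obtain ⟨s, hs, hs0⟩ :=
    ((hcont.eventually (isOpen_interior.mem_nhds hint)).and self_mem_nhdsWithin).exists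
  have hs0' : (0 : ℝ) < s := hs0
  rw [hl] at hx ⊢
  have h1 := hx.2 _ (interior_subset hs)
  rw [map_add, map_smul, map_sub, smul_eq_mul] at h1
  have h2 : l x ≤ l y := by
    by_contra hc
    push Not at hc
    have := mul_pos hs0' (sub_pos.2 hc)
    linarith
  exact ⟨hy, fun z hz => (hx.2 z hz).trans h2⟩

theorem mem_sail_of_face {a b : ℕ} {F : Set (Fin 3 → ℝ)} (hne : F ≠ hull a b)
    (hF : IsExposed ℝ (hull a b) F) {x : Fin 3 → ℝ} (hx : x ∈ F) :
    x ∈ sail (familyOp a b) ![0, 0, 1] := by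
  rw [sail, (isClosed_hull a b).frontier_eq]
  exact ⟨hF.subset hx, notMem_interior_of_isExposed hF hne hx⟩

/-- The centroid of finitely many points affinely spanning the face lies on the sail, so some form
equals `1` there. That form is at least `1` at each of the points, hence equal to `1` at all of them
and on their affine span. -/
theorem exists_facet_of_face {a b : ℕ} {F : Set (Fin 3 → ℝ)} (hF0 : F.Nonempty)
    (hne : F ≠ hull a b) (hF : IsExposed ℝ (hull a b) F) :
    ∃ h ∈ periodGroup a b, ∃ i, ∀ x ∈ F, facetForm a b i (act h x) = 1 := by
  obtain ⟨t, htF, hspan, hind⟩ := exists_affineIndependent ℝ (Fin 3 → ℝ) F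
  have hfin : t.Finite := finite_set_of_fin_dim_affineIndependent ℝ hind
  have htne : t.Nonempty := by
    rw [← affineSpan_nonempty (k := ℝ), hspan, affineSpan_nonempty]; exact hF0
  set T := hfin.toFinset with hT
  have hcard : (0 : ℝ) < T.card := by
    have : 0 < T.card := Finset.card_pos.2 (by simpa [hT] using htne)
    exact_mod_cast this
  have hmem : ∀ p ∈ T, p ∈ F := fun p hp => htF (by simpa [hT] using hp)
  have hc : ∑ p ∈ T, (T.card : ℝ)⁻¹ • p ∈ F :=
    (hF.convex (convex_hull a b)).sum_mem (fun _ _ => by positivity)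
      (by rw [Finset.sum_const, nsmul_eq_mul, mul_inv_cancel₀ hcard.ne']) hmem
  obtain ⟨-, h, hh, i, hi⟩ := mem_sail_iff.1 (mem_sail_of_face hne hF hc)
  refine ⟨h, hh, i, ?_⟩
  have hge : ∀ p ∈ T, 1 ≤ facetForm a b i (act h p) := fun p hp =>
    (mem_hull_iff.1 (hF.subset (hmem p hp))).2 h hh i
  have hsum : ∑ p ∈ T, (facetForm a b i (act h p) - 1) = 0 := by
    rw [← Finset.smul_sum, map_smul, map_smul, map_sum, map_sum, smul_eq_mul,
      inv_mul_eq_one₀ hcard.ne'] at hi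
    rw [Finset.sum_sub_distrib, ← hi]
    simp
  rw [Finset.sum_eq_zero_iff_of_nonneg fun p hp => sub_nonneg.2 (hge p hp)] at hsum
  intro x hx
  have hx' : x ∈ affineSpan ℝ t := by rw [hspan]; exact subset_affineSpan ℝ _ hx
  refine affineSpan_induction (p := fun x => facetForm a b i (act h x) = 1) hx' (fun p hp => ?_) ?_
  · exact sub_eq_zero.1 (hsum p (by simpa [hT] using hp))
  · intro c u v w hu hv hw
    rw [vsub_eq_sub, vadd_eq_add, map_add, map_add, map_smul, map_smul, map_sub, map_sub, hu, hv,
      hw, sub_self, smul_zero, zero_add]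

/-- The exposing functional is maximal at a convex combination of vertices only if it is maximal at
every vertex of positive weight. -/
theorem exposed_eq_convexHull {a b : ℕ} {F : Set (Fin 3 → ℝ)} (hF : IsExposed ℝ (hull a b) F)
    {S : Finset Vtx} (hS : F ⊆ convexHull ℝ (vtx a b '' S)) :
    ∃ W ⊆ S, F = convexHull ℝ (vtx a b '' W) := by
  classical
  refine ⟨S.filter fun v => vtx a b v ∈ F, Finset.filter_subset _ _, ?_⟩
  refine Set.Subset.antisymm (fun x hx => ?_) (convexHull_min ?_ (hF.convex (convex_hull a b)))
  · obtain ⟨w, hw, hs, hwx⟩ := exists_weight_of_mem_convexHull (hS hx)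
    rw [← hwx]
    refine sum_mem_convexHull ⟨hw.1, fun u hu => ?_⟩ hs
    by_contra hne
    have hpos : 0 < w u := lt_of_le_of_ne (hw.1 u) (Ne.symm hne)
    refine hu (Finset.mem_filter.2 ⟨by_contra fun h => hne (hw.2 u h), ?_⟩)
    obtain ⟨l, hl⟩ := hF ⟨x, hx⟩
    rw [hl] at hx ⊢
    have h0 : ∑ v, w v * (l x - l (vtx a b v)) = 0 := by
      have h1 : ∑ v, w v * l (vtx a b v) = l x := by
        rw [← hwx, map_sum]
        exact Finset.sum_congr rfl fun v _ => by rw [map_smul, smul_eq_mul]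
      simp only [mul_sub, Finset.sum_sub_distrib, ← Finset.sum_mul]
      rw [h1, hs, one_mul, sub_self]
    rw [Finset.sum_eq_zero_iff_of_nonneg fun v _ =>
      mul_nonneg (hw.1 v) (sub_nonneg.2 (hx.2 _ (vtx_mem_hull a b v)))] at h0
    have h2 := (mul_eq_zero.1 (h0 u (Finset.mem_univ _))).resolve_left hne
    refine ⟨vtx_mem_hull a b u, fun y hy => (hx.2 y hy).trans (sub_eq_zero.1 h2).le⟩
  · rintro _ ⟨v, hv, rfl⟩
    exact (Finset.mem_filter.1 hv).2

/-- The common point of two crossing segments lies in the face by convexity, and an extreme set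
containing an inner point of a segment contains its ends. -/
theorem mem_of_cross {E : Type*} [AddCommGroup E] [Module ℝ E] {K F : Set E}
    (h : IsExtreme ℝ K F) (hF : Convex ℝ F) {x y z t : E} (hx : x ∈ F) (hy : y ∈ F) (hz : z ∈ K)
    (ht : t ∈ K) {α β γ δ : ℝ} (hα : 0 < α) (hβ : 0 < β) (hγ : 0 < γ) (hδ : 0 < δ)
    (hsum : α + β = γ + δ) (heq : α • x + β • y = γ • z + δ • t) : z ∈ F ∧ t ∈ F := by
  have hs : 0 < α + β := by positivity
  have h1 : (α / (α + β)) • x + (β / (α + β)) • y ∈ F :=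
    hF hx hy (by positivity) (by positivity) (by rw [← add_div, div_self hs.ne'])
  have h2 : (α / (α + β)) • x + (β / (α + β)) • y ∈ openSegment ℝ z t := by
    refine ⟨γ / (α + β), δ / (α + β), by positivity, by positivity,
      by rw [← add_div, ← hsum, div_self hs.ne'], ?_⟩
    simp only [div_eq_inv_mul, mul_smul, ← smul_add]
    rw [heq]
  exact ⟨h.left_mem_of_mem_openSegment hz ht h1 h2, h.right_mem_of_mem_openSegment hz ht h1 h2⟩

/-- The pairs of crossing diagonals of the quadrangle or the pentagon. -/
def crossings (a : ℕ) : List ((Vtx × Vtx) × (Vtx × Vtx)) :=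
  ((.D, .E), (.B, .G)) :: ((.B, .G), (.D, .E)) :: if a = 0 then
    [((.F, .G), (.B, .D)), ((.B, .D), (.F, .G)), ((.F, .E), (.B, .D)), ((.B, .D), (.F, .E)),
      ((.F, .E), (.B, .G)), ((.B, .G), (.F, .E)), ((.F, .G), (.D, .E)), ((.D, .E), (.F, .G))]
    else []

theorem crossing_relation {a : ℕ} (b : ℕ) {q : (Vtx × Vtx) × (Vtx × Vtx)} (hq : q ∈ crossings a) :
    ∃ α β γ δ : ℝ, 0 < α ∧ 0 < β ∧ 0 < γ ∧ 0 < δ ∧ α + β = γ + δ ∧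
      α • vtx a b q.1.1 + β • vtx a b q.1.2 = γ • vtx a b q.2.1 + δ • vtx a b q.2.2 := by
  have hb : (0 : ℝ) < b + 2 := by positivity
  have e1 : (1 : ℝ) • vtx a b .D + ((b : ℝ) + 2) • vtx a b .E =
      (1 : ℝ) • vtx a b .B + ((b : ℝ) + 2) • vtx a b .G := by
    rw [vtx_B, vtx_D, vtx_E, vtx_G]; funext i; fin_cases i <;> simp <;> ring
  by_cases ha : a = 0
  · subst ha
    have e2 : ((b : ℝ) + 2) • vtx 0 b .F + ((b : ℝ) + 2) • vtx 0 b .G =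
        (1 : ℝ) • vtx 0 b .B + (2 * (b : ℝ) + 3) • vtx 0 b .D := by
      rw [vtx_B, vtx_D, vtx_F, vtx_G]; funext i; fin_cases i <;> simp <;> ring
    have e3 : ((b : ℝ) + 2) • vtx 0 b .F + ((b : ℝ) + 2) • vtx 0 b .E =
        (2 : ℝ) • vtx 0 b .B + (2 * (b : ℝ) + 2) • vtx 0 b .D := by
      rw [vtx_B, vtx_D, vtx_F, vtx_E]; funext i; fin_cases i <;> simp <;> ring
    have e4 : (1 : ℝ) • vtx 0 b .F + (2 * (b : ℝ) + 3) • vtx 0 b .E =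
        (2 : ℝ) • vtx 0 b .B + (2 * (b : ℝ) + 2) • vtx 0 b .G := by
      rw [vtx_B, vtx_G, vtx_F, vtx_E]; funext i; fin_cases i <;> simp <;> ring
    have e5 : (1 : ℝ) • vtx 0 b .F + (2 : ℝ) • vtx 0 b .G =
        (2 : ℝ) • vtx 0 b .D + (1 : ℝ) • vtx 0 b .E := by
      rw [vtx_D, vtx_G, vtx_F, vtx_E]; funext i; fin_cases i <;> simp <;> ring
    simp only [crossings, if_true, List.mem_cons, List.not_mem_nil, or_false] at hq
    rcases hq with rfl | rfl | rfl | rfl | rfl | rfl | rfl | rfl | rfl | rfl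
    · exact ⟨_, _, _, _, by positivity, by positivity, by positivity, by positivity, by ring, e1⟩
    · exact ⟨_, _, _, _, by positivity, by positivity, by positivity, by positivity, by ring, e1.symm⟩
    · exact ⟨_, _, _, _, by positivity, by positivity, by positivity, by positivity, by ring, e2⟩
    · exact ⟨_, _, _, _, by positivity, by positivity, by positivity, by positivity, by ring, e2.symm⟩
    · exact ⟨_, _, _, _, by positivity, by positivity, by positivity, by positivity, by ring, e3⟩
    · exact ⟨_, _, _, _, by positivity, by positivity, by positivity, by positivity, by ring, e3.symm⟩
    · exact ⟨_, _, _, _, by positivity, by positivity, by positivity, by positivity, by ring, e4⟩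
    · exact ⟨_, _, _, _, by positivity, by positivity, by positivity, by positivity, by ring, e4.symm⟩
    · exact ⟨_, _, _, _, by positivity, by positivity, by positivity, by positivity, by ring, e5⟩
    · exact ⟨_, _, _, _, by positivity, by positivity, by positivity, by positivity, by ring, e5.symm⟩
  · simp only [crossings, if_neg ha, List.mem_cons, List.not_mem_nil, or_false] at hq
    rcases hq with rfl | rfl
    · exact ⟨_, _, _, _, by positivity, by positivity, by positivity, by positivity, by ring, e1⟩
    · exact ⟨_, _, _, _, by positivity, by positivity, by positivity, by positivity, by ring, e1.symm⟩

theorem crossings_mem {a b : ℕ} {W : Finset Vtx}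
    (h : IsExposed ℝ (hull a b) (convexHull ℝ (vtx a b '' W))) :
    ∀ q ∈ crossings a, q.1.1 ∈ W → q.1.2 ∈ W → q.2.1 ∈ W ∧ q.2.2 ∈ W := by
  intro q hq h1 h2
  obtain ⟨α, β, γ, δ, hα, hβ, hγ, hδ, hsum, heq⟩ := crossing_relation b hq
  have hmem : ∀ {v}, vtx a b v ∈ convexHull ℝ (vtx a b '' W) → v ∈ W := by
    intro v hv
    obtain ⟨w, hw, hwv⟩ := eq_vtx_of_extreme (vtx_mem_extremePoints a b v) hv
    rwa [← vtx_injective a b hwv]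
  obtain ⟨h3, h4⟩ := mem_of_cross h.isExtreme (convex_convexHull ℝ _)
    (subset_convexHull ℝ _ ⟨_, h1, rfl⟩) (subset_convexHull ℝ _ ⟨_, h2, rfl⟩)
    (vtx_mem_hull a b _) (vtx_mem_hull a b _) hα hβ hγ hδ hsum heq
  exact ⟨hmem h3, hmem h4⟩

/-- The vertices of a facet as a list. -/
def facetList (a : ℕ) : Facet → List Vtx
  | .ABF => [.A, .B, .F]
  | .CDG => [.C, .D, .G]
  | .CEG => [.C, .E, .G]
  | .BDF => if a = 0 then [.B, .F, .D, .G, .E] else [.B, .D, .F]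
  | .BDGE => if a = 0 then [.B, .F, .D, .G, .E] else [.B, .D, .G, .E]

theorem mem_facetList {a : ℕ} {i : Facet} {v : Vtx} (h : v ∈ facetVerts a i) :
    v ∈ facetList a i := by
  have key : ∀ v ∈ facetVerts a i, v ∈ facetList a i := by
    cases i <;> simp only [facetVerts, facetList] <;> (try split_ifs) <;> decide
  exact key v h

/-- The vertex lists of the faces of a facet. -/
def faceLists (a : ℕ) : Facet → List (List Vtx)
  | .ABF => [[.A], [.B], [.F], [.A, .B], [.A, .F], [.B, .F], [.A, .B, .F]]
  | .CDG => [[.C], [.D], [.G], [.C, .D], [.D, .G], [.C, .G], [.C, .D, .G]]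
  | .CEG => [[.C], [.E], [.G], [.C, .E], [.E, .G], [.C, .G], [.C, .E, .G]]
  | .BDF => if a = 0 then
      [[.B], [.F], [.D], [.G], [.E], [.B, .F], [.F, .D], [.D, .G], [.G, .E], [.B, .E],
        [.B, .F, .D, .G, .E]]
      else [[.B], [.D], [.F], [.B, .D], [.D, .F], [.B, .F], [.B, .D, .F]]
  | .BDGE => if a = 0 then
      [[.B], [.F], [.D], [.G], [.E], [.B, .F], [.F, .D], [.D, .G], [.G, .E], [.B, .E],
        [.B, .F, .D, .G, .E]]
      else [[.B], [.D], [.G], [.E], [.B, .D], [.D, .G], [.G, .E], [.B, .E], [.B, .D, .G, .E]]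

/-- The sublists of a list. -/
def subLists {α : Type*} : List α → List (List α)
  | [] => [[]]
  | x :: l => subLists l ++ (subLists l).map (x :: ·)

theorem filter_mem_subLists {α : Type*} (p : α → Prop) [DecidablePred p] (l : List α) :
    l.filter p ∈ subLists l := by
  induction l with
  | nil => simp [subLists]
  | cons x l ih =>
    rw [List.filter_cons, subLists]
    split_ifs
    · exact List.mem_append_right _ (List.mem_map_of_mem ih)
    · exact List.mem_append_left _ ih

/-- A set of vertices containing both ends of a diagonal contains the ends of the crossing ones. -/
def CrossClosed (a : ℕ) (L : List Vtx) : Prop :=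
  ∀ q ∈ crossings a, q.1.1 ∈ L → q.1.2 ∈ L → q.2.1 ∈ L ∧ q.2.2 ∈ L

instance (a : ℕ) (L : List Vtx) : Decidable (CrossClosed a L) :=
  @List.decidableBAll ((Vtx × Vtx) × (Vtx × Vtx)) (fun q => q.1.1 ∈ L → q.1.2 ∈ L → q.2.1 ∈ L ∧ q.2.2 ∈ L)
    (fun _ => inferInstance) _

/-- In a convex polygon a nonempty set of vertices that is closed under crossing diagonals is a
vertex, the ends of a side, or everything; checked by enumerating sublists. -/
theorem mem_faceLists : ∀ a ∈ [0, 1], ∀ i ∈ [Facet.ABF, .CDG, .CEG, .BDF, .BDGE],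
    ∀ L ∈ subLists (facetList a i), L ≠ [] →
      CrossClosed a L → L ∈ faceLists a i := by
  decide +kernel

theorem exists_cell_of_mem_faceLists : ∀ a ∈ [0, 1], ∀ i ∈ [Facet.ABF, .CDG, .CEG, .BDF, .BDGE],
    ∀ L ∈ faceLists a i, ∃ k ∈ [0, 1, 2], ∃ S ∈ cellFinsets a k,
      ∃ z ∈ [((0 : ℤ), (0 : ℤ)), (-1, 0), (0, 1), (-1, 1), (1, 0)],
        S.image (label z) = L.toFinset.image (label 0) := by
  decide +kernel

theorem exists_cell_of_crossings {a : ℕ} {i : Facet} {W : Finset Vtx} (hW : W ⊆ facetVerts a i)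
    (hne : W.Nonempty)
    (h : ∀ q ∈ crossings a, q.1.1 ∈ W → q.1.2 ∈ W → q.2.1 ∈ W ∧ q.2.2 ∈ W) :
    ∃ k, ∃ S ∈ cellFinsets a k, ∃ z, S.image (label z) = W.image (label 0) := by
  have hmem : ∀ v, v ∈ (facetList a i).filter (· ∈ W) ↔ v ∈ W := fun v => by
    simpa using fun hv => mem_facetList (hW hv)
  have hWL : W = ((facetList a i).filter (· ∈ W)).toFinset := by
    ext v
    rw [List.mem_toFinset, hmem]
  have hi : i ∈ [Facet.ABF, .CDG, .CEG, .BDF, .BDGE] := by cases i <;> decide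
  have hL : (facetList a i).filter (· ∈ W) ≠ [] := by
    obtain ⟨v, hv⟩ := hne
    exact List.ne_nil_of_mem ((hmem v).2 hv)
  rw [hWL]
  have h : CrossClosed a ((facetList a i).filter (· ∈ W)) := by
    simpa only [CrossClosed, hmem] using h
  have hsub := filter_mem_subLists (· ∈ W) (facetList a i)
  generalize (facetList a i).filter (· ∈ W) = L at hL h hsub
  by_cases ha : a = 0
  · subst ha
    obtain ⟨k, -, S, hS, z, -, hz⟩ := exists_cell_of_mem_faceLists 0 (by decide) i hi L
      (mem_faceLists 0 (by decide) i hi L hsub hL h)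
    exact ⟨k, S, hS, z, hz⟩
  · have hf : facetList a = facetList 1 := by funext i; cases i <;> simp [facetList, ha]
    have hc : crossings a = crossings 1 := by simp [crossings, ha]
    rw [hf] at hsub
    rw [CrossClosed, hc] at h
    obtain ⟨k, -, S, hS, z, -, hz⟩ := exists_cell_of_mem_faceLists 1 (by decide) i hi L
      (mem_faceLists 1 (by decide) i hi L hsub hL h)
    exact ⟨k, S, by rwa [cellFinsets_eq_one ha], z, hz⟩

/-- A period moves the face into a standard facet, where it is the hull of a set of vertices closed
under crossings. Such a set is a translate of a listed cell, and comparing dimensions identifies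
`k`. -/
theorem exists_cell_of_isSailFace {a b k : ℕ} {F : Set (Fin 3 → ℝ)}
    (hF : IsSailFace (familyOp a b) ![0, 0, 1] k F) :
    ∃ S ∈ cellFinsets a k, ∃ z, act (period a b z) '' convexHull ℝ (vtx a b '' S) = F := by
  obtain ⟨h, hh, i, hi⟩ := exists_facet_of_face hF.1 hF.2.1 hF.2.2.1
  have hF' := isSailFace_image_act hF hh
  have hsub : act h '' F ⊆ convexHull ℝ (vtx a b '' facetVerts a i) := by
    rw [← facet_eq_convexHull]
    rintro _ ⟨x, hx, rfl⟩
    exact ⟨hF'.2.2.1.subset ⟨x, hx, rfl⟩, hi x hx⟩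
  obtain ⟨W, hW, hFW⟩ := exposed_eq_convexHull hF'.2.2.1 hsub
  have hWne : W.Nonempty := by
    rw [Finset.nonempty_iff_ne_empty]
    rintro rfl
    have := hF'.1
    rw [hFW] at this
    simp at this
  have hcr := crossings_mem (hFW ▸ hF'.2.2.1)
  obtain ⟨k', S, hS, z, hz⟩ := exists_cell_of_crossings hW hWne hcr
  obtain ⟨z', rfl⟩ := mem_periodGroup_iff.1 hh
  have hFS : act (period a b (-z' + z)) '' convexHull ℝ (vtx a b '' S) = F := by
    have h1 := act_image_convexHull_vtx (a := a) (b := b) hz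
    rw [← hFW] at h1
    rw [period_add, period_neg, act_mul, LinearMap.coe_comp, Set.image_comp, h1, ← Set.image_comp]
    have : (act (period a b z')⁻¹ : (Fin 3 → ℝ) → _) ∘ act (period a b z') = id :=
      funext (act_inv_act _)
    rw [this, Set.image_id]
  have hk : k' = k := by
    rw [← hF.2.2.2, ← hFS, finrank_vectorSpan_act, finrank_cell hS]
  subst hk
  exact ⟨S, hS, _, hFS⟩

theorem isFundamentalRegion_regionFaces (a b : ℕ) :
    IsFundamentalRegion (familyOp a b) ![0, 0, 1] (regionFaces a b) := by
  intro k
  refine ⟨fun F hF => ?_, fun F hF => ?_⟩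
  · obtain ⟨S, hS, rfl⟩ := mem_regionFaces_iff.1 hF
    exact isSailFace_cell hS
  · obtain ⟨S, hS, z, rfl⟩ := exists_cell_of_isSailFace hF
    refine ⟨_, ⟨mem_regionFaces_iff.2 ⟨S, hS, rfl⟩, period a b z,
      by rw [sailGroup_eq]; exact period_mem a b z, rfl⟩, ?_⟩
    rintro F' ⟨hF', g, hg, hgF⟩
    obtain ⟨T, hT, rfl⟩ := mem_regionFaces_iff.1 hF'
    rw [sailGroup_eq, mem_periodGroup_iff] at hg
    obtain ⟨z', rfl⟩ := hg
    have h1 : act (period a b (-z + z')) '' convexHull ℝ (vtx a b '' T) =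
        convexHull ℝ (vtx a b '' S) := by
      rw [period_add, period_neg, act_mul, LinearMap.coe_comp, Set.image_comp, hgF,
        ← Set.image_comp]
      have : (act (period a b z)⁻¹ : (Fin 3 → ℝ) → _) ∘ act (period a b z) = id :=
        funext (act_inv_act _)
      rw [this, Set.image_id]
    rw [cell_unique hT hS (image_label_eq h1)]

theorem vertices_closure_region (a b : ℕ) :
    {v | IsSailFace (familyOp a b) ![0, 0, 1] 0 {v} ∧ ∃ k, ∃ F ∈ regionFaces a b k, v ∈ F} =
      Set.range (vtx a b) := by
  ext x
  constructor
  · rintro ⟨hx, k, F, hF, hxF⟩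
    obtain ⟨S, -, rfl⟩ := mem_regionFaces_iff.1 hF
    obtain ⟨v, -, hv⟩ := eq_vtx_of_extreme (isExtreme_singleton.1 hx.2.2.1.isExtreme) hxF
    exact ⟨v, hv⟩
  · rintro ⟨v, rfl⟩
    constructor
    · have hS : {rep v} ∈ cellFinsets a 0 := by
        cases v <;> simp [cellFinsets, rep]
      have h := isSailFace_image_act (isSailFace_cell (b := b) hS) (period_mem a b (shift v))
      rwa [Finset.coe_singleton, Set.image_singleton, convexHull_singleton, Set.image_singleton,
        ← vtx_eq_act_rep] at h
    · have hS : ∃ S ∈ cellFinsets a 2, v ∈ S := by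
        cases v
        exacts [⟨{.A, .B, .F}, by simp [cellFinsets], by decide⟩,
          ⟨{.A, .B, .F}, by simp [cellFinsets], by decide⟩,
          ⟨{.C, .D, .G}, by simp [cellFinsets], by decide⟩,
          ⟨{.C, .D, .G}, by simp [cellFinsets], by decide⟩,
          ⟨{.C, .E, .G}, by simp [cellFinsets], by decide⟩,
          ⟨{.A, .B, .F}, by simp [cellFinsets], by decide⟩,
          ⟨{.C, .D, .G}, by simp [cellFinsets], by decide⟩]
      obtain ⟨S, hS, hv⟩ := hS
      exact ⟨2, _, mem_regionFaces_iff.2 ⟨S, hS, rfl⟩, subset_convexHull ℝ _ ⟨v, hv, rfl⟩⟩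

/-! ### The model square -/

/-- The unit square. -/
def unitSquare : Set (ℝ × ℝ) := Set.Icc 0 1

theorem mem_unitSquare {x : ℝ × ℝ} :
    x ∈ unitSquare ↔ (0 ≤ x.1 ∧ 0 ≤ x.2) ∧ x.1 ≤ 1 ∧ x.2 ≤ 1 := by
  rw [unitSquare, Set.mem_Icc, Prod.le_def, Prod.le_def]
  rfl

/-- The piecewise linear function on the model square equal to `1` at one of the vertices and
to `0` at the others. -/
noncomputable def hat (v : Vtx) (x : ℝ × ℝ) : ℝ :=
  match v with
  | .A => max 0 (1 - 2 * x.1 - x.2)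
  | .B => max 0 (min x.2 (min ((3 - 3 * x.1 - x.2) / 2) (3 - 2 * x.1 - 2 * x.2)))
  | .C => max 0 (max (3 * x.1 + x.2 - 3) (2 * x.1 + 2 * x.2 - 3))
  | .D => max 0 (min (2 * x.1 + x.2 - 1) (max ((3 - x.1 - 3 * x.2) / 2) (x.1 - x.2)))
  | .E => max 0 (min (2 * x.1 + 6 * x.2 - 6) (2 * x.2 - 2 * x.1))
  | .F => max 0 (min (2 * x.1) (2 - 2 * x.1 - 2 * x.2))
  | .G => max 0 (min (2 * x.1 + 2 * x.2 - 2) (min (4 - 4 * x.1) (4 - 4 * x.2)))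

theorem continuous_hat (v : Vtx) : Continuous (hat v) := by
  cases v <;> unfold hat <;> fun_prop

theorem sum_modelVtx (w : Vtx → ℝ) : ∑ u, w u • modelVtx u =
    (w .C + w .D + w .E / 2 + w .F / 2 + 3 / 4 * w .G,
      w .B + w .C + w .E + 3 / 4 * w .G) := by
  rw [sum_vtx]
  simp only [modelVtx, Prod.smul_mk, smul_eq_mul, Prod.mk_add_mk]
  ext <;> simp only <;> ring

-- On each triangle of the model the hat functions are its barycentric coordinates. One formula for
-- all triangles makes continuity of the parametrization automatic.
set_option maxHeartbeats 1000000 in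
theorem hat_sum {t : Tri} {w : Vtx → ℝ} (hw : IsWeight t.verts w) (hs : ∑ u, w u = 1) (v : Vtx) :
    hat v (∑ u, w u • modelVtx u) = w v := by
  rw [sum_modelVtx]
  rw [sum_vtx] at hs
  have hA := hw.1 .A
  have hB := hw.1 .B
  have hC := hw.1 .C
  have hD := hw.1 .D
  have hE := hw.1 .E
  have hF := hw.1 .F
  have hG := hw.1 .G
  have h0 : ∀ v, v ∉ t.verts → w v = 0 := hw.2
  clear hw
  generalize hx : w .C + w .D + w .E / 2 + w .F / 2 + 3 / 4 * w .G = x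
  generalize hy : w .B + w .C + w .E + 3 / 4 * w .G = y
  cases t with
  | ABF =>
    have zC := h0 .C (by decide)
    have zD := h0 .D (by decide)
    have zE := h0 .E (by decide)
    have zG := h0 .G (by decide)
    clear h0
    simp only [zC, zD, zE, zG, zero_div, mul_zero, add_zero, zero_add] at hs hx hy
    clear hC hD hE hG
    cases v <;> simp only [hat, zC, zD, zE, zG, max_def, min_def] <;>
      split_ifs <;> linarith
  | BDF =>
    have zA := h0 .A (by decide)
    have zC := h0 .C (by decide)
    have zE := h0 .E (by decide)
    have zG := h0 .G (by decide)
    clear h0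
    simp only [zA, zC, zE, zG, zero_div, mul_zero, add_zero, zero_add] at hs hx hy
    clear hA hC hE hG
    cases v <;> simp only [hat, zA, zC, zE, zG, max_def, min_def] <;>
      split_ifs <;> linarith
  | BDG =>
    have zA := h0 .A (by decide)
    have zC := h0 .C (by decide)
    have zE := h0 .E (by decide)
    have zF := h0 .F (by decide)
    clear h0
    simp only [zA, zC, zE, zF, zero_div, add_zero, zero_add] at hs hx hy
    clear hA hC hE hF
    cases v <;> simp only [hat, zA, zC, zE, zF, max_def, min_def] <;>
      split_ifs <;> linarith
  | BGE =>
    have zA := h0 .A (by decide)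
    have zC := h0 .C (by decide)
    have zD := h0 .D (by decide)
    have zF := h0 .F (by decide)
    clear h0
    simp only [zA, zC, zD, zF, zero_div, add_zero, zero_add] at hs hx hy
    clear hA hC hD hF
    cases v <;> simp only [hat, zA, zC, zD, zF, max_def, min_def] <;>
      split_ifs <;> linarith
  | CDG =>
    have zA := h0 .A (by decide)
    have zB := h0 .B (by decide)
    have zE := h0 .E (by decide)
    have zF := h0 .F (by decide)
    clear h0
    simp only [zA, zB, zE, zF, zero_div, add_zero, zero_add] at hs hx hy
    clear hA hB hE hF
    cases v <;> simp only [hat, zA, zB, zE, zF, max_def, min_def] <;>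
      split_ifs <;> linarith
  | CEG =>
    have zA := h0 .A (by decide)
    have zB := h0 .B (by decide)
    have zD := h0 .D (by decide)
    have zF := h0 .F (by decide)
    clear h0
    simp only [zA, zB, zD, zF, zero_div, add_zero, zero_add] at hs hx hy
    clear hA hB hD hF
    cases v <;> simp only [hat, zA, zB, zD, zF, max_def, min_def] <;>
      split_ifs <;> linarith

/-- A point with nonnegative barycentric coordinates lies in the triangle. -/
theorem mem_model_tri {x : ℝ × ℝ} {p q r : Vtx} {α β γ : ℝ} (hα : 0 ≤ α) (hβ : 0 ≤ β) (hγ : 0 ≤ γ)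
    (hs : α + β + γ = 1) (h : α • modelVtx p + β • modelVtx q + γ • modelVtx r = x) :
    x ∈ convexHull ℝ (modelVtx '' ({p, q, r} : Finset Vtx)) := by
  obtain ⟨w, hw, hwx⟩ := exists_isWeight (f := fun v => (modelVtx v, (1 : ℝ))) (v := (x, 1))
    (p := p) (q := q) (r := r) hα hβ hγ (by
      simp only [Prod.smul_mk, Prod.mk_add_mk, h, smul_eq_mul, mul_one, hs])
  have h1 := congrArg Prod.fst hwx
  have h2 := congrArg Prod.snd hwx
  simp only [Prod.fst_sum, Prod.snd_sum, Prod.smul_mk, smul_eq_mul, mul_one] at h1 h2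
  rw [← h1]
  exact sum_mem_convexHull hw h2

/-! ### The triangles of the model square in terms of inequalities -/

theorem model_ABF {x : ℝ × ℝ} (h1 : 0 ≤ x.1) (h2 : 0 ≤ x.2) (h3 : 2 * x.1 + x.2 ≤ 1) :
    x ∈ convexHull ℝ (modelVtx '' (Tri.ABF.verts : Finset Vtx)) := by
  refine mem_model_tri (α := 1 - 2 * x.1 - x.2) (β := x.2) (γ := 2 * x.1) (by linarith)
    (by linarith) (by linarith) (by ring) ?_
  ext <;> (simp [modelVtx]; try ring)

theorem model_BDF {x : ℝ × ℝ} (h1 : 1 ≤ 2 * x.1 + x.2) (h2 : 0 ≤ x.2) (h3 : x.1 + x.2 ≤ 1) :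
    x ∈ convexHull ℝ (modelVtx '' (Tri.BDF.verts : Finset Vtx)) := by
  refine mem_model_tri (α := x.2) (β := 2 * x.1 + x.2 - 1) (γ := 2 - 2 * x.1 - 2 * x.2)
    (by linarith) (by linarith) (by linarith) (by ring) ?_
  ext <;> (simp [modelVtx]; try ring)

theorem model_BDG {x : ℝ × ℝ} (h1 : 1 ≤ x.1 + x.2) (h2 : 3 * x.1 + x.2 ≤ 3)
    (h3 : x.1 + 3 * x.2 ≤ 3) : x ∈ convexHull ℝ (modelVtx '' (Tri.BDG.verts : Finset Vtx)) := by
  refine mem_model_tri (α := (3 - 3 * x.1 - x.2) / 2) (β := (3 - x.1 - 3 * x.2) / 2)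
    (γ := 2 * x.1 + 2 * x.2 - 2) (by linarith) (by linarith) (by linarith) (by ring) ?_
  ext <;> simp [modelVtx] <;> ring

theorem model_BGE {x : ℝ × ℝ} (h1 : 3 ≤ x.1 + 3 * x.2) (h2 : 2 * x.1 + 2 * x.2 ≤ 3)
    (h3 : x.2 ≤ 1) : x ∈ convexHull ℝ (modelVtx '' (Tri.BGE.verts : Finset Vtx)) := by
  refine mem_model_tri (α := 3 - 2 * x.1 - 2 * x.2) (β := 4 - 4 * x.2)
    (γ := 2 * x.1 + 6 * x.2 - 6) (by linarith) (by linarith) (by linarith) (by ring) ?_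
  ext <;> simp [modelVtx] <;> ring

theorem model_CDG {x : ℝ × ℝ} (h1 : 3 ≤ 3 * x.1 + x.2) (h2 : x.2 ≤ x.1)
    (h3 : x.1 ≤ 1) : x ∈ convexHull ℝ (modelVtx '' (Tri.CDG.verts : Finset Vtx)) := by
  refine mem_model_tri (α := 3 * x.1 + x.2 - 3) (β := x.1 - x.2)
    (γ := 4 - 4 * x.1) (by linarith) (by linarith) (by linarith) (by ring) ?_
  ext <;> simp [modelVtx] <;> ring

theorem model_CEG {x : ℝ × ℝ} (h1 : 3 ≤ 2 * x.1 + 2 * x.2) (h2 : x.1 ≤ x.2)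
    (h3 : x.2 ≤ 1) : x ∈ convexHull ℝ (modelVtx '' (Tri.CEG.verts : Finset Vtx)) := by
  refine mem_model_tri (α := 2 * x.1 + 2 * x.2 - 3) (β := 2 * x.2 - 2 * x.1)
    (γ := 4 - 4 * x.2) (by linarith) (by linarith) (by linarith) (by ring) ?_
  ext <;> simp [modelVtx] <;> ring

theorem exists_model_tri {x : ℝ × ℝ} (hx : x ∈ unitSquare) :
    ∃ t : Tri, x ∈ convexHull ℝ (modelVtx '' (t.verts : Finset Vtx)) := by
  obtain ⟨⟨h1, h2⟩, h3, h4⟩ := mem_unitSquare.1 hx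
  by_cases c1 : 2 * x.1 + x.2 ≤ 1
  · exact ⟨.ABF, model_ABF h1 h2 c1⟩
  by_cases c2 : x.1 + x.2 ≤ 1
  · exact ⟨.BDF, model_BDF (by linarith) h2 c2⟩
  by_cases c3 : x.2 ≤ x.1
  · by_cases c4 : 3 * x.1 + x.2 ≤ 3
    · exact ⟨.BDG, model_BDG (by linarith) c4 (by linarith)⟩
    · exact ⟨.CDG, model_CDG (by linarith) c3 h3⟩
  · by_cases c4 : 2 * x.1 + 2 * x.2 ≤ 3
    · by_cases c5 : x.1 + 3 * x.2 ≤ 3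
      · exact ⟨.BDG, model_BDG (by linarith) (by linarith) c5⟩
      · exact ⟨.BGE, model_BGE (by linarith) c4 h4⟩
    · exact ⟨.CEG, model_CEG (by linarith) (by linarith) h4⟩

theorem modelVtx_mem_unitSquare (v : Vtx) : modelVtx v ∈ unitSquare := by
  rw [mem_unitSquare]
  cases v <;> norm_num [modelVtx]

theorem model_subset_unitSquare (S : Set Vtx) : convexHull ℝ (modelVtx '' S) ⊆ unitSquare := by
  refine convexHull_min ?_ (convex_Icc 0 1)
  rintro _ ⟨v, -, rfl⟩
  exact modelVtx_mem_unitSquare v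

theorem exists_model_tri_facet {a : ℕ} {i : Facet} {x : ℝ × ℝ}
    (hx : x ∈ convexHull ℝ (modelVtx '' (facetVerts a i : Finset Vtx))) :
    ∃ t : Tri, t.verts ⊆ facetVerts a i ∧
      x ∈ convexHull ℝ (modelVtx '' (t.verts : Finset Vtx)) := by
  have hsq := mem_unitSquare.1 (model_subset_unitSquare _ hx)
  have hquad : ∀ S : Finset Vtx, x ∈ convexHull ℝ (modelVtx '' (S : Set Vtx)) →
      ∀ α β γ : ℝ, (∀ v ∈ S, γ ≤ α * (modelVtx v).1 + β * (modelVtx v).2) →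
      γ ≤ α * x.1 + β * x.2 := by
    intro S hS α β γ h
    have hlin : IsLinearMap ℝ fun y : ℝ × ℝ => α * y.1 + β * y.2 :=
      ⟨fun y z => by simp only [Prod.fst_add, Prod.snd_add]; ring,
        fun c y => by simp only [Prod.smul_fst, Prod.smul_snd, smul_eq_mul]; ring⟩
    refine convexHull_min (t := {y : ℝ × ℝ | γ ≤ α * y.1 + β * y.2}) ?_
      (convex_halfSpace_ge hlin γ) hS
    rintro _ ⟨v, hv, rfl⟩
    exact h v hv
  have hpent : facetVerts a i = {.B, .F, .D, .G, .E} → ∃ t : Tri, t.verts ⊆ facetVerts a i ∧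
      x ∈ convexHull ℝ (modelVtx '' (t.verts : Finset Vtx)) := by
    intro h
    rw [h] at hx ⊢
    -- The three half-planes are bounded by the lines `BF`, `DG` and `EG` of the model; the
    -- diagonals `BD` and `BG` are `x + y = 1` and `x + 3y = 3`.
    have h1 := hquad _ hx 2 1 1 (by
      intro v hv
      simp only [Finset.mem_insert, Finset.mem_singleton] at hv
      rcases hv with rfl | rfl | rfl | rfl | rfl <;> norm_num [modelVtx])
    have h2 := hquad _ hx (-3) (-1) (-3) (by
      intro v hv
      simp only [Finset.mem_insert, Finset.mem_singleton] at hv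
      rcases hv with rfl | rfl | rfl | rfl | rfl <;> norm_num [modelVtx])
    have h3 := hquad _ hx (-2) (-2) (-3) (by
      intro v hv
      simp only [Finset.mem_insert, Finset.mem_singleton] at hv
      rcases hv with rfl | rfl | rfl | rfl | rfl <;> norm_num [modelVtx])
    by_cases c1 : x.1 + x.2 ≤ 1
    · exact ⟨.BDF, by decide, model_BDF (by linarith) hsq.1.2 c1⟩
    by_cases c2 : x.1 + 3 * x.2 ≤ 3
    · exact ⟨.BDG, by decide, model_BDG (by linarith) (by linarith) c2⟩
    · exact ⟨.BGE, by decide, model_BGE (by linarith) (by linarith) hsq.2.2⟩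
  have hBDGE : facetVerts a i = {.B, .D, .G, .E} → ∃ t : Tri, t.verts ⊆ facetVerts a i ∧
      x ∈ convexHull ℝ (modelVtx '' (t.verts : Finset Vtx)) := by
    intro h
    rw [h] at hx ⊢
    have h1 := hquad _ hx 1 1 1 (by
      intro v hv
      simp only [Finset.mem_insert, Finset.mem_singleton] at hv
      rcases hv with rfl | rfl | rfl | rfl <;> norm_num [modelVtx])
    have h2 := hquad _ hx (-3) (-1) (-3) (by
      intro v hv
      simp only [Finset.mem_insert, Finset.mem_singleton] at hv
      rcases hv with rfl | rfl | rfl | rfl <;> norm_num [modelVtx])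
    have h3 := hquad _ hx (-2) (-2) (-3) (by
      intro v hv
      simp only [Finset.mem_insert, Finset.mem_singleton] at hv
      rcases hv with rfl | rfl | rfl | rfl <;> norm_num [modelVtx])
    by_cases c2 : x.1 + 3 * x.2 ≤ 3
    · exact ⟨.BDG, by decide, model_BDG (by linarith) (by linarith) c2⟩
    · exact ⟨.BGE, by decide, model_BGE (by linarith) (by linarith) hsq.2.2⟩
  by_cases ha : a = 0
  · cases i
    · exact ⟨.ABF, subset_rfl, hx⟩
    · exact ⟨.CDG, subset_rfl, hx⟩
    · exact ⟨.CEG, subset_rfl, hx⟩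
    · exact hpent (by simp [facetVerts, ha])
    · exact hpent (by simp [facetVerts, ha])
  · cases i
    · exact ⟨.ABF, subset_rfl, hx⟩
    · exact ⟨.CDG, subset_rfl, hx⟩
    · exact ⟨.CEG, subset_rfl, hx⟩
    · exact ⟨.BDF, by simp [facetVerts, ha, Tri.verts], by simpa [facetVerts, ha, Tri.verts] using hx⟩
    · exact hBDGE (by simp [facetVerts, ha])

/-! ### The parametrization of the sail by the model square -/

/-- The facet containing a triangle. -/
def Tri.facet : Tri → Facet
  | .ABF => .ABF | .BDF => .BDF | .BDG => .BDGE | .BGE => .BDGE | .CDG => .CDG | .CEG => .CEG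

theorem Tri.verts_subset_facet (a : ℕ) (t : Tri) : t.verts ⊆ facetVerts a t.facet := by
  cases t <;> simp only [Tri.facet, facetVerts] <;> (try split_ifs) <;> decide

/-- The piecewise linear map from the model square to the sail. -/
noncomputable def param (a b : ℕ) (x : ℝ × ℝ) : Fin 3 → ℝ := ∑ u, hat u x • vtx a b u

theorem continuous_param (a b : ℕ) : Continuous (param a b) :=
  continuous_finsetSum _ fun u _ => (continuous_hat u).smul continuous_const

theorem param_sum {a b : ℕ} {t : Tri} {w : Vtx → ℝ} (hw : IsWeight t.verts w)
    (hs : ∑ u, w u = 1) : param a b (∑ u, w u • modelVtx u) = ∑ u, w u • vtx a b u := by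
  rw [param]
  exact Finset.sum_congr rfl fun u _ => by rw [hat_sum hw hs]

theorem exists_hat_weight {x : ℝ × ℝ} (hx : x ∈ unitSquare) : ∃ t : Tri,
    IsWeight t.verts (fun u => hat u x) ∧ ∑ u, hat u x = 1 ∧ ∑ u, hat u x • modelVtx u = x := by
  obtain ⟨t, ht⟩ := exists_model_tri hx
  obtain ⟨w, hw, hs, rfl⟩ := exists_weight_of_mem_convexHull ht
  refine ⟨t, ?_⟩
  simp only [hat_sum hw hs, and_true]
  exact ⟨hw, hs⟩

theorem param_image_of_subset_tri (a b : ℕ) {t : Tri} {S : Finset Vtx} (hS : S ⊆ t.verts) :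
    param a b '' convexHull ℝ (modelVtx '' S) = convexHull ℝ (vtx a b '' S) := by
  ext p
  constructor
  · rintro ⟨x, hx, rfl⟩
    obtain ⟨w, hw, hs, rfl⟩ := exists_weight_of_mem_convexHull hx
    rw [param_sum (hw.mono hS) hs]
    exact sum_mem_convexHull hw hs
  · intro hp
    obtain ⟨w, hw, hs, rfl⟩ := exists_weight_of_mem_convexHull hp
    exact ⟨_, sum_mem_convexHull hw hs, param_sum (hw.mono hS) hs⟩

/-- The quadrangle and the pentagon are subdivided by the same diagonals in the model and on the
sail. -/
theorem param_image_facet (a b : ℕ) (i : Facet) :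
    param a b '' convexHull ℝ (modelVtx '' facetVerts a i) =
      convexHull ℝ (vtx a b '' facetVerts a i) := by
  ext p
  constructor
  · rintro ⟨x, hx, rfl⟩
    obtain ⟨t, ht, hxt⟩ := exists_model_tri_facet hx
    have h1 : param a b x ∈ convexHull ℝ (vtx a b '' t.verts) := by
      rw [← param_image_of_subset_tri a b (subset_refl t.verts)]
      exact ⟨x, hxt, rfl⟩
    exact convexHull_mono (Set.image_mono (by exact_mod_cast ht)) h1
  · intro hp
    rw [← facet_eq_convexHull] at hp
    obtain ⟨t, ht, w, hw, hs, hwp⟩ := exists_weight_of_form_eq_one hp.1 (one_mem _) (i := i)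
      (by rw [act_one]; exact hp.2)
    rw [act_one, LinearMap.id_apply] at hwp
    exact ⟨_, sum_mem_convexHull (hw.mono ht) hs, by rw [param_sum hw hs, hwp]⟩

theorem cell_subset_tri_or_facet {a k : ℕ} {S : Finset Vtx} (hS : S ∈ cellFinsets a k) :
    (∃ t : Tri, S ⊆ t.verts) ∨ ∃ i, facetVerts a i = S := by
  match k with
  | 0 =>
    have h : ∀ S ∈ cellFinsets 0 0,
        ∃ t ∈ [Tri.ABF, .BDF, .BDG, .BGE, .CDG, .CEG], S ⊆ t.verts := by decide +kernel
    obtain ⟨t, -, ht⟩ := h S hS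
    exact .inl ⟨t, ht⟩
  | 1 =>
    have h : ∀ S ∈ cellFinsets 1 1,
        ∃ t ∈ [Tri.ABF, .BDF, .BDG, .BGE, .CDG, .CEG], S ⊆ t.verts := by decide +kernel
    have hsub : cellFinsets 0 1 ⊆ cellFinsets 1 1 := by decide +kernel
    have hS' : S ∈ cellFinsets 1 1 := by
      by_cases ha : a = 0
      · subst ha; exact hsub hS
      · rwa [cellFinsets_eq_one ha] at hS
    obtain ⟨t, -, ht⟩ := h S hS'
    exact .inl ⟨t, ht⟩
  | 2 => exact .inr (exists_facetVerts_eq hS)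
  | k + 3 => simp [cellFinsets] at hS

theorem param_image_cell {a b k : ℕ} {S : Finset Vtx} (hS : S ∈ cellFinsets a k) :
    param a b '' convexHull ℝ (modelVtx '' S) = convexHull ℝ (vtx a b '' S) := by
  rcases cell_subset_tri_or_facet hS with ⟨t, ht⟩ | ⟨i, rfl⟩
  · exact param_image_of_subset_tri a b ht
  · exact param_image_facet a b i

theorem weight_mem_sail {a b : ℕ} {t : Tri} {w : Vtx → ℝ} (hw : IsWeight t.verts w)
    (hs : ∑ u, w u = 1) : ∑ u, w u • vtx a b u ∈ sail (familyOp a b) ![0, 0, 1] := by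
  have h := sum_mem_convexHull (f := vtx a b) (hw.mono (t.verts_subset_facet a)) hs
  rw [← facet_eq_convexHull] at h
  exact mem_sail_iff.2 ⟨h.1, 1, one_mem _, t.facet, by rw [act_one]; exact h.2⟩

theorem param_mem_sail {a b : ℕ} {x : ℝ × ℝ} (hx : x ∈ unitSquare) :
    param a b x ∈ sail (familyOp a b) ![0, 0, 1] := by
  obtain ⟨t, hw, hs, -⟩ := exists_hat_weight hx
  exact weight_mem_sail hw hs

theorem exists_param_of_mem_sail {a b : ℕ} {p : Fin 3 → ℝ}
    (hp : p ∈ sail (familyOp a b) ![0, 0, 1]) :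
    ∃ g ∈ periodGroup a b, ∃ x ∈ unitSquare, act g p = param a b x := by
  obtain ⟨hp1, h, hh, j, hj⟩ := mem_sail_iff.1 hp
  obtain ⟨t, -, w, hw, hs, hwp⟩ := exists_weight_of_form_eq_one hp1 hh hj
  exact ⟨h, hh, _, model_subset_unitSquare _ (sum_mem_convexHull hw hs),
    by rw [param_sum hw hs, hwp]⟩

/-! ### The gluing of the boundary of the square -/

theorem pair_sum {E : Type*} [AddCommGroup E] [Module ℝ E] (f : Vtx → E) {u v : Vtx} {α β : ℝ}
    : ∑ x, (Pi.single u α + Pi.single v β : Vtx → ℝ) x • f x = α • f u + β • f v := by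
  simp [add_smul, Finset.sum_add_distrib, Pi.single_apply, ite_smul]

theorem pair_isWeight {S : Finset Vtx} {u v : Vtx} {α β : ℝ} (hu : u ∈ S) (hv : v ∈ S)
    (hα : 0 ≤ α) (hβ : 0 ≤ β) : IsWeight S (Pi.single u α + Pi.single v β) := by
  have h0 : ∀ (s : Vtx) (c : ℝ), 0 ≤ c → ∀ x, 0 ≤ (Pi.single s c : Vtx → ℝ) x := fun s c hc x => by
    rw [Pi.single_apply]; split_ifs <;> simp [hc]
  refine ⟨fun x => add_nonneg (h0 _ _ hα x) (h0 _ _ hβ x), fun x hx => ?_⟩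
  have h1 : x ≠ u := fun h => hx (h ▸ hu)
  have h2 : x ≠ v := fun h => hx (h ▸ hv)
  simp [h1, h2]

theorem param_pair (a b : ℕ) {t : Tri} {u v : Vtx} {α β : ℝ} (hu : u ∈ t.verts) (hv : v ∈ t.verts)
    (hα : 0 ≤ α) (hβ : 0 ≤ β) (h : α + β = 1) :
    param a b (α • modelVtx u + β • modelVtx v) = α • vtx a b u + β • vtx a b v := by
  rw [← pair_sum, param_sum (pair_isWeight hu hv hα hβ) (by
    simpa [Finset.sum_add_distrib] using h), pair_sum]

theorem param_right (a b : ℕ) {y : ℝ} (h0 : 0 ≤ y) (h1 : y ≤ 1) :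
    param a b (1, y) = act (periodX a b) (param a b (0, y)) := by
  have e1 : ((1 : ℝ), y) = (1 - y) • modelVtx .D + y • modelVtx .C := by
    ext <;> simp [modelVtx]
  have e0 : ((0 : ℝ), y) = (1 - y) • modelVtx .A + y • modelVtx .B := by
    ext <;> simp [modelVtx]
  rw [e1, e0, param_pair a b (t := .CDG) (by decide) (by decide) (by linarith) h0 (by ring),
    param_pair a b (t := .ABF) (by decide) (by decide) (by linarith) h0 (by ring), map_add, map_smul,
    map_smul, act_periodX_A, act_periodX_B]

theorem param_top (a b : ℕ) {x : ℝ} (h0 : 0 ≤ x) (h1 : x ≤ 1) :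
    param a b (x, 1) = act (periodY a b) (param a b (x, 0)) := by
  rcases le_total x (1 / 2) with h | h
  · have e1 : (x, (1 : ℝ)) = (1 - 2 * x) • modelVtx .B + (2 * x) • modelVtx .E := by
      ext <;> simp [modelVtx]; ring
    have e0 : (x, (0 : ℝ)) = (1 - 2 * x) • modelVtx .A + (2 * x) • modelVtx .F := by
      ext <;> simp [modelVtx]; ring
    rw [e1, e0, param_pair a b (t := .BGE) (by decide) (by decide) (by linarith) (by linarith)
      (by ring), param_pair a b (t := .ABF) (by decide) (by decide) (by linarith) (by linarith)
      (by ring), map_add, map_smul, map_smul, act_periodY_A, act_periodY_F]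
  · have e1 : (x, (1 : ℝ)) = (2 - 2 * x) • modelVtx .E + (2 * x - 1) • modelVtx .C := by
      ext <;> simp [modelVtx] <;> ring
    have e0 : (x, (0 : ℝ)) = (2 - 2 * x) • modelVtx .F + (2 * x - 1) • modelVtx .D := by
      ext <;> simp [modelVtx]; ring
    rw [e1, e0, param_pair a b (t := .CEG) (by decide) (by decide) (by linarith) (by linarith)
      (by ring), param_pair a b (t := .BDF) (by decide) (by decide) (by linarith) (by linarith)
      (by ring), map_add, map_smul, map_smul, act_periodY_F, act_periodY_D]

/-- The projection of the plane to the standard torus. -/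
def torusMk (x : ℝ × ℝ) : UnitAddCircle × UnitAddCircle := ((x.1 : UnitAddCircle), (x.2 : UnitAddCircle))

theorem coe_unitAddCircle_eq_iff {x y : ℝ} :
    (x : UnitAddCircle) = y ↔ ∃ n : ℤ, y = x + n := by
  rw [eq_comm, ← sub_eq_zero, ← AddCircle.coe_sub, AddCircle.coe_eq_zero_iff]
  refine exists_congr fun n => ?_
  rw [zsmul_one, eq_sub_iff_add_eq, add_comm, eq_comm]

theorem torusMk_eq_iff {x y : ℝ × ℝ} :
    torusMk x = torusMk y ↔ ∃ z : ℤ × ℤ, y = (x.1 + z.1, x.2 + z.2) := by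
  rw [torusMk, torusMk, Prod.mk.injEq, coe_unitAddCircle_eq_iff, coe_unitAddCircle_eq_iff]
  constructor
  · rintro ⟨⟨n, hn⟩, m, hm⟩
    exact ⟨(n, m), Prod.ext hn hm⟩
  · rintro ⟨z, rfl⟩
    exact ⟨⟨z.1, rfl⟩, z.2, rfl⟩

theorem int_shift_unit {x : ℝ} {n : ℤ} (h0 : 0 ≤ x) (h1 : x ≤ 1) (h0' : 0 ≤ x + n)
    (h1' : x + n ≤ 1) : n = 0 ∨ (n = 1 ∧ x = 0) ∨ (n = -1 ∧ x = 1) := by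
  have hl : -1 ≤ n := by
    have : (-1 : ℝ) ≤ n := by linarith
    exact_mod_cast this
  have hu : n ≤ 1 := by
    have : (n : ℝ) ≤ 1 := by linarith
    exact_mod_cast this
  obtain rfl | rfl | rfl : n = -1 ∨ n = 0 ∨ n = 1 := by lia
  · push_cast at h0'
    exact .inr (.inr ⟨rfl, by linarith⟩)
  · exact .inl rfl
  · push_cast at h1'
    exact .inr (.inl ⟨rfl, by linarith⟩)

theorem param_add_left (a b : ℕ) {x y : ℝ} {n : ℤ} (h0 : 0 ≤ x) (h1 : x ≤ 1) (h0' : 0 ≤ x + n)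
    (h1' : x + n ≤ 1) (hy0 : 0 ≤ y) (hy1 : y ≤ 1) :
    param a b (x + n, y) = act (periodX a b ^ n) (param a b (x, y)) := by
  rcases int_shift_unit h0 h1 h0' h1' with rfl | ⟨rfl, rfl⟩ | ⟨rfl, rfl⟩
  · simp [act_one]
  · simpa using param_right a b hy0 hy1
  · have := param_right a b hy0 hy1
    simp [this, act_inv_act]

theorem param_add_right (a b : ℕ) {x y : ℝ} {n : ℤ} (h0 : 0 ≤ y) (h1 : y ≤ 1) (h0' : 0 ≤ y + n)
    (h1' : y + n ≤ 1) (hx0 : 0 ≤ x) (hx1 : x ≤ 1) :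
    param a b (x, y + n) = act (periodY a b ^ n) (param a b (x, y)) := by
  rcases int_shift_unit h0 h1 h0' h1' with rfl | ⟨rfl, rfl⟩ | ⟨rfl, rfl⟩
  · simp [act_one]
  · simpa using param_top a b hx0 hx1
  · have := param_top a b hx0 hx1
    simp [this, act_inv_act]

theorem param_add (a b : ℕ) {x : ℝ × ℝ} {z : ℤ × ℤ} (hx : x ∈ unitSquare)
    (hx' : (x.1 + z.1, x.2 + z.2) ∈ unitSquare) :
    param a b (x.1 + z.1, x.2 + z.2) = act (period a b z) (param a b x) := by
  obtain ⟨⟨h1, h2⟩, h3, h4⟩ := mem_unitSquare.1 hx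
  obtain ⟨⟨h1', h2'⟩, h3', h4'⟩ := mem_unitSquare.1 hx'
  rw [param_add_left a b h1 h3 h1' h3' h2' h4', param_add_right a b h2 h4 h2' h4' h1 h3, period,
    act_mul_apply]

/-! ### Points of the square with equivalent images -/

theorem lineBD_F (a b : ℕ) : lineBD b (vtx a b .F) = 1 := by
  rw [vtx_F, lineBD, rowForm_apply]; simp; ring

theorem lineBD_G (a b : ℕ) : lineBD b (vtx a b .G) = -1 := by
  rw [vtx_G, lineBD, rowForm_apply]; simp; ring

theorem lineBD_E (a b : ℕ) : lineBD b (vtx a b .E) = -1 := by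
  rw [vtx_E, lineBD, rowForm_apply]; simp; ring

theorem lineBD_B (a b : ℕ) : lineBD b (vtx a b .B) = 0 := by
  rw [vtx_B, lineBD, rowForm_apply]; simp; ring

theorem lineBD_D (a b : ℕ) : lineBD b (vtx a b .D) = 0 := by
  rw [vtx_D, lineBD, rowForm_apply]; simp

theorem lineBG_B (a b : ℕ) : lineBG b (vtx a b .B) = 0 := by
  rw [vtx_B, lineBG, rowForm_apply]; simp; ring

theorem lineBG_G (a b : ℕ) : lineBG b (vtx a b .G) = 0 := by
  rw [vtx_G, lineBG, rowForm_apply]; simp; ring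

theorem lineBG_D (a b : ℕ) : lineBG b (vtx a b .D) = b + 2 := by
  rw [vtx_D, lineBG, rowForm_apply]; simp

theorem lineBG_E (a b : ℕ) : lineBG b (vtx a b .E) = -1 := by
  rw [vtx_E, lineBG, rowForm_apply]; simp; ring

/-- A common point of two triangles on opposite sides of `φ = 0` puts weight only on vertices of
that plane. These belong to the one triangle `s`, whose vertices are independent. -/
theorem weight_eq_of_separating {a b : ℕ} {t t' s : Tri} (φ : (Fin 3 → ℝ) →ₗ[ℝ] ℝ)
    {w w' : Vtx → ℝ} (hw : IsWeight t.verts w) (hw' : IsWeight t'.verts w')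
    (h : ∑ u, w u • vtx a b u = ∑ u, w' u • vtx a b u)
    (h1 : ∀ v ∈ t.verts, 0 < φ (vtx a b v) ∨ (φ (vtx a b v) = 0 ∧ v ∈ s.verts))
    (h2 : ∀ v ∈ t'.verts, φ (vtx a b v) < 0 ∨ (φ (vtx a b v) = 0 ∧ v ∈ s.verts)) : w = w' := by
  have hφ := congrArg φ h
  simp only [map_sum, map_smul, smul_eq_mul] at hφ
  have hnn : ∀ u ∈ Finset.univ, 0 ≤ w u * φ (vtx a b u) := by
    intro u _
    by_cases hu : u ∈ t.verts
    · refine mul_nonneg (hw.1 u) ?_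
      rcases h1 u hu with h | h
      exacts [h.le, h.1.ge]
    · rw [hw.2 u hu, zero_mul]
  have hnp : ∀ u ∈ Finset.univ, 0 ≤ -(w' u * φ (vtx a b u)) := by
    intro u _
    by_cases hu : u ∈ t'.verts
    · refine neg_nonneg.2 (mul_nonpos_of_nonneg_of_nonpos (hw'.1 u) ?_)
      rcases h2 u hu with h | h
      exacts [h.le, h.1.le]
    · rw [hw'.2 u hu, zero_mul, neg_zero]
  have hs1 := Finset.sum_nonneg hnn
  have hs2 := Finset.sum_nonneg hnp
  rw [Finset.sum_neg_distrib, ← hφ] at hs2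
  have h0 : ∑ u, w u * φ (vtx a b u) = 0 := by linarith
  have h0' : ∑ u, -(w' u * φ (vtx a b u)) = 0 := by
    rw [Finset.sum_neg_distrib, ← hφ, h0, neg_zero]
  rw [Finset.sum_eq_zero_iff_of_nonneg hnn] at h0
  rw [Finset.sum_eq_zero_iff_of_nonneg hnp] at h0'
  refine weight_eq_of_tri (t := s) (fun u hu => ?_) (fun u hu => ?_) h
  · by_cases hut : u ∈ t.verts
    · have h3 := (h1 u hut).resolve_right fun h => hu h.2
      exact (mul_eq_zero.1 (h0 u (Finset.mem_univ _))).resolve_right h3.ne'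
    · exact hw.2 u hut
  · by_cases hut : u ∈ t'.verts
    · have h3 := (h2 u hut).resolve_right fun h => hu h.2
      exact (mul_eq_zero.1 (neg_eq_zero.1 (h0' u (Finset.mem_univ _)))).resolve_right h3.ne
    · exact hw'.2 u hut

/-- The triangles subdividing the quadrangle or the pentagon. -/
def midTris : List Tri := [.BDF, .BDG, .BGE]

theorem weight_eq_of_mid {a b : ℕ} {t t' : Tri} (ht : t ∈ midTris) (ht' : t' ∈ midTris)
    {w w' : Vtx → ℝ} (hw : IsWeight t.verts w) (hw' : IsWeight t'.verts w')
    (h : ∑ u, w u • vtx a b u = ∑ u, w' u • vtx a b u) : w = w' := by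
  have hb : (0 : ℝ) < b + 2 := by positivity
  have key1 : ∀ {w w'}, IsWeight Tri.BDF.verts w → IsWeight Tri.BDG.verts w' →
      ∑ u, w u • vtx a b u = ∑ u, w' u • vtx a b u → w = w' := fun hw hw' h => by
    refine weight_eq_of_separating (s := .BDG) (lineBD b) hw hw' h ?_ ?_ <;>
      simp [Tri.verts, lineBD_B, lineBD_D, lineBD_F, lineBD_G]
  have key2 : ∀ {w w'}, IsWeight Tri.BDF.verts w → IsWeight Tri.BGE.verts w' →
      ∑ u, w u • vtx a b u = ∑ u, w' u • vtx a b u → w = w' := fun hw hw' h => by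
    refine weight_eq_of_separating (s := .BDG) (lineBD b) hw hw' h ?_ ?_ <;>
      simp [Tri.verts, lineBD_B, lineBD_D, lineBD_F, lineBD_G, lineBD_E]
  have key3 : ∀ {w w'}, IsWeight Tri.BDG.verts w → IsWeight Tri.BGE.verts w' →
      ∑ u, w u • vtx a b u = ∑ u, w' u • vtx a b u → w = w' := fun hw hw' h => by
    refine weight_eq_of_separating (s := .BDG) (lineBG b) hw hw' h ?_ ?_ <;>
      simp [Tri.verts, lineBG_B, lineBG_D, lineBG_E, lineBG_G, hb]
  simp only [midTris, List.mem_cons, List.not_mem_nil, or_false] at ht ht'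
  rcases ht with rfl | rfl | rfl <;> rcases ht' with rfl | rfl | rfl
  · exact weight_eq_of_tri hw.2 hw'.2 h
  · exact key1 hw hw' h
  · exact key2 hw hw' h
  · exact (key1 hw' hw h.symm).symm
  · exact weight_eq_of_tri hw.2 hw'.2 h
  · exact key3 hw hw' h
  · exact (key2 hw' hw h.symm).symm
  · exact (key3 hw' hw h.symm).symm
  · exact weight_eq_of_tri hw.2 hw'.2 h

theorem label_injective (z : ℤ × ℤ) : Function.Injective (label z) := by
  have key : ∀ v w : Vtx, rep v = rep w → shift v = shift w → v = w := by decide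
  intro v w h
  simp only [label, Prod.mk.injEq, add_left_inj] at h
  exact key v w h.1 h.2

theorem label_neg_iff {z : ℤ × ℤ} {u v : Vtx} : label (-z) v = label 0 u ↔ label z u = label 0 v := by
  simp only [label, Prod.mk.injEq, add_zero, ← sub_eq_add_neg, sub_eq_iff_eq_add]
  exact ⟨fun h => ⟨h.1.symm, h.2.symm⟩, fun h => ⟨h.1.symm, h.2.symm⟩⟩

instance : DecidableEq Facet := fun x y => by
  cases x <;> cases y <;> first | exact isTrue rfl | exact isFalse (fun h => nomatch h)

/-- The vertices of a facet mapped by a period to vertices of another facet. -/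
def commonList (a : ℕ) (i j : Facet) (z : ℤ × ℤ) : List Vtx :=
  (facetList a i).filter fun u => (facetList a j).any fun v => decide (label z u = label 0 v)

theorem exists_tri_commonList : ∀ a ∈ [0, 1], ∀ i ∈ [Facet.ABF, .CDG, .CEG, .BDF, .BDGE],
    ∀ j ∈ [Facet.ABF, .CDG, .CEG, .BDF, .BDGE], ∀ z ∈ [((0 : ℤ), (0 : ℤ)), (0, 1), (0, -1), (1, 0),
      (1, 1), (1, -1), (-1, 0), (-1, 1), (-1, -1)],
    (z = 0 ∧ (i = j ∨ (i ∈ [Facet.BDF, .BDGE] ∧ j ∈ [Facet.BDF, .BDGE]))) ∨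
      ∃ s ∈ [Tri.ABF, .BDF, .BDG, .BGE, .CDG, .CEG], ∀ u ∈ commonList a i j z, u ∈ s.verts := by
  decide +kernel

/-- Two different translated facets share at most a side, so their common vertices fit into one
triangle. If nothing is shared, any triangle serves. -/
theorem exists_tri_common {a : ℕ} {i j : Facet} {z : ℤ × ℤ}
    (hz : ¬(z = 0 ∧ (i = j ∨ (i ∈ [Facet.BDF, .BDGE] ∧ j ∈ [Facet.BDF, .BDGE])))) :
    ∃ s : Tri, ∀ u ∈ facetVerts a i, ∀ v ∈ facetVerts a j, label z u = label 0 v →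
      u ∈ s.verts := by
  by_cases hex : ∃ u ∈ facetVerts a i, ∃ v ∈ facetVerts a j, label z u = label 0 v
  · obtain ⟨u, -, v, -, huv⟩ := hex
    have hz' : z = shift v - shift u := by
      have := congrArg Prod.snd huv
      simp only [label, add_zero] at this
      rw [← this, add_sub_cancel_left]
    have hmem : ∀ u v : Vtx, shift v - shift u ∈ [((0 : ℤ), (0 : ℤ)), (0, 1), (0, -1), (1, 0),
      (1, 1), (1, -1), (-1, 0), (-1, 1), (-1, -1)] := by decide +kernel
    have hi : ∀ i, i ∈ [Facet.ABF, .CDG, .CEG, .BDF, .BDGE] := by intro i; cases i <;> decide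
    have key : ∀ {a'}, a' ∈ [0, 1] → facetVerts a = facetVerts a' → ∃ s : Tri,
        ∀ u ∈ facetVerts a i, ∀ v ∈ facetVerts a j, label z u = label 0 v → u ∈ s.verts := by
      intro a' ha' heq
      obtain ⟨s, -, hs⟩ := (exists_tri_commonList a' ha' i (hi i) j (hi j) z
        (hz' ▸ hmem u v)).resolve_left hz
      refine ⟨s, fun u hu v hv huv => hs u ?_⟩
      rw [heq] at hu hv
      refine List.mem_filter.2 ⟨mem_facetList hu, List.any_eq_true.2 ⟨v, mem_facetList hv, ?_⟩⟩
      exact decide_eq_true huv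
    by_cases ha : a = 0
    · exact key (a' := 0) (by decide) (by rw [ha])
    · exact key (a' := 1) (by decide) (facetVerts_eq_one ha)
  · exact ⟨.ABF, fun u hu v hv huv => (hex ⟨u, hu, v, hv, huv⟩).elim⟩

theorem form_eq_one_of_weight {a b : ℕ} {S : Finset Vtx} {w : Vtx → ℝ} (hw : IsWeight S w)
    (hs : ∑ u, w u = 1) {h : SL(3, ℤ)} (hh : h ∈ periodGroup a b) {j : Facet}
    (h1 : facetForm a b j (act h (∑ u, w u • vtx a b u)) = 1) {u : Vtx} (hu : w u ≠ 0) :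
    facetForm a b j (act h (vtx a b u)) = 1 := by
  have hge : ∀ v, 1 ≤ facetForm a b j (act h (vtx a b v)) := fun v =>
    (mem_hull_iff.1 (vtx_mem_hull a b v)).2 _ hh _
  rw [map_sum, map_sum, ← hs] at h1
  have h4 : ∑ v, w v * (facetForm a b j (act h (vtx a b v)) - 1) = 0 := by
    rw [← sub_eq_zero.2 h1, ← Finset.sum_sub_distrib]
    refine Finset.sum_congr rfl fun v _ => ?_
    rw [map_smul, map_smul, smul_eq_mul]; ring
  rw [Finset.sum_eq_zero_iff_of_nonneg
    fun v _ => mul_nonneg (hw.1 v) (sub_nonneg.2 (hge v))] at h4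
  exact sub_eq_zero.1 ((mul_eq_zero.1 (h4 u (Finset.mem_univ _))).resolve_left hu)

/-- The weights carried back by a period. -/
noncomputable def pullWeight (z : ℤ × ℤ) (w : Vtx → ℝ) (u : Vtx) : ℝ :=
  ∑ v, if label z u = label 0 v then w v else 0

theorem sum_pullWeight {E : Type*} [AddCommGroup E] [Module ℝ E] {z : ℤ × ℤ} {w : Vtx → ℝ}
    {f f' : Vtx → E} (hf : ∀ u v, label z u = label 0 v → f u = f' v)
    (hw : ∀ v, w v ≠ 0 → ∃ u, label z u = label 0 v) :
    ∑ u, pullWeight z w u • f u = ∑ v, w v • f' v := by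
  simp only [pullWeight, Finset.sum_smul]
  rw [Finset.sum_comm]
  refine Finset.sum_congr rfl fun v _ => ?_
  by_cases h0 : w v = 0
  · simp [h0]
  · obtain ⟨u, hu⟩ := hw v h0
    rw [Finset.sum_eq_single u, if_pos hu, hf u v hu]
    · intro u' _ hne
      rw [if_neg, zero_smul]
      exact fun h => hne (label_injective z (h.trans hu.symm))
    · exact fun h => (h (Finset.mem_univ _)).elim

theorem modelVtx_eq (v : Vtx) :
    modelVtx v = modelVtx (rep v) + (((shift v).1 : ℝ), ((shift v).2 : ℝ)) := by
  cases v <;> simp [modelVtx, rep, shift]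

theorem modelVtx_of_label {z : ℤ × ℤ} {u v : Vtx} (h : label z u = label 0 v) :
    modelVtx u = modelVtx v - ((z.1 : ℝ), (z.2 : ℝ)) := by
  simp only [label, add_zero, Prod.mk.injEq] at h
  rw [modelVtx_eq u, modelVtx_eq v, h.1, ← h.2]
  ext <;> simp <;> ring

/-- This is the injectivity behind the homeomorphism. Within one planar region the weights agree by
independence or separation. Otherwise the equation forces both weights onto common vertices of two
translated facets; carried back by `z` they lie in one triangle and agree, and equal labels mean
model positions differing by `z`. -/
theorem eq_add_of_param_eq {a b : ℕ} {x y : ℝ × ℝ} {z : ℤ × ℤ} (hx : x ∈ unitSquare)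
    (hy : y ∈ unitSquare) (h : act (period a b z) (param a b x) = param a b y) :
    y = (x.1 + z.1, x.2 + z.2) := by
  obtain ⟨t, hw, hs, hwx⟩ := exists_hat_weight hx
  obtain ⟨t', hw', hs', hwy⟩ := exists_hat_weight hy
  by_cases hz : z = 0 ∧ (t.facet = t'.facet ∨
      (t.facet ∈ [Facet.BDF, .BDGE] ∧ t'.facet ∈ [Facet.BDF, .BDGE]))
  · obtain ⟨rfl, hz⟩ := hz
    rw [period_zero, act_one, LinearMap.id_apply] at h
    have hw0 : (fun u => hat u x) = fun u => hat u y := by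
      have htt : t = t' ∨ (t ∈ midTris ∧ t' ∈ midTris) := by
        revert hz
        cases t <;> cases t' <;> simp [Tri.facet, midTris]
      rcases htt with rfl | ⟨ht, ht'⟩
      · exact weight_eq_of_tri hw.2 hw'.2 h
      · exact weight_eq_of_mid ht ht' hw hw' h
    have hxy : x = y := by
      rw [← hwx, ← hwy]
      exact Finset.sum_congr rfl fun u _ => by rw [congrFun hw0 u]
    simp [hxy]
  · obtain ⟨s, hsv⟩ := exists_tri_common (a := a) hz
    have h' : param a b x = act (period a b (-z)) (param a b y) := by
      rw [← h, period_neg, act_inv_act]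
    have hsub := t.verts_subset_facet a
    have hsub' := t'.verts_subset_facet a
    have hsup : ∀ u, hat u x ≠ 0 → ∃ v ∈ facetVerts a t'.facet, label z u = label 0 v := by
      intro u hu
      have h1 : facetForm a b t'.facet (act (period a b z) (∑ u, hat u x • vtx a b u)) = 1 := by
        rw [← param, h, param, facetForm_sum hsub' hw'.2, hs']
      have h2 := form_eq_one_of_weight hw hs (period_mem a b z) h1 hu
      obtain ⟨v, hv, hvt⟩ := exists_vtx_of_extreme (vtx_mem_extremePoints a b u)
        (period_mem a b z) h2
      exact ⟨v, hv, act_period_vtx_eq_iff.1 hvt.symm⟩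
    have hsup' : ∀ v, hat v y ≠ 0 → ∃ u ∈ facetVerts a t.facet, label z u = label 0 v := by
      intro v hv
      have h1 : facetForm a b t.facet (act (period a b (-z)) (∑ u, hat u y • vtx a b u)) = 1 := by
        rw [← param, ← h', param, facetForm_sum hsub hw.2, hs]
      have h2 := form_eq_one_of_weight hw' hs' (period_mem a b (-z)) h1 hv
      obtain ⟨u, hu, hut⟩ := exists_vtx_of_extreme (vtx_mem_extremePoints a b v)
        (period_mem a b (-z)) h2
      exact ⟨u, hu, label_neg_iff.1 (act_period_vtx_eq_iff.1 hut.symm)⟩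
    have hex : ∀ v, hat v y ≠ 0 → ∃ u, label z u = label 0 v := fun v hv => by
      obtain ⟨u, -, hu⟩ := hsup' v hv
      exact ⟨u, hu⟩
    have e1 : ∑ u, pullWeight z (fun v => hat v y) u • vtx a b u = ∑ u, hat u x • vtx a b u := by
      rw [← param, h', param, map_sum]
      rw [sum_pullWeight (f' := fun v => act (period a b (-z)) (vtx a b v)) ?_ hex]
      · exact Finset.sum_congr rfl fun v _ => by rw [map_smul]
      · intro u v huv
        rw [← act_period_vtx_eq_iff.2 huv, period_neg, act_inv_act]
    have hww : (fun u => hat u x) = pullWeight z (fun v => hat v y) := by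
      refine weight_eq_of_tri (t := s) (fun u hu => ?_) (fun u hu => ?_) e1.symm
      · by_contra hne
        obtain ⟨v, hv, huv⟩ := hsup u hne
        exact hu (hsv u (hsub (by_contra fun hut => hne (hw.2 u hut))) v hv huv)
      · refine Finset.sum_eq_zero fun v _ => ?_
        by_contra hne
        have huv : label z u = label 0 v := by
          by_contra hc
          exact hne (if_neg hc)
        rw [if_pos huv] at hne
        obtain ⟨u', hu', hu'v⟩ := hsup' v hne
        rw [label_injective z (hu'v.trans huv.symm)] at hu'
        exact hu (hsv u hu' v (hsub' (by_contra fun hvt => hne (hw'.2 v hvt))) huv)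
    have e2 : ∑ u, pullWeight z (fun v => hat v y) u • modelVtx u =
        ∑ v, hat v y • (modelVtx v - ((z.1 : ℝ), (z.2 : ℝ))) :=
      sum_pullWeight (fun u v => modelVtx_of_label) hex
    have e3 : x = y - ((z.1 : ℝ), (z.2 : ℝ)) := by
      rw [← hww] at e2
      rw [← hwx, e2]
      simp only [smul_sub, Finset.sum_sub_distrib, ← Finset.sum_smul]
      rw [hwy, hs', one_smul]
    rw [e3]
    ext <;> simp

/-! ### The quotient of the sail is a Hausdorff space -/

noncomputable instance sailAction (a b : ℕ) : MulAction (sailGroup (familyOp a b) ![0, 0, 1])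
    (sail (familyOp a b) ![0, 0, 1]) where
  smul g x := ⟨act (g : SL(3, ℤ)) x, g.2.2.subset ⟨_, x.2, rfl⟩⟩
  one_smul x := Subtype.ext (by
    change act 1 (x : Fin 3 → ℝ) = x
    rw [act_one, LinearMap.id_apply])
  mul_smul g h x := Subtype.ext (by
    change act ((g : SL(3, ℤ)) * h) (x : Fin 3 → ℝ) = act g (act h x)
    rw [act_mul_apply])

instance (a b : ℕ) : ContinuousConstSMul (sailGroup (familyOp a b) ![0, 0, 1])
    (sail (familyOp a b) ![0, 0, 1]) where
  continuous_const_smul g :=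
    Continuous.subtype_mk ((continuous_act (g : SL(3, ℤ))).comp continuous_subtype_val) _

theorem sail_subset_openCone {a b : ℕ} {x : Fin 3 → ℝ}
    (hx : x ∈ sail (familyOp a b) ![0, 0, 1]) : x ∈ openCone a b :=
  (mem_hull_iff.1 (mem_sail_iff.1 hx).1).1

theorem exists_eigForm_bounds {a b : ℕ} {K : Set (sail (familyOp a b) ![0, 0, 1])}
    (hK : IsCompact K) :
    ∃ c > 0, ∃ C, ∀ x ∈ K, ∀ k, c ≤ eigForm a b k x ∧ eigForm a b k x ≤ C := by
  have hcont : ∀ k, ContinuousOn (fun x : sail (familyOp a b) ![0, 0, 1] =>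
      eigForm a b k x) K := fun k =>
    ((continuous_eigForm a b k).comp continuous_subtype_val).continuousOn
  rcases K.eq_empty_or_nonempty with rfl | hne
  · exact ⟨1, one_pos, 0, fun x hx => hx.elim⟩
  have hmin := fun k => hK.exists_isMinOn hne (hcont k)
  have hmax := fun k => hK.exists_isMaxOn hne (hcont k)
  choose p hp hpmin using hmin
  choose q hq hqmax using hmax
  obtain ⟨k0, -, hk0⟩ := Finset.exists_min_image (Finset.univ : Finset (Fin 3))
    (fun k => eigForm a b k (p k)) ⟨0, Finset.mem_univ _⟩
  obtain ⟨k1, -, hk1⟩ := Finset.exists_max_image (Finset.univ : Finset (Fin 3))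
    (fun k => eigForm a b k (q k)) ⟨0, Finset.mem_univ _⟩
  exact ⟨_, sail_subset_openCone (p k0).2 k0, _, fun x hx k =>
    ⟨(hk0 k (Finset.mem_univ _)).trans (hpmin k hx),
      (hqmax k hx).trans (hk1 k (Finset.mem_univ _))⟩⟩

instance (a b : ℕ) : ProperlyDiscontinuousSMul (sailGroup (familyOp a b) ![0, 0, 1])
    (sail (familyOp a b) ![0, 0, 1]) where
  finite_disjoint_inter_image {K L} hK hL := by
    obtain ⟨c, hc, C, hKb⟩ := exists_eigForm_bounds hK
    obtain ⟨c', hc', C', hLb⟩ := exists_eigForm_bounds hL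
    -- If `g` moves a point of `K` into `L`, each of its eigenvalues is at most the upper bound of
    -- the eigenforms on `L` divided by the lower bound on `K`.
    refine Set.Finite.of_finite_image (f := Subtype.val)
      ((finite_eigVal_le a b (C' / c)).subset ?_) Subtype.val_injective.injOn
    rintro _ ⟨g, hg, rfl⟩
    obtain ⟨_, ⟨x, hx, rfl⟩, hy⟩ := hg
    have hgp : (g : SL(3, ℤ)) ∈ positiveGroup a b := by
      refine periodGroup_le a b ?_
      rw [← sailGroup_eq]
      exact g.2
    refine ⟨hgp.1, fun k => ?_⟩
    have h1 := (hKb x hx k).1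
    have h2 := (hLb _ hy k).2
    have h3 := hgp.2 k
    change eigForm a b k (act (g : SL(3, ℤ)) x) ≤ C' at h2
    rw [eigForm_act hgp.1] at h2
    rw [abs_of_pos h3, le_div_iff₀ hc]
    exact (mul_le_mul_of_nonneg_left h1 h3.le).trans h2

instance (a b : ℕ) : LocallyCompactSpace (sail (familyOp a b) ![0, 0, 1]) :=
  (isClosed_sail a b).isClosedEmbedding_subtypeVal.locallyCompactSpace

theorem sailSetoid_eq (a b : ℕ) : sailSetoid (familyOp a b) ![0, 0, 1] =
    MulAction.orbitRel (sailGroup (familyOp a b) ![0, 0, 1])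
      (sail (familyOp a b) ![0, 0, 1]) := by
  ext x y
  rw [MulAction.orbitRel_apply, ← MulAction.orbitRel_apply, Setoid.comm', MulAction.orbitRel_apply]
  constructor
  · rintro ⟨g, hg, h⟩
    exact ⟨⟨g, hg⟩, Subtype.ext h⟩
  · rintro ⟨g, h⟩
    exact ⟨g, g.2, congrArg Subtype.val h⟩

instance (a b : ℕ) : T2Space (SailQuotient (familyOp a b) ![0, 0, 1]) := by
  change T2Space (Quotient (sailSetoid (familyOp a b) ![0, 0, 1]))
  rw [sailSetoid_eq]
  exact t2Space_of_properlyDiscontinuousSMul_of_t2Space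

/-! ### The homeomorphism with the torus -/

/-- The map from the model square to the quotient of the sail. -/
noncomputable def squareToQuotient (a b : ℕ) (x : unitSquare) :
    SailQuotient (familyOp a b) ![0, 0, 1] :=
  Quotient.mk _ ⟨param a b x, param_mem_sail x.2⟩

/-- The map from the model square to the torus. -/
def squareToTorus (x : unitSquare) : UnitAddCircle × UnitAddCircle := torusMk x

theorem continuous_squareToQuotient (a b : ℕ) : Continuous (squareToQuotient a b) :=
  continuous_quotient_mk'.comp
    (((continuous_param a b).comp continuous_subtype_val).subtype_mk _)

theorem continuous_torusMk : Continuous torusMk :=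
  ((AddCircle.continuous_mk' 1).comp continuous_fst).prodMk
    ((AddCircle.continuous_mk' 1).comp continuous_snd)

theorem continuous_squareToTorus : Continuous squareToTorus :=
  continuous_torusMk.comp continuous_subtype_val

theorem surjective_squareToTorus : Function.Surjective squareToTorus := by
  rintro ⟨p, q⟩
  obtain ⟨x, hx, rfl⟩ := AddCircle.eq_coe_Ico p
  obtain ⟨y, hy, rfl⟩ := AddCircle.eq_coe_Ico q
  exact ⟨⟨(x, y), mem_unitSquare.2 ⟨⟨hx.1, hy.1⟩, hx.2.le, hy.2.le⟩⟩, rfl⟩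

theorem surjective_squareToQuotient (a b : ℕ) : Function.Surjective (squareToQuotient a b) := by
  intro c
  induction c using Quotient.inductionOn with
  | h p =>
    obtain ⟨g, hg, x, hx, hgx⟩ := exists_param_of_mem_sail p.2
    have hg' : g ∈ sailGroup (familyOp a b) ![0, 0, 1] := by rwa [sailGroup_eq]
    refine ⟨⟨x, hx⟩, Eq.symm (Quotient.sound ?_)⟩
    exact ⟨g, hg', hgx⟩

theorem squareToQuotient_eq_iff {a b : ℕ} {x y : unitSquare} :
    squareToQuotient a b x = squareToQuotient a b y ↔ squareToTorus x = squareToTorus y := by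
  rw [squareToTorus, squareToTorus, torusMk_eq_iff]
  constructor
  · intro h
    obtain ⟨g, hg, hgx⟩ := Quotient.exact h
    rw [sailGroup_eq, mem_periodGroup_iff] at hg
    obtain ⟨z, rfl⟩ := hg
    exact ⟨z, eq_add_of_param_eq x.2 y.2 hgx⟩
  · rintro ⟨z, hz⟩
    refine Quotient.sound ⟨period a b z, ?_, ?_⟩
    · rw [sailGroup_eq]; exact period_mem a b z
    · change act (period a b z) (param a b x) = param a b y
      rw [hz, param_add a b x.2 (by rw [← hz]; exact y.2)]

instance : CompactSpace unitSquare := isCompact_iff_compactSpace.1 isCompact_Icc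

/-- Both maps from the compact square are surjective with the same fibres. The induced continuous
bijection goes from a compact space to a Hausdorff one. -/
theorem exists_homeomorph_torus (a b : ℕ) :
    ∃ h : SailQuotient (familyOp a b) ![0, 0, 1] ≃ₜ UnitAddCircle × UnitAddCircle,
      ∀ x : unitSquare, h (squareToQuotient a b x) = squareToTorus x := by
  let q : C(unitSquare, SailQuotient (familyOp a b) ![0, 0, 1]) :=
    ⟨squareToQuotient a b, continuous_squareToQuotient a b⟩
  let p : C(unitSquare, UnitAddCircle × UnitAddCircle) :=
    ⟨squareToTorus, continuous_squareToTorus⟩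
  have hq : Topology.IsQuotientMap q :=
    q.continuous.isClosedMap.isQuotientMap q.continuous (surjective_squareToQuotient a b)
  have : CompactSpace (SailQuotient (familyOp a b) ![0, 0, 1]) :=
    (surjective_squareToQuotient a b).compactSpace (continuous_squareToQuotient a b)
  have hfib : Function.FactorsThrough p q := fun x y h => squareToQuotient_eq_iff.1 h
  let f : C(SailQuotient (familyOp a b) ![0, 0, 1], UnitAddCircle × UnitAddCircle) :=
    hq.lift p hfib
  have hf : ∀ x, f (squareToQuotient a b x) = squareToTorus x := fun x =>
    congrArg (fun g : C(unitSquare, UnitAddCircle × UnitAddCircle) => g x) (hq.lift_comp p hfib)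
  have hbij : Function.Bijective f := by
    constructor
    · intro c c' h
      obtain ⟨x, rfl⟩ := surjective_squareToQuotient a b c
      obtain ⟨y, rfl⟩ := surjective_squareToQuotient a b c'
      rw [hf, hf] at h
      exact squareToQuotient_eq_iff.2 h
    · intro p
      obtain ⟨x, rfl⟩ := surjective_squareToTorus p
      exact ⟨_, hf x⟩
  exact ⟨f.continuous.homeoOfEquivCompactToT2 (f := Equiv.ofBijective f hbij), hf⟩

/-! ### The images of the cells under the homeomorphism -/

theorem modelCell_eq (s : Set Vtx) : modelCell s = torusMk '' convexHull ℝ (modelVtx '' s) := rfl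

theorem sailProj_act_image {a b : ℕ} {g : SL(3, ℤ)} (hg : g ∈ periodGroup a b)
    (F : Set (Fin 3 → ℝ)) : sailProj (familyOp a b) ![0, 0, 1] (act g '' F) =
      sailProj (familyOp a b) ![0, 0, 1] F := by
  have key : ∀ {g}, g ∈ periodGroup a b → ∀ F, sailProj (familyOp a b) ![0, 0, 1] F ⊆
      sailProj (familyOp a b) ![0, 0, 1] (act g '' F) := by
    rintro g hg F _ ⟨x, hx, rfl⟩
    have hg' : g ∈ sailGroup (familyOp a b) ![0, 0, 1] := by rwa [sailGroup_eq]
    have hgx : act g x ∈ sail (familyOp a b) ![0, 0, 1] := hg'.2.subset ⟨x, x.2, rfl⟩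
    refine ⟨⟨act g x, hgx⟩, ⟨x, hx, rfl⟩, Eq.symm (Quotient.sound ?_)⟩
    exact ⟨g, hg', rfl⟩
  refine Set.Subset.antisymm ?_ (key hg F)
  have h := key (inv_mem hg) (act g '' F)
  rw [← Set.image_comp] at h
  have hid : (act g⁻¹ : (Fin 3 → ℝ) → _) ∘ act g = id := funext (act_inv_act g)
  rwa [hid, Set.image_id] at h

theorem homeomorph_image_cell {a b : ℕ}
    {h : SailQuotient (familyOp a b) ![0, 0, 1] ≃ₜ UnitAddCircle × UnitAddCircle}
    (hh : ∀ x : unitSquare, h (squareToQuotient a b x) = squareToTorus x) {k : ℕ} {S : Finset Vtx}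
    (hS : S ∈ cellFinsets a k) :
    h '' sailProj (familyOp a b) ![0, 0, 1] (convexHull ℝ (vtx a b '' S)) = modelCell S := by
  rw [← param_image_cell hS, modelCell_eq]
  ext p
  constructor
  · rintro ⟨_, ⟨⟨_, hq⟩, ⟨x, hx, rfl⟩, rfl⟩, rfl⟩
    exact ⟨x, hx, (hh ⟨x, model_subset_unitSquare _ hx⟩).symm⟩
  · rintro ⟨x, hx, rfl⟩
    have hsq := model_subset_unitSquare _ hx
    exact ⟨_, ⟨⟨param a b x, param_mem_sail hsq⟩, ⟨x, hx, rfl⟩, rfl⟩, hh ⟨x, hsq⟩⟩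

theorem exists_homeomorph_cells (a b : ℕ) :
    ∃ h : SailQuotient (familyOp a b) ![0, 0, 1] ≃ₜ UnitAddCircle × UnitAddCircle,
      (∀ k, (fun c => h '' c) '' torusCells (familyOp a b) ![0, 0, 1] k = modelCells a k) ∧
      ∀ k, ∀ s ∈ cells a k,
        h '' sailProj (familyOp a b) ![0, 0, 1] (convexHull ℝ (vtx a b '' s)) = modelCell s := by
  obtain ⟨h, hh⟩ := exists_homeomorph_torus a b
  have hcell : ∀ k, ∀ s ∈ cells a k,
      h '' sailProj (familyOp a b) ![0, 0, 1] (convexHull ℝ (vtx a b '' s)) = modelCell s := by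
    intro k s hs
    obtain ⟨S, hS, rfl⟩ := mem_cells_iff.1 hs
    exact homeomorph_image_cell hh hS
  refine ⟨h, fun k => ?_, hcell⟩
  ext c
  constructor
  · rintro ⟨_, ⟨F, hF, rfl⟩, rfl⟩
    obtain ⟨S, hS, z, rfl⟩ := exists_cell_of_isSailFace hF
    refine ⟨S, mem_cells_iff.2 ⟨S, hS, rfl⟩, ?_⟩
    change h '' _ = _
    rw [sailProj_act_image (period_mem a b z)]
    exact homeomorph_image_cell hh hS
  · rintro ⟨s, hs, rfl⟩
    obtain ⟨S, hS, rfl⟩ := mem_cells_iff.1 hs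
    exact ⟨_, ⟨_, isSailFace_cell hS, rfl⟩, hcell k S hs⟩

/-! ### Integer points on an edge -/

theorem integerPoints_BD (a b : ℕ) :
    (openSegment ℝ (vtx a b .B) (vtx a b .D) ∩ integerPoints).ncard = b + 1 := by
  have hb : (0 : ℝ) < b + 2 := by positivity
  -- `B - D` is `b + 2` times the vector `(b+3, b+2, b+1)`, whose first two coordinates differ by
  -- `1`; so the parameter `n` is read off as `z 0 - z 1`.
  let f : ℤ → Fin 3 → ℝ := fun n => ![n * (b + 3), n * (b + 2), n * (b + 1) + 1]
  have hinj : Function.Injective f := by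
    intro n m h
    have h1 := congrFun h 1
    simp only [f, Matrix.cons_val] at h1
    exact_mod_cast mul_right_cancel₀ hb.ne' h1
  have hset : openSegment ℝ (vtx a b .B) (vtx a b .D) ∩ integerPoints =
      f '' (Finset.Icc (1 : ℤ) (b + 1) : Finset ℤ) := by
    ext p
    constructor
    · rintro ⟨⟨s, t, hs, ht, hst, rfl⟩, z, hz⟩
      have h0 := congrFun hz 0
      have h1 := congrFun hz 1
      have ht' : t = 1 - s := by linarith
      subst ht'
      simp only [vtx_B, vtx_D, Pi.add_apply, Pi.smul_apply, Matrix.cons_val, smul_eq_mul] at h0 h1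
      have hn : ((z 0 - z 1 : ℤ) : ℝ) = s * (b + 2) := by
        push_cast
        rw [← h0, ← h1]; ring
      refine ⟨z 0 - z 1, ?_, ?_⟩
      · rw [Finset.coe_Icc, Set.mem_Icc]
        have hpos : (0 : ℝ) < ((z 0 - z 1 : ℤ) : ℝ) := by rw [hn]; positivity
        have hlt : ((z 0 - z 1 : ℤ) : ℝ) < b + 2 := by rw [hn]; nlinarith
        have hpos' : (0 : ℤ) < z 0 - z 1 := by exact_mod_cast hpos
        have hlt' : z 0 - z 1 < (b : ℤ) + 2 := by exact_mod_cast hlt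
        constructor <;> lia
      · funext i
        simp only [f, hn]
        fin_cases i <;> simp [vtx_B, vtx_D] <;> ring
    · rintro ⟨n, hn, rfl⟩
      rw [Finset.coe_Icc, Set.mem_Icc] at hn
      have h1 : (1 : ℝ) ≤ n := by exact_mod_cast hn.1
      have h2 : (n : ℝ) ≤ b + 1 := by exact_mod_cast hn.2
      refine ⟨⟨n / (b + 2), 1 - n / (b + 2), by positivity, ?_, by ring, ?_⟩,
        ![n * (b + 3), n * (b + 2), n * (b + 1) + 1], ?_⟩
      · rw [sub_pos, div_lt_one hb]; linarith
      · funext i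
        simp only [f]
        fin_cases i <;> simp [vtx_B, vtx_D] <;> field_simp <;> ring
      · funext i
        simp only [f]
        fin_cases i <;> simp
  rw [hset, Set.ncard_image_of_injective _ hinj, Set.ncard_coe_finset, Int.card_Icc]
  lia

theorem act_image_segment (g : SL(3, ℤ)) (x y : Fin 3 → ℝ) :
    act g '' segment ℝ x y = segment ℝ (act g x) (act g y) :=
  image_segment ℝ (act g).toAffineMap x y

end FrobeniusSail

theorem proposition3p5 (a b : ℕ) :
    -- the operator defines a two-dimensional continued fraction of a cubic irrationality
    IsCubicIrrationality (familyOp a b) ∧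
    -- the torus triangulation is homeomorphic to the model
    (∃ h : SailQuotient (familyOp a b) ![0, 0, 1] ≃ₜ UnitAddCircle × UnitAddCircle,
      (∀ k, (fun c => h '' c) '' torusCells (familyOp a b) ![0, 0, 1] k = modelCells a k) ∧
      ∀ k, ∀ s ∈ cells a k,
        h '' sailProj (familyOp a b) ![0, 0, 1] (convexHull ℝ (vtx a b '' s)) = modelCell s) ∧
    -- the periods freely generate the group
    Subgroup.closure {periodX a b, periodY a b} = sailGroup (familyOp a b) ![0, 0, 1] ∧
    (∀ i j : ℤ, periodX a b ^ i * periodY a b ^ j = 1 → i = 0 ∧ j = 0) ∧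
    -- the fundamental region and the vertices in its closure
    IsFundamentalRegion (familyOp a b) ![0, 0, 1] (regionFaces a b) ∧
    {v | IsSailFace (familyOp a b) ![0, 0, 1] 0 {v} ∧ ∃ k, ∃ F ∈ regionFaces a b k, v ∈ F} =
      Set.range (vtx a b) ∧
    -- the gluing of the boundary
    act (periodX a b) (vtx a b .A) = vtx a b .D ∧
    act (periodX a b) (vtx a b .B) = vtx a b .C ∧
    act (periodX a b) '' segment ℝ (vtx a b .A) (vtx a b .B) =
      segment ℝ (vtx a b .D) (vtx a b .C) ∧
    act (periodY a b) (vtx a b .A) = vtx a b .B ∧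
    act (periodY a b) (vtx a b .F) = vtx a b .E ∧
    act (periodY a b) (vtx a b .D) = vtx a b .C ∧
    act (periodY a b) ''
        (segment ℝ (vtx a b .A) (vtx a b .F) ∪ segment ℝ (vtx a b .F) (vtx a b .D)) =
      segment ℝ (vtx a b .B) (vtx a b .E) ∪ segment ℝ (vtx a b .E) (vtx a b .C) ∧
    -- the integer points inside the segment
    (openSegment ℝ (vtx a b .B) (vtx a b .D) ∩ integerPoints).ncard = b + 1 := by
  open FrobeniusSail in
  refine ⟨isCubicIrrationality_familyOp a b, exists_homeomorph_cells a b, (sailGroup_eq a b).symm,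
    periods_independent a b, isFundamentalRegion_regionFaces a b, vertices_closure_region a b,
    act_periodX_A a b, act_periodX_B a b, ?_, act_periodY_A a b, act_periodY_F a b,
    act_periodY_D a b, ?_, integerPoints_BD a b⟩
  · rw [FrobeniusSail.act_image_segment, FrobeniusSail.act_periodX_A,
      FrobeniusSail.act_periodX_B]
  · rw [Set.image_union, FrobeniusSail.act_image_segment, FrobeniusSail.act_image_segment,
      FrobeniusSail.act_periodY_A, FrobeniusSail.act_periodY_F, FrobeniusSail.act_periodY_D]
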